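/- **Notation.** For $c=(c_1,c_2,c_3)\in\mathbb R^3$ let $P_c(x)=c_1(1-x)+c_2(1+x)+c_3(1-x^2)$. For $\nu\ge 0$ let $$\bar c_3(c_1,c_2;\nu)=-\tfrac12\big(\sqrt{\nu^2+c_1}+\sqrt{\nu^2+c_2}\big)\big(\sqrt{\nu^2+c_1}+\sqrt{\nu^2+c_2}+2\nu\big),$$ $$J_\nu=\{c\in\mathbb R^3 : c_1\ge-\nu^2,\ c_2\ge-\nu^2,\ c_3\ge\bar c_3(c_1,c_2;\nu)\},\qquad c_3^*(c_1,c_2)=\bar c_3(c_1,c_2;0)=-\tfrac12(\sqrt{c_1}+\sqrt{c_2})^2 .$$ For $\nu>0$ and $c\in J_\nu$ let $U^+_\nu(c)$ and $U^-_\nu(c)$ be the largest and the smallest solution on $(-1,1)$ of $$\nu(1-x^2)U'+2\nu xU+\tfrac12U^2=P_c(x),\qquad -1<x<1,$$ that is, for every $x\in(-1,1)$ the largest and the smallest value at $x$ of a solution on $(-1,1)$; both are extended continuously to $[-1,1]$. For $0<\beta<1$ the norm of $C^\beta$ is the supremum norm plus the Hölder seminorm, and the norm of $C^m$ is the sum of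 the suprema of the derivatives of order at most $m$. **Theorem 1.6.** Let $c\in\mathbb R^3$, $c\neq0$, with $c_3=c_3^*(c_1,c_2)$. Consider sequences $\nu_k\to0^+$ and $c_k=(c_{k1},c_{k2},c_{k3})\in J_{\nu_k}$ with $c_k\to c$. The constants $C$ below depend only on the quantities named, not on the sequences; how large $k$ must be may depend on the sequences. (i) If $c_k\in J_0$ for all $k$, then $$\lim_{k\to\infty}\big\|U^{\pm}_{\nu_k}(c_k)\mp\sqrt{2P_c}\big\|_{L^\infty(-1,1)}=0,$$ and for any $\epsilon>0$ and $0<\beta<2/3$ there is a constant $C$, depending only on $c,\epsilon,\beta$, such that for large $k$ $$\big\|\tfrac12(U^\pm_{\nu_k}(c_k))^2-P_{c_k}\big\|_{L^\infty(-1,1)}+\nu_k^\beta\big\|\tfrac12(U^\pm_{\nu_k}(c_k))^2-P_{c_k}\big\|_{C^\beta(-1+\epsilon,1-\epsilon)}\le C\nu_k^{2/3}.$$ Moreover $\bar x:=\frac{\sqrt{c_1}-\sqrt{c_2}}{\sqrt{c_1}+\sqrt{c_2}}\in[-1,1]$, and for any $\epsilon>0$ and any integer $m\ge0$ there is a constant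 $C$, depending only on $c,m,\epsilon$, such that for large $k$ $$\big\|U^+_{\nu_k}(c_k)-\sqrt{2P_{c_k}}\big\|_{C^m([-1,1-\epsilon]\setminus[\bar x-\epsilon,\bar x+\epsilon])}+\big\|U^-_{\nu_k}(c_k)+\sqrt{2P_{c_k}}\big\|_{C^m([-1+\epsilon,1]\setminus[\bar x-\epsilon,\bar x+\epsilon])}\le C\nu_k .$$ (ii) If $c_2=0$, then $\lim_{k\to\infty}\|U^+_{\nu_k}(c_k)-\sqrt{2P_c}\|_{L^\infty(-1,1)}=0$, and there is a constant $C$, depending only on $c$, such that for large $k$ $$\big\|\tfrac12(U^+_{\nu_k}(c_k))^2-P_{c_k}\big\|_{L^\infty(-1,1)}\le C\big(|c_{k2}|+|2c_{k3}+c_{k1}|^2+\nu_k^{2/3}\big)=o(1).$$ (iii) If $c_1=0$, then $\lim_{k\to\infty}\|U^-_{\nu_k}(c_k)+\sqrt{2P_c}\|_{L^\infty(-1,1)}=0$, and there is a constant $C$, depending only on $c$, such that for large $k$ $$\big\|\tfrac12(U^-_{\nu_k}(c_k))^2-P_{c_k}\big\|_{L^\infty(-1,1)}\le C\big(|c_{k1}|+|2c_{k3}+c_{k2}|^2+\nu_k^{2/3}\big)=o(1).$$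 -/

import Mathlib

open Set Filter Topology MeasureTheory
open scoped NNReal ENNReal

noncomputable section

namespace AxisymNS

/-- The quadratic `P_c(x) = c₁ (1 - x) + c₂ (1 + x) + c₃ (1 - x²)`, where `c = (c₁, c₂, c₃)`. -/
def P (c : ℝ × ℝ × ℝ) (x : ℝ) : ℝ :=
  c.1 * (1 - x) + c.2.1 * (1 + x) + c.2.2 * (1 - x ^ 2)

/-- `c̄₃(c₁, c₂; ν)`. -/
def c3bar (c₁ c₂ ν : ℝ) : ℝ :=
  -(1 / 2) * (√(ν ^ 2 + c₁) + √(ν ^ 2 + c₂)) * (√(ν ^ 2 + c₁) + √(ν ^ 2 + c₂) + 2 * ν)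

/-- The parameter set `J_ν`, for `ν ≥ 0`. -/
def J (ν : ℝ) : Set (ℝ × ℝ × ℝ) :=
  {c | -ν ^ 2 ≤ c.1 ∧ -ν ^ 2 ≤ c.2.1 ∧ c3bar c.1 c.2.1 ν ≤ c.2.2}

/-- `c₃*(c₁, c₂) = c̄₃(c₁, c₂; 0)`. -/
def c3star (c₁ c₂ : ℝ) : ℝ := c3bar c₁ c₂ 0

/-- The double zero `x̄` of `P_c` when `c₃ = c₃*(c₁, c₂)`. -/
def xbar (c : ℝ × ℝ × ℝ) : ℝ := (√c.1 - √c.2.1) / (√c.1 + √c.2.1)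

/-- `U` solves `ν (1 - x²) U' + 2 ν x U + U² / 2 = P_c` on `(-1, 1)`. -/
def IsSolution (ν : ℝ) (c : ℝ × ℝ × ℝ) (U : ℝ → ℝ) : Prop :=
  ∀ x ∈ Ioo (-1 : ℝ) 1, DifferentiableAt ℝ U x ∧
    ν * (1 - x ^ 2) * deriv U x + 2 * ν * x * U x + 1 / 2 * U x ^ 2 = P c x

/-- The upper solution `U⁺_ν(c)`: on `(-1, 1)` the pointwise largest value of a solution,
extended by continuity to the endpoints of `(-1, 1)`. -/
def upperSol (ν : ℝ) (c : ℝ × ℝ × ℝ) : ℝ → ℝ :=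
  extendFrom (Ioo (-1) 1) fun x => sSup {y | ∃ U, IsSolution ν c U ∧ U x = y}

/-- The lower solution `U⁻_ν(c)`: on `(-1, 1)` the pointwise smallest value of a solution,
extended by continuity to the endpoints of `(-1, 1)`. -/
def lowerSol (ν : ℝ) (c : ℝ × ℝ × ℝ) : ℝ → ℝ :=
  extendFrom (Ioo (-1) 1) fun x => sInf {y | ∃ U, IsSolution ν c U ∧ U x = y}

/-- The norm of `L^∞(-1, 1)`. -/
def linfNorm (f : ℝ → ℝ) : ℝ≥0∞ := eLpNorm f ∞ (volume.restrict (Ioo (-1) 1))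

/-- The Hölder norm of `C^β(S)`, for `0 < β < 1`: supremum norm plus Hölder seminorm. -/
def holderNorm (β : ℝ≥0) (f : ℝ → ℝ) (S : Set ℝ) : ℝ≥0∞ :=
  (⨆ x ∈ S, ‖f x‖ₑ) + eHolderNorm β (S.domRestrict f)

open Classical in
/-- The norm of `C^m(S)`, the sum of the suprema on `S` of the derivatives of order at most `m`;
it is `∞` for a function that is not `C^m` on `S`. -/
def cmNorm (m : ℕ) (f : ℝ → ℝ) (S : Set ℝ) : ℝ≥0∞ :=
  if ContDiffOn ℝ m f S then
    ∑ j ∈ Finset.range (m + 1), ⨆ x ∈ S, ‖iteratedDerivWithin j f S x‖ₑ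
  else ∞

/-- `ν_k → 0⁺`, `c_k ∈ J_{ν_k}` and `c_k → c`. -/
structure IsVanishing (c : ℝ × ℝ × ℝ) (ν : ℕ → ℝ) (ck : ℕ → ℝ × ℝ × ℝ) : Prop where
  pos : ∀ k, 0 < ν k
  tendsto_zero : Tendsto ν atTop (𝓝 0)
  mem : ∀ k, ck k ∈ J (ν k)
  tendsto : Tendsto ck atTop (𝓝 c)

end AxisymNS

end

open AxisymNS

noncomputable section

namespace AxisymNS

/-! The equation is of Riccati type. When $c_3=\bar c_3$ it has the affine solution `affSol`. In
general, put $U=\mathrm{affSol}+2\nu(1-x^2)h'/h$; in the variable $t=(1+x)/2$ the function $h$ then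
solves a hypergeometric equation whose zero-order coefficient is nonnegative exactly because
$c_3\ge\bar c_3$. The power series regular at $x=-1$ therefore has nonnegative coefficients, so
$h\ge1$ on $[-1,1)$ and `maxSol` is analytic up to and across $-1$. A solution lying above it at
some point would have, after multiplication by an integrating factor, a difference whose reciprocal
becomes negative before $-1$ is reached (`IsSolution.le_maxSol`). Hence `maxSol` is $U^+_\nu$. The
reflection $x\mapsto-x$, $U\mapsto-U$, $c_1\leftrightarrow c_2$ exchanges $U^+$ and $U^-$, so only
$U^+$ needs estimates.

Sup estimate. Suppose $U\ge-\theta$, $P\ge-\eta$, $\nu\le\theta^3$ and $\eta\le\theta^2$.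
First-crossing barriers give $|U^2/2-P|\le C\theta^2$ (`maxSol_upper_bound`, `maxSol_lower_bound`):
at a contact point the reaction term beats the derivative of the barrier multiplied by $\nu$, and
this balance is the source of the exponent $2/3$. The bound $U\ge-\theta$ also selects the positive
root of $2P$. For parameters in $J_0$ one has $P\ge0$ and $U\ge-2\nu$, and $\theta=\nu^{1/3}$ is
admissible. For $c_2=0$, $\theta^2$ is a multiple of the stated error, and $U\ge\mathrm{affSol}$
gives the lower bound.

Hölder estimate. Inserting the sup estimate into the equation gives $U'=O(\nu^{-1/3})$ in the
interior; interpolation does the rest.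

$C^m$ estimate. For $c_3=c_3^*$, $P_c$ is half a perfect square vanishing only at $\bar x$. Away
from $\bar x$ and $1$, the remainder $U-\sqrt{2P}$ and each of its derivatives solve
$\nu(1-x^2)E'+\kappa E=O(\nu)$ with $\kappa\ge\delta>0$. On the left the equation itself gives
$E(-1)=O(\nu)$; to the right of $\bar x$ bounded data decay like $e^{-\delta(x-p)/\nu}$. Induction
on the order of the derivative concludes.

All estimates hold eventually along the filter `vanFilter`, so their constants are chosen before any
sequence. -/

/-! ### Power series with polynomially bounded coefficients -/

/-- The coefficients `a n` grow at most polynomially. -/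
def PolyBounded (a : ℕ → ℝ) : Prop := ∃ C : ℝ, ∃ N : ℕ, ∀ n, |a n| ≤ C * ((n : ℝ) + 1) ^ N

/-- The sum of the power series with coefficients `a`. -/
def psum (a : ℕ → ℝ) (t : ℝ) : ℝ := ∑' n, a n * t ^ n

/-- The coefficients of the termwise derivative. -/
def dcoef (a : ℕ → ℝ) (n : ℕ) : ℝ := ((n : ℝ) + 1) * a (n + 1)

lemma PolyBounded.dcoef {a : ℕ → ℝ} (h : PolyBounded a) : PolyBounded (dcoef a) := by
  obtain ⟨C, N, h⟩ := h
  have hC : 0 ≤ C := by simpa using (abs_nonneg _).trans (h 0)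
  refine ⟨C * 2 ^ N, N + 1, fun n => ?_⟩
  have hn : (0 : ℝ) ≤ n := n.cast_nonneg
  rw [AxisymNS.dcoef, abs_mul, abs_of_nonneg (by positivity)]
  have h1 := h (n + 1)
  push_cast at h1
  have h2 : ((n : ℝ) + 1 + 1) ^ N ≤ 2 ^ N * ((n : ℝ) + 1) ^ N := by
    rw [← mul_pow]; exact pow_le_pow_left₀ (by positivity) (by linarith) _
  calc ((n : ℝ) + 1) * |a (n + 1)| ≤ ((n : ℝ) + 1) * (C * (2 ^ N * ((n : ℝ) + 1) ^ N)) := by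
        exact mul_le_mul_of_nonneg_left
          (h1.trans (mul_le_mul_of_nonneg_left h2 hC)) (by positivity)
    _ = C * 2 ^ N * ((n : ℝ) + 1) ^ (N + 1) := by ring

lemma PolyBounded.summable_abs {a : ℕ → ℝ} (h : PolyBounded a) {t : ℝ} (ht : |t| < 1) :
    Summable fun n => |a n| * |t| ^ n := by
  obtain ⟨C, N, h⟩ := h
  have hC : 0 ≤ C := by simpa using (abs_nonneg _).trans (h 0)
  have hs : Summable fun n : ℕ => C * (2 ^ N * ((n : ℝ) ^ N * |t| ^ n) + 2 ^ N * |t| ^ n) := by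
    have h1 : Summable fun n : ℕ => (n : ℝ) ^ N * |t| ^ n :=
      summable_pow_mul_geometric_of_norm_lt_one (R := ℝ) N (r := |t|) (by simpa using ht)
    have h2 := summable_geometric_of_lt_one (abs_nonneg t) ht
    exact ((h1.mul_left (2 ^ N)).add (h2.mul_left (2 ^ N))).mul_left C
  refine Summable.of_nonneg_of_le (fun n => by positivity) (fun n => ?_) hs
  have h2 : ((n : ℝ) + 1) ^ N ≤ 2 ^ N * (n : ℝ) ^ N + 2 ^ N := by
    rcases Nat.eq_zero_or_pos n with rfl | hn
    · have : (1 : ℝ) ≤ 2 ^ N := one_le_pow₀ (by norm_num)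
      have h0 : (0 : ℝ) ≤ 2 ^ N * ((0 : ℕ) : ℝ) ^ N := by positivity
      simp only [Nat.cast_zero, zero_add, one_pow] at h0 ⊢
      linarith
    · have hn' : (1 : ℝ) ≤ n := by exact_mod_cast hn
      have : ((n : ℝ) + 1) ^ N ≤ 2 ^ N * (n : ℝ) ^ N := by
        rw [← mul_pow]; exact pow_le_pow_left₀ (by positivity) (by linarith) _
      have : (0 : ℝ) ≤ 2 ^ N := by positivity
      linarith
  calc |a n| * |t| ^ n ≤ C * (2 ^ N * (n : ℝ) ^ N + 2 ^ N) * |t| ^ n := by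
        exact mul_le_mul_of_nonneg_right
          ((h n).trans (mul_le_mul_of_nonneg_left h2 hC)) (by positivity)
    _ = C * (2 ^ N * ((n : ℝ) ^ N * |t| ^ n) + 2 ^ N * |t| ^ n) := by ring

lemma PolyBounded.summable {a : ℕ → ℝ} (h : PolyBounded a) {t : ℝ} (ht : |t| < 1) :
    Summable fun n => a n * t ^ n := by
  refine Summable.of_norm ?_
  simpa [abs_mul] using h.summable_abs ht

lemma PolyBounded.hasSum {a : ℕ → ℝ} (h : PolyBounded a) {t : ℝ} (ht : |t| < 1) :
    HasSum (fun n => a n * t ^ n) (psum a t) := (h.summable ht).hasSum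

lemma PolyBounded.hasDerivAt {a : ℕ → ℝ} (h : PolyBounded a) {t : ℝ} (ht : |t| < 1) :
    HasDerivAt (psum a) (psum (AxisymNS.dcoef a) t) t := by
  obtain ⟨r, hr1, hr2⟩ := exists_between ht
  have hr0 : 0 < r := (abs_nonneg t).trans_lt hr1
  have hrr : |r| < 1 := by rwa [abs_of_pos hr0]
  have hu : Summable fun n : ℕ => |a n| * (n * r ^ (n - 1)) := by
    rw [← summable_nat_add_iff 1]
    refine (h.dcoef.summable_abs hrr).congr fun n => ?_
    have : (0 : ℝ) ≤ (n : ℝ) + 1 := by positivity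
    rw [AxisymNS.dcoef, abs_mul, abs_of_nonneg this, abs_of_pos hr0]
    push_cast
    ring
  have key := hasDerivAt_tsum_of_isPreconnected (t := Metric.ball (0 : ℝ) r)
    (g := fun n y => a n * y ^ n) (g' := fun n y => a n * (n * y ^ (n - 1))) (y₀ := 0) (y := t)
    hu Metric.isOpen_ball (convex_ball _ _).isPreconnected
    (fun n y _ => (hasDerivAt_pow n y).const_mul _)
    (fun n y hy => by
      rw [mem_ball_zero_iff, Real.norm_eq_abs] at hy
      rw [norm_mul, norm_mul, norm_pow, Real.norm_eq_abs, Real.norm_eq_abs, Real.norm_eq_abs,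
        Nat.abs_cast]
      gcongr)
    (by simpa using hr0) (h.summable (by simp)) (by simpa using hr1)
  have hs : Summable fun n : ℕ => a n * (n * t ^ (n - 1)) := by
    rw [← summable_nat_add_iff 1]
    refine (h.dcoef.summable ht).congr fun n => ?_
    rw [AxisymNS.dcoef]
    push_cast
    ring
  have he : ∑' n : ℕ, a n * (n * t ^ (n - 1)) = psum (AxisymNS.dcoef a) t := by
    rw [hs.tsum_eq_zero_add, psum]
    simp only [Nat.cast_zero, zero_mul, mul_zero, zero_add]
    refine tsum_congr fun n => ?_
    rw [AxisymNS.dcoef]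
    push_cast
    ring
  rw [he] at key
  exact key

lemma PolyBounded.analyticAt {a : ℕ → ℝ} (h : PolyBounded a) {t : ℝ} (ht : |t| < 1) :
    AnalyticAt ℝ (psum a) t := by
  obtain ⟨r, hr1, hr2⟩ := exists_between ht
  have hr0 : 0 < r := (abs_nonneg t).trans_lt hr1
  set p := FormalMultilinearSeries.ofScalars ℝ a
  lift r to ℝ≥0 using hr0.le
  have hrad : (r : ℝ≥0∞) ≤ p.radius := by
    refine p.le_radius_of_summable ?_
    refine (h.summable_abs (t := (r : ℝ)) (by rwa [abs_of_pos hr0])).congr fun n => ?_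
    rw [abs_of_pos hr0]
    simp [p]
  have hpos : 0 < p.radius := lt_of_lt_of_le (by exact_mod_cast hr0) hrad
  have hp := p.hasFPowerSeriesOnBall hpos
  have heq : p.sum = psum a := by
    ext x
    simp [p, FormalMultilinearSeries.sum, psum, mul_comm]
  rw [heq] at hp
  refine hp.analyticAt_of_mem ?_
  refine lt_of_lt_of_le ?_ hrad
  rw [edist_zero_right]
  have : ‖t‖₊ < r := by
    rw [← NNReal.coe_lt_coe]; simpa using hr1
  exact_mod_cast this

lemma hasSum_of_shift {f g : ℕ → ℝ} {S : ℝ} (hf : f 0 = 0) (h : ∀ n, f (n + 1) = g n)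
    (hg : HasSum g S) : HasSum f S := by
  rw [← hasSum_nat_add_iff' 1]
  simpa [hf, h] using hg

/-! ### A hypergeometric series -/

/-- The coefficients of the solution of `t (1 - t) g'' + (A (1 - t) - B t) g' = M g` that is
regular at `0`. -/
def hcoef (A B M : ℝ) : ℕ → ℝ
  | 0 => 1
  | n + 1 => hcoef A B M n * ((n * (n - 1) + (A + B) * n + M) / ((n + 1) * (n + A)))

section
variable {A B M : ℝ}

lemma hcoef_nonneg (hA : 1 ≤ A) (hB : 1 ≤ B) (hM : 0 ≤ M) (n : ℕ) : 0 ≤ hcoef A B M n := by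
  induction n with
  | zero => simp [hcoef]
  | succ n ih =>
    rw [hcoef]
    have hn : (0 : ℝ) ≤ n := n.cast_nonneg
    have : 0 ≤ (n : ℝ) * (n - 1) + (A + B) * n + M := by nlinarith
    positivity

/-- The ratio of consecutive coefficients is at most $1+N/(n+1)\le(1+1/(n+1))^N$ as soon as $N\ge
B+M$, and the product of these bounds telescopes to $(n+1)^N$. -/
lemma polyBounded_hcoef (hA : 1 ≤ A) (hB : 1 ≤ B) (hM : 0 ≤ M) : PolyBounded (hcoef A B M) := by
  obtain ⟨N, hN⟩ := exists_nat_ge (B + M)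
  refine ⟨1, N, fun n => ?_⟩
  rw [abs_of_nonneg (hcoef_nonneg hA hB hM n), one_mul]
  induction n with
  | zero => simp [hcoef]
  | succ n ih =>
    rw [hcoef]
    have hn : (0 : ℝ) ≤ n := n.cast_nonneg
    have h0 : 0 ≤ (n : ℝ) * (n - 1) + (A + B) * n + M := by nlinarith
    have h1 : ((n : ℝ) * (n - 1) + (A + B) * n + M) / ((n + 1) * (n + A)) ≤ 1 + N * (1 / (n + 1)) := by
      rw [div_le_iff₀ (by positivity)]
      have : (1 + (N : ℝ) * (1 / (n + 1))) * ((n + 1) * (n + A)) = (n + 1 + N) * (n + A) := by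
        field_simp
      rw [this]
      nlinarith
    have h2 : 1 + (N : ℝ) * (1 / (n + 1)) ≤ (1 + 1 / ((n : ℝ) + 1)) ^ N :=
      one_add_mul_le_pow (by have : (0:ℝ) ≤ 1 / ((n : ℝ) + 1) := by positivity
                             linarith) N
    calc hcoef A B M n * (((n : ℝ) * (n - 1) + (A + B) * n + M) / ((n + 1) * (n + A)))
        ≤ ((n : ℝ) + 1) ^ N * (1 + 1 / ((n : ℝ) + 1)) ^ N :=
          mul_le_mul ih (h1.trans h2) (by positivity) (by positivity)
      _ = _ := by
        rw [← mul_pow]; congr 1; push_cast; field_simp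

lemma psum_hcoef_ode (hA : 1 ≤ A) (hB : 1 ≤ B) (hM : 0 ≤ M) {t : ℝ} (ht : |t| < 1) :
    t * (1 - t) * psum (dcoef (dcoef (hcoef A B M))) t +
      (A * (1 - t) - B * t) * psum (dcoef (hcoef A B M)) t = M * psum (hcoef A B M) t := by
  set a := hcoef A B M with ha
  have h0 := polyBounded_hcoef hA hB hM
  rw [← ha] at h0
  have s0 := h0.hasSum ht
  have s1 := h0.dcoef.hasSum ht
  have s2 := h0.dcoef.dcoef.hasSum ht
  have e1 : HasSum (fun n : ℕ => n * a n * t ^ n) (t * psum (dcoef a) t) :=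
    hasSum_of_shift (by simp) (fun n => by rw [dcoef]; push_cast; ring) (s1.mul_left t)
  have e2 : HasSum (fun n : ℕ => n * (n + 1) * a (n + 1) * t ^ n)
      (t * psum (dcoef (dcoef a)) t) :=
    hasSum_of_shift (by simp) (fun n => by rw [dcoef, dcoef]; push_cast; ring) (s2.mul_left t)
  have e3 : HasSum (fun n : ℕ => n * (n - 1) * a n * t ^ n)
      (t * (t * psum (dcoef (dcoef a)) t)) :=
    hasSum_of_shift (by simp) (fun n => by push_cast; ring) (e2.mul_left t)
  -- The coefficient of $t^n$ in the equation is exactly the recurrence defining `hcoef`, cleared of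
  -- its denominator.
  have hsum := ((e2.sub e3).add ((s1.mul_left A).sub (e1.mul_left (A + B)))).sub (s0.mul_left M)
  have hz : ∀ n : ℕ, (n : ℝ) * (n + 1) * a (n + 1) * t ^ n - n * (n - 1) * a n * t ^ n +
      (A * (dcoef a n * t ^ n) - (A + B) * (n * a n * t ^ n)) - M * (a n * t ^ n) = 0 := by
    intro n
    have hn : (0 : ℝ) ≤ n := n.cast_nonneg
    have hr : a (n + 1) * ((n + 1) * (n + A)) = a n * (n * (n - 1) + (A + B) * n + M) := by
      rw [ha, hcoef]
      field_simp
    rw [dcoef]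
    linear_combination t ^ n * hr
  simp only [hz] at hsum
  have := hsum.unique hasSum_zero
  linarith
end

/-! ### The upper solution -/

section
variable {ν : ℝ} {c : ℝ × ℝ × ℝ} {x : ℝ}

/-- The affine solution for the parameters `(c₁, c₂, c̄₃(c₁, c₂; ν))`. -/
def affSol (ν : ℝ) (c : ℝ × ℝ × ℝ) (x : ℝ) : ℝ :=
  (ν + √(ν ^ 2 + c.1)) * (1 - x) - (ν + √(ν ^ 2 + c.2.1)) * (1 + x)

/-- The coefficients of the series of the linearizing function. -/
def linCoef (ν : ℝ) (c : ℝ × ℝ × ℝ) : ℕ → ℝ :=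
  hcoef ((ν + √(ν ^ 2 + c.1)) / ν) ((ν + √(ν ^ 2 + c.2.1)) / ν)
    ((c.2.2 - c3bar c.1 c.2.1 ν) / (2 * ν ^ 2))

/-- The linearizing function. -/
def linFun (ν : ℝ) (c : ℝ × ℝ × ℝ) (x : ℝ) : ℝ := psum (linCoef ν c) ((1 + x) / 2)

/-- The derivative of the linearizing function. -/
def linFun' (ν : ℝ) (c : ℝ × ℝ × ℝ) (x : ℝ) : ℝ :=
  psum (dcoef (linCoef ν c)) ((1 + x) / 2) * (1 / 2)

/-- The second derivative of the linearizing function. -/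
def linFun'' (ν : ℝ) (c : ℝ × ℝ × ℝ) (x : ℝ) : ℝ :=
  psum (dcoef (dcoef (linCoef ν c))) ((1 + x) / 2) * (1 / 2) * (1 / 2)

/-- An explicit formula for the upper solution. -/
def maxSol (ν : ℝ) (c : ℝ × ℝ × ℝ) (x : ℝ) : ℝ :=
  affSol ν c x + 2 * ν * (1 - x ^ 2) * (linFun' ν c x / linFun ν c x)

lemma one_le_linParam (hν : 0 < ν) (a : ℝ) : 1 ≤ (ν + √(ν ^ 2 + a)) / ν := by
  rw [le_div_iff₀ hν]; linarith [Real.sqrt_nonneg (ν ^ 2 + a)]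

lemma linParam_nonneg (hc : c ∈ J ν) : 0 ≤ (c.2.2 - c3bar c.1 c.2.1 ν) / (2 * ν ^ 2) :=
  div_nonneg (sub_nonneg.2 hc.2.2) (by positivity)

lemma polyBounded_linCoef (hν : 0 < ν) (hc : c ∈ J ν) : PolyBounded (linCoef ν c) :=
  polyBounded_hcoef (one_le_linParam hν _) (one_le_linParam hν _) (linParam_nonneg hc)

lemma linCoef_nonneg (hν : 0 < ν) (hc : c ∈ J ν) (n : ℕ) : 0 ≤ linCoef ν c n :=
  hcoef_nonneg (one_le_linParam hν _) (one_le_linParam hν _) (linParam_nonneg hc) n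

lemma abs_half_lt_one (h1 : -3 < x) (h2 : x < 1) : |(1 + x) / 2| < 1 := by
  rw [abs_lt]; constructor <;> linarith

lemma hasDerivAt_half : HasDerivAt (fun x : ℝ => (1 + x) / 2) (1 / 2) x :=
  ((hasDerivAt_id x).const_add 1).div_const 2

lemma hasDerivAt_linFun (hν : 0 < ν) (hc : c ∈ J ν) (h1 : -3 < x) (h2 : x < 1) :
    HasDerivAt (linFun ν c) (linFun' ν c x) x :=
  HasDerivAt.comp (h₂ := psum (linCoef ν c)) x
    ((polyBounded_linCoef hν hc).hasDerivAt (abs_half_lt_one h1 h2)) hasDerivAt_half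

lemma hasDerivAt_linFun' (hν : 0 < ν) (hc : c ∈ J ν) (h1 : -3 < x) (h2 : x < 1) :
    HasDerivAt (linFun' ν c) (linFun'' ν c x) x :=
  (HasDerivAt.comp (h₂ := psum (dcoef (linCoef ν c))) x
    ((polyBounded_linCoef hν hc).dcoef.hasDerivAt (abs_half_lt_one h1 h2))
      hasDerivAt_half).mul_const _

lemma analyticAt_linFun (hν : 0 < ν) (hc : c ∈ J ν) (h1 : -3 < x) (h2 : x < 1) :
    AnalyticAt ℝ (linFun ν c) x := by
  have h : AnalyticAt ℝ (fun x : ℝ => (1 + x) / 2) x := by fun_prop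
  exact AnalyticAt.comp (g := psum (linCoef ν c))
    ((polyBounded_linCoef hν hc).analyticAt (abs_half_lt_one h1 h2)) h

lemma analyticAt_linFun' (hν : 0 < ν) (hc : c ∈ J ν) (h1 : -3 < x) (h2 : x < 1) :
    AnalyticAt ℝ (linFun' ν c) x := by
  have h : AnalyticAt ℝ (fun x : ℝ => (1 + x) / 2) x := by fun_prop
  have h' : AnalyticAt ℝ (fun x : ℝ => psum (dcoef (linCoef ν c)) ((1 + x) / 2)) x :=
    AnalyticAt.comp (g := psum (dcoef (linCoef ν c))) (f := fun x : ℝ => (1 + x) / 2)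
      ((polyBounded_linCoef hν hc).dcoef.analyticAt (abs_half_lt_one h1 h2)) h
  exact h'.mul analyticAt_const

/-- This is the hypergeometric equation after $t=(1+x)/2$, using
$\mathrm{affSol}=\nu(A(1-x)-B(1+x))$. -/
lemma linFun_ode (hν : 0 < ν) (hc : c ∈ J ν) (h1 : -3 < x) (h2 : x < 1) :
    2 * ν ^ 2 * (1 - x ^ 2) * linFun'' ν c x + 2 * ν * affSol ν c x * linFun' ν c x =
      (c.2.2 - c3bar c.1 c.2.1 ν) * linFun ν c x := by
  have h := psum_hcoef_ode (one_le_linParam hν c.1) (one_le_linParam hν c.2.1)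
    (linParam_nonneg hc) (abs_half_lt_one h1 h2)
  rw [linFun, linFun', linFun'', linCoef, affSol]
  field_simp at h ⊢
  linear_combination h

lemma one_le_linFun (hν : 0 < ν) (hc : c ∈ J ν) (h1 : -1 ≤ x) (h2 : x < 1) :
    1 ≤ linFun ν c x := by
  have hs := (polyBounded_linCoef hν hc).hasSum (abs_half_lt_one (by linarith) h2)
  have h0 : 0 ≤ (1 + x) / 2 := by linarith
  have := hs.summable.sum_le_tsum {0}
    (fun n _ => mul_nonneg (linCoef_nonneg hν hc n) (pow_nonneg h0 n))
  rw [Finset.sum_singleton, pow_zero, mul_one] at this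
  exact this

lemma linFun'_nonneg (hν : 0 < ν) (hc : c ∈ J ν) (h1 : -1 ≤ x) : 0 ≤ linFun' ν c x := by
  have h0 : 0 ≤ (1 + x) / 2 := by linarith
  refine mul_nonneg (tsum_nonneg fun n => ?_) (by norm_num)
  exact mul_nonneg (mul_nonneg (by positivity) (linCoef_nonneg hν hc _)) (pow_nonneg h0 n)

/-- The affine function solves the equation up to the defect $(c_3-\bar c_3)(1-x^2)$, which the
logarithmic derivative of `linFun` has to absorb. -/
lemma affSol_identity (hc : c ∈ J ν) (x : ℝ) :
    ν * (1 - x ^ 2) * (-(ν + √(ν ^ 2 + c.1)) - (ν + √(ν ^ 2 + c.2.1))) +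
      2 * ν * x * affSol ν c x + 1 / 2 * affSol ν c x ^ 2 =
      P c x - (c.2.2 - c3bar c.1 c.2.1 ν) * (1 - x ^ 2) := by
  have h1 : √(ν ^ 2 + c.1) ^ 2 = ν ^ 2 + c.1 := Real.sq_sqrt (by linarith [hc.1])
  have h2 : √(ν ^ 2 + c.2.1) ^ 2 = ν ^ 2 + c.2.1 := Real.sq_sqrt (by linarith [hc.2.1])
  rw [affSol, P, c3bar]
  linear_combination (1 - x) * h1 + (1 + x) * h2

lemma hasDerivAt_affSol : HasDerivAt (affSol ν c)
    (-(ν + √(ν ^ 2 + c.1)) - (ν + √(ν ^ 2 + c.2.1))) x := by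
  have h1 := ((hasDerivAt_id x).const_sub 1).const_mul (ν + √(ν ^ 2 + c.1))
  have h2 := ((hasDerivAt_id x).const_add 1).const_mul (ν + √(ν ^ 2 + c.2.1))
  simpa using! h1.sub h2

/-- In the Riccati equation for $2\nu(1-x^2)h'/h$ the squares of $h'/h$ cancel, and what is left is
the linear equation for $h$. The range of $x$ extends to the left of $-1$, so that $-1$ is an
interior point for derivatives. -/
lemma maxSol_hasDerivAt (hν : 0 < ν) (hc : c ∈ J ν) (h1 : -3 < x) (h2 : x < 1)
    (h0 : linFun ν c x ≠ 0) :
    ∃ d, HasDerivAt (maxSol ν c) d x ∧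
      ν * (1 - x ^ 2) * d + 2 * ν * x * maxSol ν c x + 1 / 2 * maxSol ν c x ^ 2 = P c x := by
  have hq := (hasDerivAt_linFun' hν hc h1 h2).div (hasDerivAt_linFun hν hc h1 h2) h0
  have hp : HasDerivAt (fun x : ℝ => 2 * ν * (1 - x ^ 2)) (2 * ν * (-(2 * x))) x := by
    simpa using (((hasDerivAt_id x).pow 2).const_sub 1).const_mul (2 * ν)
  refine ⟨_, (hasDerivAt_affSol (ν := ν) (c := c)).add (hp.mul hq), ?_⟩
  have ha := affSol_identity hc x
  have ho := linFun_ode hν hc h1 h2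
  have ho' : linFun'' ν c x * (2 * ν ^ 2 * (1 - x ^ 2)) / linFun ν c x =
      (c.2.2 - c3bar c.1 c.2.1 ν) - 2 * ν * affSol ν c x * (linFun' ν c x / linFun ν c x) := by
    field_simp
    linear_combination ho
  rw [maxSol]
  have e : (linFun'' ν c x * linFun ν c x - linFun' ν c x * linFun' ν c x) / linFun ν c x ^ 2 =
      linFun'' ν c x / linFun ν c x - (linFun' ν c x / linFun ν c x) ^ 2 := by
    field_simp
  rw [e]
  linear_combination ha + (1 - x ^ 2) * ho'

lemma analyticAt_maxSol (hν : 0 < ν) (hc : c ∈ J ν) (hx : x ∈ Ico (-1 : ℝ) 1) :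
    AnalyticAt ℝ (maxSol ν c) x := by
  have h1 := analyticAt_linFun hν hc (by linarith [hx.1]) hx.2
  have h2 := analyticAt_linFun' hν hc (by linarith [hx.1]) hx.2
  have h3 : linFun ν c x ≠ 0 := by linarith [one_le_linFun hν hc hx.1 hx.2]
  have h4 : AnalyticAt ℝ (affSol ν c) x := by unfold affSol; fun_prop
  have h5 : AnalyticAt ℝ (fun x : ℝ => 2 * ν * (1 - x ^ 2)) x := by fun_prop
  exact h4.add (h5.mul (h2.div h1 h3))

lemma maxSol_ode (hν : 0 < ν) (hc : c ∈ J ν) (hx : x ∈ Ico (-1 : ℝ) 1) :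
    ∀ᶠ y in 𝓝 x, ν * (1 - y ^ 2) * deriv (maxSol ν c) y + 2 * ν * y * maxSol ν c y +
      1 / 2 * maxSol ν c y ^ 2 = P c y := by
  have h3 : linFun ν c x ≠ 0 := by linarith [one_le_linFun hν hc hx.1 hx.2]
  have h1 := (analyticAt_linFun hν hc (by linarith [hx.1]) hx.2).continuousAt.eventually_ne h3
  filter_upwards [h1, Ioo_mem_nhds (show -3 < x by linarith [hx.1]) hx.2] with y hy hy'
  obtain ⟨d, hd, h⟩ := maxSol_hasDerivAt hν hc hy'.1 hy'.2 hy
  rwa [hd.deriv]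

lemma maxSol_hasDerivAt' (hν : 0 < ν) (hc : c ∈ J ν) (hx : x ∈ Ico (-1 : ℝ) 1) :
    ∃ d, HasDerivAt (maxSol ν c) d x ∧
      ν * (1 - x ^ 2) * d + 2 * ν * x * maxSol ν c x + 1 / 2 * maxSol ν c x ^ 2 = P c x :=
  maxSol_hasDerivAt hν hc (by linarith [hx.1]) hx.2
    (by linarith [one_le_linFun hν hc hx.1 hx.2])

lemma isSolution_maxSol (hν : 0 < ν) (hc : c ∈ J ν) : IsSolution ν c (maxSol ν c) := by
  intro x hx
  obtain ⟨d, hd, h⟩ := maxSol_hasDerivAt' hν hc (Ioo_subset_Ico_self hx)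
  exact ⟨hd.differentiableAt, by rwa [hd.deriv]⟩

lemma affSol_le_maxSol (hν : 0 < ν) (hc : c ∈ J ν) (hx : x ∈ Ico (-1 : ℝ) 1) :
    affSol ν c x ≤ maxSol ν c x := by
  have h1 := one_le_linFun hν hc hx.1 hx.2
  have h2 := linFun'_nonneg hν hc hx.1
  have h3 : 0 ≤ 1 - x ^ 2 := by nlinarith [hx.1, hx.2]
  rw [maxSol]
  have : 0 ≤ 2 * ν * (1 - x ^ 2) * (linFun' ν c x / linFun ν c x) := by positivity
  linarith

lemma maxSol_neg_one : maxSol ν c (-1) = 2 * (ν + √(ν ^ 2 + c.1)) := by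
  rw [maxSol, affSol]; norm_num; ring

/-- Every solution lies below `maxSol`. -/
lemma IsSolution.le_maxSol {U : ℝ → ℝ} (hU : IsSolution ν c U) (hν : 0 < ν) (hc : c ∈ J ν)
    {x₁ : ℝ} (hx₁ : x₁ ∈ Ioo (-1 : ℝ) 1) : U x₁ ≤ maxSol ν c x₁ := by
  by_contra! hlt
  set A := (ν + √(ν ^ 2 + c.1)) / ν with hA
  set B := (ν + √(ν ^ 2 + c.2.1)) / ν with hB
  have hA1 : 1 ≤ A := one_le_linParam hν _
  have hB1 : 1 ≤ B := one_le_linParam hν _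
  have hsub : Ioc (-1) x₁ ⊆ Ioo (-1 : ℝ) 1 := fun x hx => ⟨hx.1, hx.2.trans_lt hx₁.2⟩
  obtain ⟨H, hH⟩ : ∃ H, ∀ x ∈ Icc (-1) x₁, linFun ν c x ≤ H := by
    have hcont : ContinuousOn (linFun ν c) (Icc (-1) x₁) := fun x hx =>
      (analyticAt_linFun hν hc (by linarith [hx.1])
        (hx.2.trans_lt hx₁.2)).continuousAt.continuousWithinAt
    obtain ⟨H, hH⟩ := isCompact_Icc.bddAbove_image hcont
    exact ⟨H, fun x hx => hH ⟨x, hx, rfl⟩⟩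
  -- The difference $D$ of two solutions satisfies $\nu(1-x^2)D'+(2\nu x+\mathrm{maxSol})D+D^2/2=0$.
  -- The weight `ρ` is the integrating factor of the linear part, so `q` satisfies a pure quadratic
  -- equation.
  set ρ : ℝ → ℝ := fun x => (1 + x) ^ (A - 1) * (1 - x) ^ (B - 1) * linFun ν c x ^ 2 with hρ
  have hρpos : ∀ x ∈ Ioo (-1 : ℝ) 1, 0 < ρ x := fun x hx => by
    have h1 := one_le_linFun hν hc hx.1.le hx.2
    have h2 : 0 < 1 + x := by linarith [hx.1]
    have h3 : 0 < 1 - x := by linarith [hx.2]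
    positivity
  set q : ℝ → ℝ := fun x => ρ x * (U x - maxSol ν c x) with hq
  have hqd : ∀ x ∈ Ioo (-1 : ℝ) 1, HasDerivAt q (-(q x ^ 2 / (2 * ν * (1 - x ^ 2) * ρ x))) x := by
    intro x hx
    have h1 := one_le_linFun hν hc hx.1.le hx.2
    have h2 : 0 < 1 + x := by linarith [hx.1]
    have h3 : 0 < 1 - x := by linarith [hx.2]
    have h4 : 1 - x ^ 2 = (1 + x) * (1 - x) := by ring
    obtain ⟨d, hd, hde⟩ := maxSol_hasDerivAt' hν hc (Ioo_subset_Ico_self hx)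
    obtain ⟨hUd, hUe⟩ := hU x hx
    have r1 := ((hasDerivAt_id x).const_add 1).rpow_const (p := A - 1) (Or.inl h2.ne')
    have r2 := ((hasDerivAt_id x).const_sub 1).rpow_const (p := B - 1) (Or.inl h3.ne')
    have r3 := (hasDerivAt_linFun hν hc (by linarith) hx.2).pow 2
    have hd' := ((r1.mul r2).mul r3).mul (hUd.hasDerivAt.sub hd)
    refine HasDerivAt.congr_deriv (f := q) hd' ?_
    simp only [id, Pi.mul_apply, Pi.pow_apply, Pi.sub_apply, hq, hρ]
    have hdd : deriv U x - d = -((U x - maxSol ν c x) * (2 * ν * x + maxSol ν c x) +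
        (U x - maxSol ν c x) ^ 2 / 2) / (ν * ((1 + x) * (1 - x))) := by
      rw [eq_div_iff (by positivity), ← h4]; linear_combination hUe - hde
    have hm : maxSol ν c x = ν * (A * (1 - x) - B * (1 + x)) +
        2 * ν * ((1 + x) * (1 - x)) * (linFun' ν c x / linFun ν c x) := by
      rw [maxSol, affSol, hA, hB, ← h4]; field_simp
    rw [Real.rpow_sub_one h2.ne' (A - 1), Real.rpow_sub_one h3.ne' (B - 1), hdd, h4]
    have p1 : 0 < (1 + x) ^ (A - 1) := by positivity
    have p2 : 0 < (1 - x) ^ (B - 1) := by positivity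
    generalize (1 + x) ^ (A - 1) = X at *
    generalize (1 - x) ^ (B - 1) = Y at *
    generalize U x - maxSol ν c x = D at *
    rw [hm]
    generalize linFun' ν c x = l' at *
    generalize linFun ν c x = l at *
    push_cast
    have : l ≠ 0 := by linarith
    field_simp
    ring
  -- Since `q` is nonincreasing, positivity at `x₁` propagates to the left.
  have hqpos : ∀ x ∈ Ioc (-1) x₁, 0 < q x := by
    intro x hx
    have hanti : AntitoneOn q (Icc x x₁) := by
      have hs : Icc x x₁ ⊆ Ioo (-1 : ℝ) 1 := fun y hy => ⟨hx.1.trans_le hy.1, hy.2.trans_lt hx₁.2⟩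
      refine antitoneOn_of_deriv_nonpos (convex_Icc _ _)
        (fun y hy => (hqd y (hs hy)).continuousAt.continuousWithinAt)
        (fun y hy => (hqd y (hs (interior_subset hy))).differentiableAt.differentiableWithinAt)
        (fun y hy => ?_)
      have hy' := hs (interior_subset hy)
      rw [(hqd y hy').deriv, neg_nonpos]
      have := hρpos y hy'
      have : 0 < 1 - y ^ 2 := by nlinarith [hy'.1, hy'.2]
      positivity
    exact lt_of_lt_of_le (mul_pos (hρpos _ hx₁) (sub_pos.2 hlt))
      (hanti (left_mem_Icc.2 hx.2) (right_mem_Icc.2 hx.2) hx.2)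
  -- As $A,B\ge1$, one has $(1-x^2)\rho\le2^{A-1}2^BH^2(1+x)$, hence $(1/q)'\ge\kappa/(1+x)$, which
  -- is not integrable at $-1$.
  set κ : ℝ := 1 / (2 * ν * (2 ^ (A - 1) * 2 ^ B * H ^ 2)) with hκ
  have hH1 : 1 ≤ H := (one_le_linFun hν hc le_rfl (by norm_num)).trans
    (hH (-1) ⟨le_rfl, hx₁.1.le⟩)
  have hκ0 : 0 < κ := by positivity
  set F : ℝ → ℝ := fun x => (q x)⁻¹ - κ * Real.log (1 + x) with hF
  have hFd : ∀ x ∈ Ioc (-1) x₁,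
      HasDerivAt F (1 / (2 * ν * (1 - x ^ 2) * ρ x) - κ * (1 / (1 + x))) x := by
    intro x hx
    have h2 : 0 < 1 + x := by linarith [hx.1]
    have hl := (((hasDerivAt_id x).const_add 1).log h2.ne').const_mul κ
    have := ((hqd x (hsub hx)).inv (hqpos x hx).ne').sub hl
    refine HasDerivAt.congr_deriv (f := F) this ?_
    have := (hqpos x hx).ne'
    simp only [id, neg_neg]
    congr 1
    field_simp
  have hFpos : ∀ x ∈ Ioc (-1) x₁, 0 ≤ 1 / (2 * ν * (1 - x ^ 2) * ρ x) - κ * (1 / (1 + x)) := by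
    intro x hx
    have h2 : 0 < 1 + x := by linarith [hx.1]
    have h3 : 0 < 1 - x := by linarith [hx.2, hx₁.2]
    have h1 := one_le_linFun hν hc hx.1.le (hx.2.trans_lt hx₁.2)
    have hr := hρpos x (hsub hx)
    have h4 : 1 - x ^ 2 = (1 + x) * (1 - x) := by ring
    have h5 : κ * (1 / (1 + x)) = 1 / (2 * ν * (2 ^ (A - 1) * 2 ^ B * H ^ 2) * (1 + x)) := by
      rw [hκ, div_mul_div_comm, one_mul]
    rw [sub_nonneg, h5]
    refine one_div_le_one_div_of_le (by rw [h4]; positivity) ?_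
    have h6 : 2 * ν * (1 - x ^ 2) * ρ x =
        2 * ν * ((1 + x) ^ (A - 1) * (1 - x) ^ B * linFun ν c x ^ 2) * (1 + x) := by
      rw [hρ, h4]
      simp only
      rw [Real.rpow_sub_one h3.ne' B]
      field_simp
    rw [h6]
    gcongr
    all_goals first
      | exact hH x ⟨hx.1.le, hx.2⟩
      | linarith [hx.1, hx.2, hx₁.2]
  have hmono : MonotoneOn F (Ioc (-1) x₁) := by
    refine monotoneOn_of_deriv_nonneg (convex_Ioc _ _)
      (fun y hy => (hFd y hy).continuousAt.continuousWithinAt)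
      (fun y hy => (hFd y (interior_subset hy)).differentiableAt.differentiableWithinAt)
      (fun y hy => ?_)
    rw [(hFd y (interior_subset hy)).deriv]
    exact hFpos y (interior_subset hy)
  -- Chosen so that $-\kappa\log y\ge F(x_1)+1$. Then $F(y-1)>F(x_1)$ although `F` is nondecreasing
  -- and $y-1\le x_1$.
  set y := min (Real.exp (-(F x₁ + 1) / κ)) (1 + x₁) with hy
  have hy0 : 0 < y := lt_min (Real.exp_pos _) (by linarith [hx₁.1])
  have hyx : y - 1 ∈ Ioc (-1) x₁ := ⟨by linarith, by linarith [min_le_right (Real.exp (-(F x₁ + 1) / κ)) (1 + x₁)]⟩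
  have h1 := hmono hyx ⟨hx₁.1, le_rfl⟩ hyx.2
  have h2 : Real.log y ≤ -(F x₁ + 1) / κ := by
    rw [Real.log_le_iff_le_exp hy0]; exact min_le_left _ _
  have h3 : 0 < (q (y - 1))⁻¹ := inv_pos.2 (hqpos _ hyx)
  rw [le_div_iff₀ hκ0] at h2
  have h4 : F (y - 1) = (q (y - 1))⁻¹ - κ * Real.log y := by
    rw [hF]; simp only [add_sub_cancel]
  rw [h4] at h1
  linarith

end

/-! ### Identification of the extremal solutions; reflection. -/

section
variable {ν : ℝ} {c : ℝ × ℝ × ℝ} {x : ℝ}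

lemma extendFrom_Ioo_eq {f g : ℝ → ℝ} (hfg : ∀ y ∈ Ioo (-1 : ℝ) 1, f y = g y)
    (hx : x ∈ Icc (-1 : ℝ) 1) (hg : ContinuousAt g x) : extendFrom (Ioo (-1) 1) f x = g x := by
  refine extendFrom_eq (by rwa [closure_Ioo (by norm_num)]) ?_
  refine (hg.tendsto.mono_left nhdsWithin_le_nhds).congr' ?_
  filter_upwards [self_mem_nhdsWithin] with y hy using (hfg y hy).symm

/-- The supremum is attained by `maxSol`, and analyticity across $-1$ identifies the continuous
extension there. The endpoint $1$ is never needed: it is a null set for the sup norms and lies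
outside the sets of the $C^m$ estimate for $U^+$. -/
lemma upperSol_eq (hν : 0 < ν) (hc : c ∈ J ν) (hx : x ∈ Ico (-1 : ℝ) 1) :
    upperSol ν c x = maxSol ν c x := by
  refine extendFrom_Ioo_eq (fun y hy => ?_) (Ico_subset_Icc_self hx)
    (analyticAt_maxSol hν hc hx).continuousAt
  refine IsGreatest.csSup_eq ⟨⟨_, isSolution_maxSol hν hc, rfl⟩, ?_⟩
  rintro _ ⟨U, hU, rfl⟩
  exact hU.le_maxSol hν hc hy

/-- The parameters of the reflected equation. -/
def reflect (c : ℝ × ℝ × ℝ) : ℝ × ℝ × ℝ := (c.2.1, c.1, c.2.2)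

lemma reflect_reflect (c : ℝ × ℝ × ℝ) : reflect (reflect c) = c := rfl

lemma P_reflect (c : ℝ × ℝ × ℝ) (x : ℝ) : P (reflect c) x = P c (-x) := by
  simp only [P, reflect]; ring

lemma reflect_mem_J (hc : c ∈ J ν) : reflect c ∈ J ν := by
  obtain ⟨h1, h2, h3⟩ := hc
  refine ⟨h2, h1, ?_⟩
  simp only [reflect, c3bar] at h3 ⊢
  linarith

lemma continuous_reflect : Continuous reflect := by unfold reflect; fun_prop

lemma IsSolution.reflect {U : ℝ → ℝ} (hU : IsSolution ν c U) :
    IsSolution ν (reflect c) fun x => -U (-x) := by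
  intro x hx
  obtain ⟨h1, h2⟩ := hU (-x) ⟨by linarith [hx.2], by linarith [hx.1]⟩
  have hd : HasDerivAt (fun x => -U (-x)) (deriv U (-x)) x := by
    simpa using! (h1.hasDerivAt.scomp x (hasDerivAt_neg x)).neg
  refine ⟨hd.differentiableAt, ?_⟩
  rw [hd.deriv, P_reflect]
  linear_combination h2

lemma lowerSol_eq (hν : 0 < ν) (hc : c ∈ J ν) (hx : x ∈ Ioc (-1 : ℝ) 1) :
    lowerSol ν c x = -maxSol ν (reflect c) (-x) := by
  have hc' := reflect_mem_J hc
  have hcont : ContinuousAt (fun x => -maxSol ν (reflect c) (-x)) x := by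
    have h : ContinuousAt (maxSol ν (reflect c)) (-x) :=
      (analyticAt_maxSol hν hc' ⟨by linarith [hx.2], by linarith [hx.1]⟩).continuousAt
    exact (ContinuousAt.comp h continuous_neg.continuousAt).neg
  refine extendFrom_Ioo_eq (g := fun x => -maxSol ν (reflect c) (-x)) (fun y hy => ?_)
    (Ioc_subset_Icc_self hx) hcont
  refine IsLeast.csInf_eq ⟨⟨_, (isSolution_maxSol hν hc').reflect, rfl⟩, ?_⟩
  rintro _ ⟨U, hU, rfl⟩
  have := hU.reflect.le_maxSol hν hc' (x₁ := -y) ⟨by linarith [hy.2], by linarith [hy.1]⟩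
  rw [neg_neg] at this
  linarith

end

/-! ### Comparison -/

/-- A continuous function that starts positive and crosses zero only upwards stays positive. -/
lemma pos_of_crossing {f : ℝ → ℝ} {p q : ℝ} (hf : ContinuousOn f (Icc p q)) (hp : 0 < f p)
    (hd : ∀ x ∈ Ioc p q, f x = 0 → ∃ d, 0 < d ∧ HasDerivAt f d x) :
    ∀ x ∈ Icc p q, 0 < f x := by
  by_contra! hcon
  obtain ⟨z, hz, hz0⟩ := hcon
  -- The infimum of this closed set is the first point where positivity fails. There `f` vanishes
  -- and its left difference quotients are negative, which contradicts a positive derivative.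
  set S := Icc p q ∩ f ⁻¹' Iic 0
  have hS : IsClosed S := hf.preimage_isClosed_of_isClosed isClosed_Icc isClosed_Iic
  have hne : S.Nonempty := ⟨z, hz, hz0⟩
  have hbd : BddBelow S := ⟨p, fun y hy => hy.1.1⟩
  obtain ⟨h1, h2⟩ := hS.csInf_mem hne hbd
  set x := sInf S
  have hpx : p < x := lt_of_le_of_ne h1.1 (by rintro h; rw [← h] at h2; exact absurd hp (not_lt.2 h2))
  have hbefore : ∀ y ∈ Ico p x, 0 < f y := fun y hy => by
    by_contra! h
    exact absurd (csInf_le hbd ⟨⟨hy.1, hy.2.le.trans h1.2⟩, h⟩) (not_le.2 hy.2)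
  have hIco : Ico p x ∈ 𝓝[<] x := Ico_mem_nhdsLT hpx
  have hx0 : f x = 0 := by
    refine le_antisymm h2 ?_
    have ht : Tendsto f (𝓝[Ico p x] x) (𝓝 (f x)) :=
      ((hf x h1).mono fun y hy => ⟨hy.1, hy.2.le.trans h1.2⟩)
    have : (𝓝[Ico p x] x).NeBot := by
      rw [← mem_closure_iff_nhdsWithin_neBot, closure_Ico hpx.ne]
      exact right_mem_Icc.2 hpx.le
    exact ge_of_tendsto ht (by filter_upwards [self_mem_nhdsWithin] with y hy using (hbefore y hy).le)
  obtain ⟨d, hd0, hd1⟩ := hd x ⟨hpx, h1.2⟩ hx0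
  have hs := (hasDerivAt_iff_tendsto_slope_left_right.1 hd1).1
  have := (hs.eventually (lt_mem_nhds hd0)).and hIco
  obtain ⟨y, hy1, hy2⟩ := this.exists
  rw [slope_def_field, hx0, sub_zero] at hy1
  have := div_neg_of_pos_of_neg (hbefore y hy2) (sub_neg.2 hy2.2)
  linarith

/-! ### The uniform estimate -/

lemma hasDerivAt_P (c : ℝ × ℝ × ℝ) (x : ℝ) :
    HasDerivAt (P c) (-c.1 + c.2.1 - 2 * c.2.2 * x) x := by
  have h1 := ((hasDerivAt_id x).const_sub 1).const_mul c.1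
  have h2 := ((hasDerivAt_id x).const_add 1).const_mul c.2.1
  have h3 := (((hasDerivAt_id x).pow 2).const_sub 1).const_mul c.2.2
  refine ((h1.add h2).add h3).congr_deriv ?_
  simp only [id]
  push_cast
  ring

section
variable {ν : ℝ} {c : ℝ × ℝ × ℝ} {x b : ℝ}

lemma abs_P_le (h1 : |c.1| ≤ b) (h2 : |c.2.1| ≤ b) (h3 : |c.2.2| ≤ b) (hx : x ∈ Icc (-1 : ℝ) 1) :
    |P c x| ≤ 5 * b := by
  rw [abs_le] at *
  have e1 : 0 ≤ 1 - x := by linarith [hx.2]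
  have e2 : 0 ≤ 1 + x := by linarith [hx.1]
  have e3 : 0 ≤ 1 - x ^ 2 := by nlinarith
  have e4 : 0 ≤ x ^ 2 := sq_nonneg x
  rw [P]
  constructor <;> nlinarith

lemma abs_deriv_P_le (h1 : |c.1| ≤ b) (h2 : |c.2.1| ≤ b) (h3 : |c.2.2| ≤ b)
    (hx : x ∈ Icc (-1 : ℝ) 1) : |-c.1 + c.2.1 - 2 * c.2.2 * x| ≤ 4 * b := by
  have h4 : |c.2.2 * x| ≤ b := by
    rw [abs_mul]
    have : |x| ≤ 1 := abs_le.2 hx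
    nlinarith [abs_nonneg c.2.2, abs_nonneg x]
  rw [abs_le] at *
  constructor <;> nlinarith

/-- The barrier is $U^2<2P+2\eta+(k\theta)^2$. At contact $U\ge k\theta$, since $U\ge-\theta$ rules
out the negative root. Multiplied by $\nu(1-x^2)$, the derivative of the gap contains
$U(2\eta+k^2\theta^2)\ge k^3\theta^3$, while the remaining terms are bounded below by
$-O(\nu)(1+b+k^2)$ and $\nu\le\theta^3$. -/
lemma maxSol_upper_bound {θ η : ℝ} (hν : 0 < ν) (hc : c ∈ J ν)
    (hc1 : 0 ≤ c.1) (h1 : |c.1| ≤ b) (h2 : |c.2.1| ≤ b) (h3 : |c.2.2| ≤ b) (hθ : 0 < θ)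
    (hθ1 : θ ≤ 1) (hνθ : ν ≤ θ ^ 3) (hη : 0 ≤ η) (hηθ : η ≤ θ ^ 2)
    (hP : ∀ x ∈ Icc (-1 : ℝ) 1, -η ≤ P c x) (hU : ∀ x ∈ Ico (-1 : ℝ) 1, -θ ≤ maxSol ν c x)
    (hx : x ∈ Ico (-1 : ℝ) 1) :
    1 / 2 * maxSol ν c x ^ 2 - P c x ≤ η + 1 / 2 * ((16 + 48 * b) * θ) ^ 2 := by
  have hb : 0 ≤ b := (abs_nonneg _).trans h1
  -- Large enough that $k^3$ exceeds $8b+4(10b+2+k^2)$, the total coefficient of the competing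
  -- terms, and that the barrier holds strictly at $-1$.
  set k := 16 + 48 * b with hk
  have hk1 : 16 ≤ k := by linarith
  have hθ2 : ν ≤ θ ^ 2 := hνθ.trans (by nlinarith [sq_nonneg θ])
  have hν1 : ν ≤ 1 := hθ2.trans (by nlinarith)
  have key : ∀ y ∈ Icc (-1) x, 0 < 2 * P c y + 2 * η + (k * θ) ^ 2 - maxSol ν c y ^ 2 := by
    have hd : ∀ y ∈ Icc (-1) x, ∃ d,
        ν * (1 - y ^ 2) * d + 2 * ν * y * maxSol ν c y + 1 / 2 * maxSol ν c y ^ 2 = P c y ∧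
        HasDerivAt (fun y => 2 * P c y + 2 * η + (k * θ) ^ 2 - maxSol ν c y ^ 2)
          (2 * (-c.1 + c.2.1 - 2 * c.2.2 * y) - 2 * maxSol ν c y * d) y := by
      intro y hy
      obtain ⟨d, hd, he⟩ := maxSol_hasDerivAt' hν hc ⟨hy.1, hy.2.trans_lt hx.2⟩
      refine ⟨d, he, ?_⟩
      refine HasDerivAt.congr_deriv
        (((((hasDerivAt_P c y).const_mul 2).add_const (2 * η)).add_const ((k * θ) ^ 2)).sub
          (hd.pow 2)) ?_
      push_cast; ring
    refine pos_of_crossing (fun y hy => ?_) ?_ fun y hy h0 => ?_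
    · obtain ⟨d, -, h⟩ := hd y hy
      exact h.continuousAt.continuousWithinAt
    · have hs : √(ν ^ 2 + c.1) ^ 2 = ν ^ 2 + c.1 := Real.sq_sqrt (by positivity)
      have hs1 : √(ν ^ 2 + c.1) ≤ 1 + b := by
        refine Real.sqrt_le_iff.2 ⟨by linarith, ?_⟩
        have := le_abs_self c.1
        nlinarith
      have hP1 : P c (-1) = 2 * c.1 := by rw [P]; ring
      rw [maxSol_neg_one, hP1]
      have : 8 * ν * (ν + √(ν ^ 2 + c.1)) ≤ 8 * θ ^ 2 * (2 + b) := by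
        have := Real.sqrt_nonneg (ν ^ 2 + c.1)
        exact mul_le_mul (by linarith) (by linarith) (by positivity) (by positivity)
      have : 8 * θ ^ 2 * (2 + b) < (k * θ) ^ 2 := by
        have : 8 * (2 + b) < k ^ 2 := by nlinarith
        have : 0 < θ ^ 2 := by positivity
        nlinarith
      nlinarith
    · obtain ⟨d, he, h⟩ := hd y (Ioc_subset_Icc_self hy)
      refine ⟨_, ?_, h⟩
      have hyI : y ∈ Ico (-1 : ℝ) 1 := ⟨hy.1.le, hy.2.trans_lt hx.2⟩
      have hyI' := Ico_subset_Icc_self hyI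
      have q0 : 0 < 1 - y ^ 2 := by nlinarith [hy.1, hyI.2]
      have hp := hP y hyI'
      have hu := hU y hyI
      have hp' := abs_le.1 (abs_P_le h1 h2 h3 hyI')
      have hpd := (abs_le.1 (abs_deriv_P_le h1 h2 h3 hyI')).1
      set u := maxSol ν c y
      set p' := -c.1 + c.2.1 - 2 * c.2.2 * y
      clear_value u p'
      have hkθ : 16 * θ ≤ k * θ := by gcongr
      have hk2 : (16 * θ) ^ 2 ≤ (k * θ) ^ 2 := by gcongr
      have hu0 : 0 ≤ u := by
        by_contra! hneg
        have : u ^ 2 ≤ θ ^ 2 := sq_le_sq' hu (by linarith)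
        nlinarith
      have hu1 : k * θ ≤ u := by
        exact (le_abs_self _).trans (abs_le_of_sq_le_sq (by linarith) hu0)
      have hθsq : θ ^ 2 ≤ 1 := pow_le_one₀ hθ.le hθ1
      have hkk : (k * θ) ^ 2 ≤ k ^ 2 := by
        rw [mul_pow]; exact mul_le_of_le_one_right (sq_nonneg k) hθsq
      have hu2 : u ^ 2 ≤ 10 * b + 2 + k ^ 2 := by linarith
      have hpos : 0 < ν * (1 - y ^ 2) * (2 * p' - 2 * u * d) := by
        have e : ν * (1 - y ^ 2) * (2 * p' - 2 * u * d) = 2 * (ν * (1 - y ^ 2)) * p' +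
            u * (2 * η + (k * θ) ^ 2) + 4 * ν * y * u ^ 2 := by
          linear_combination (-2 * u) * he - u * h0
        rw [e]
        have b1 : -(8 * b * θ ^ 3) ≤ 2 * (ν * (1 - y ^ 2)) * p' := by
          have : ν * (1 - y ^ 2) ≤ θ ^ 3 := by nlinarith [sq_nonneg y]
          have : 0 < ν * (1 - y ^ 2) := by positivity
          nlinarith
        have b2 : k ^ 3 * θ ^ 3 ≤ u * (2 * η + (k * θ) ^ 2) := by
          calc k ^ 3 * θ ^ 3 = (k * θ) * (k * θ) ^ 2 := by ring
            _ ≤ u * (2 * η + (k * θ) ^ 2) :=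
              mul_le_mul hu1 (by linarith) (by positivity) hu0
        have b3 : -(4 * (10 * b + 2 + k ^ 2) * θ ^ 3) ≤ 4 * ν * y * u ^ 2 := by
          have t1 : ν * u ^ 2 ≤ θ ^ 3 * (10 * b + 2 + k ^ 2) :=
            mul_le_mul hνθ hu2 (sq_nonneg u) (by positivity)
          have t2 : 0 ≤ ν * u ^ 2 := by positivity
          have t3 := mul_nonneg t2 (by linarith [hy.1] : 0 ≤ 1 + y)
          linear_combination 4 * t1 + 4 * t3
        have b4 : 0 < k ^ 3 - 8 * b - 4 * (10 * b + 2 + k ^ 2) := by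
          have : 16 * (16 * (k - 4)) ≤ k * (k * (k - 4)) := by
            have : 0 ≤ k - 4 := by linarith
            gcongr
          nlinarith
        have b5 : 0 < θ ^ 3 * (k ^ 3 - 8 * b - 4 * (10 * b + 2 + k ^ 2)) := by positivity
        linear_combination b1 + b2 + b3 + b5
      exact pos_of_mul_pos_right hpos (by positivity)
  have := key x ⟨hx.1, le_rfl⟩
  linarith

-- The barrier is $R-l\theta^2/R$ with $R=\sqrt{2P+2\eta+\theta^2}$. The term $\theta^2$ keeps
-- $R\ge\theta$ and hence $|R'|\le4b/\theta$; subtracting $l\theta^2/R$ lowers the square by about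
-- $2l\theta^2$. At contact $P-U^2/2$ is at least a large multiple of $\theta^2$, which beats $\nu$
-- times the slope of the barrier, of order $\nu/\theta\le\theta^2$.
set_option maxHeartbeats 800000 in
lemma maxSol_lower_bound {θ η : ℝ} (hν : 0 < ν) (hc : c ∈ J ν)
    (hc1 : 0 ≤ c.1) (h1 : |c.1| ≤ b) (h2 : |c.2.1| ≤ b) (h3 : |c.2.2| ≤ b) (hθ : 0 < θ)
    (hθ1 : θ ≤ 1) (hνθ : ν ≤ θ ^ 3) (hη : 0 ≤ η) (hηθ : η ≤ θ ^ 2)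
    (hP : ∀ x ∈ Icc (-1 : ℝ) 1, -η ≤ P c x) (hU : ∀ x ∈ Ico (-1 : ℝ) 1, -θ ≤ maxSol ν c x)
    (hx : x ∈ Ico (-1 : ℝ) 1) :
    -(2 * (8 + 64 * b) ^ 2 * θ ^ 2) ≤ 1 / 2 * maxSol ν c x ^ 2 - P c x := by
  have hb : 0 ≤ b := (abs_nonneg _).trans h1
  obtain ⟨k, hk⟩ : ∃ k, k = 8 + 64 * b := ⟨_, rfl⟩
  rw [← hk]
  obtain ⟨l, hl⟩ : ∃ l, l = 2 * k ^ 2 := ⟨_, rfl⟩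
  rw [← hl]
  have hk8 : 8 ≤ k := by linarith
  have hl8 : 8 * k ≤ k ^ 2 := by nlinarith
  have hθ2 : ν ≤ θ ^ 2 := hνθ.trans (by nlinarith [sq_nonneg θ])
  have hθsq : θ ^ 2 ≤ 1 := pow_le_one₀ hθ.le hθ1
  have hθp : 0 < θ ^ 2 := by positivity
  obtain ⟨R, hR⟩ : ∃ R : ℝ → ℝ, ∀ y, R y = √(2 * P c y + 2 * η + θ ^ 2) := ⟨_, fun _ => rfl⟩
  have hRsq : ∀ y ∈ Icc (-1 : ℝ) 1, R y ^ 2 = 2 * P c y + 2 * η + θ ^ 2 := fun y hy => by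
    rw [hR]; exact Real.sq_sqrt (by linarith [hP y hy])
  have hRθ : ∀ y ∈ Icc (-1 : ℝ) 1, θ ≤ R y := fun y hy => by
    rw [hR]; exact Real.le_sqrt_of_sq_le (by linarith [hP y hy])
  have hRd : ∀ y ∈ Icc (-1 : ℝ) 1, HasDerivAt R ((-c.1 + c.2.1 - 2 * c.2.2 * y) / R y) y := by
    intro y hy
    have hpos : 2 * P c y + 2 * η + θ ^ 2 ≠ 0 := by linarith [hP y hy]
    have h := ((((hasDerivAt_P c y).const_mul 2).add_const (2 * η)).add_const (θ ^ 2)).sqrt hpos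
    rw [show R = fun y => √(2 * P c y + 2 * η + θ ^ 2) from funext hR]
    refine h.congr_deriv ?_
    rw [mul_div_mul_left _ _ (by norm_num)]
  have key : ∀ y ∈ Icc (-1) x, 0 < maxSol ν c y - (R y - l * θ ^ 2 / R y) := by
    have hd : ∀ y ∈ Icc (-1) x, ∃ d,
        ν * (1 - y ^ 2) * d + 2 * ν * y * maxSol ν c y + 1 / 2 * maxSol ν c y ^ 2 = P c y ∧
        HasDerivAt (fun y => maxSol ν c y - (R y - l * θ ^ 2 / R y))
          (d - (-c.1 + c.2.1 - 2 * c.2.2 * y) / R y * (1 + l * θ ^ 2 / R y ^ 2)) y := by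
      intro y hy
      have hyI : y ∈ Icc (-1 : ℝ) 1 := ⟨hy.1, (hy.2.trans_lt hx.2).le⟩
      obtain ⟨d, hd, he⟩ := maxSol_hasDerivAt' hν hc ⟨hy.1, hy.2.trans_lt hx.2⟩
      have hR0 : 0 < R y := hθ.trans_le (hRθ y hyI)
      refine ⟨d, he, ?_⟩
      refine HasDerivAt.congr_deriv (hd.sub ((hRd y hyI).sub
        ((hasDerivAt_const y (l * θ ^ 2)).div (hRd y hyI) hR0.ne'))) ?_
      field_simp
      ring
    refine pos_of_crossing (fun y hy => ?_) ?_ fun y hy h0 => ?_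
    · obtain ⟨d, -, h⟩ := hd y hy
      exact h.continuousAt.continuousWithinAt
    · have hI : (-1 : ℝ) ∈ Icc (-1 : ℝ) 1 := ⟨le_rfl, by norm_num⟩
      have hs : √(ν ^ 2 + c.1) ^ 2 = ν ^ 2 + c.1 := Real.sq_sqrt (by positivity)
      have hP1 : P c (-1) = 2 * c.1 := by rw [P]; ring
      have hR1 := hRsq _ hI
      have hR0 : 0 < R (-1) := hθ.trans_le (hRθ _ hI)
      rw [hP1] at hR1
      rw [maxSol_neg_one]
      have hs0 := Real.sqrt_nonneg (ν ^ 2 + c.1)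
      set s := √(ν ^ 2 + c.1)
      set r := R (-1)
      by_contra! hcon
      have z1 : 2 * s < r - l * θ ^ 2 / r := by linarith
      have z2 : (2 * s) ^ 2 < (r - l * θ ^ 2 / r) ^ 2 := by gcongr
      have z3 : l * θ ^ 2 / r < r := by linarith
      have z4 : 0 < l * θ ^ 2 / r := by rw [hl]; positivity
      have z5 : (r - l * θ ^ 2 / r) ^ 2 = r ^ 2 - 2 * (l * θ ^ 2) + (l * θ ^ 2 / r) ^ 2 := by
        field_simp
        ring
      have z6 : (l * θ ^ 2 / r) ^ 2 ≤ l * θ ^ 2 := by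
        have : l * θ ^ 2 = l * θ ^ 2 / r * r := by field_simp
        nlinarith
      have z7 : 3 * θ ^ 2 ≤ l * θ ^ 2 := by gcongr; nlinarith
      nlinarith
    · obtain ⟨d, he, h⟩ := hd y (Ioc_subset_Icc_self hy)
      refine ⟨_, ?_, h⟩
      have hyI : y ∈ Ico (-1 : ℝ) 1 := ⟨hy.1.le, hy.2.trans_lt hx.2⟩
      have hyI' := Ico_subset_Icc_self hyI
      have q0 : 0 < 1 - y ^ 2 := by nlinarith [hy.1, hyI.2]
      have hu := hU y hyI
      have hp := hP y hyI'
      have hp' := abs_le.1 (abs_P_le h1 h2 h3 hyI')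
      have hpd := abs_le.1 (abs_deriv_P_le h1 h2 h3 hyI')
      have hr2 := hRsq y hyI'
      have hrθ := hRθ y hyI'
      have hy1 : -1 < y := hy.1
      have hy2 : y < 1 := hyI.2
      clear hd h hRd hRsq hR hRθ hP hU
      generalize maxSol ν c y = u at *
      generalize -c.1 + c.2.1 - 2 * c.2.2 * y = p' at *
      generalize P c y = p at *
      generalize R y = r at *
      have hr0 : 0 < r := hθ.trans_le hrθ
      have hur : u * r = r ^ 2 - l * θ ^ 2 := by
        field_simp at h0
        linarith
      -- Contact is impossible where $R<k\theta$: with $l=2k^2$ it would give $UR<-k^2\theta^2$,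
      -- whereas $U\ge-\theta$ gives $UR\ge-k\theta^2$.
      have hkr : k * θ ≤ r := by
        by_contra! hlt
        have a1 : r ^ 2 < (k * θ) ^ 2 := by gcongr
        have a2 : θ * r ≤ θ * (k * θ) := by gcongr
        have a3 : -θ * r ≤ u * r := mul_le_mul_of_nonneg_right hu hr0.le
        have a4 : 8 * k * θ ^ 2 ≤ k ^ 2 * θ ^ 2 := mul_le_mul_of_nonneg_right hl8 hθp.le
        have a5 : 0 < k * θ ^ 2 := by positivity
        rw [hl] at hur
        linarith
      have hkr2 : (k * θ) ^ 2 ≤ r ^ 2 := by gcongr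
      have hlr : l * θ ^ 2 / r ^ 2 ≤ 2 := by
        rw [div_le_iff₀ (by positivity)]
        rw [hl]; linarith
      have hlr0 : 0 ≤ l * θ ^ 2 / r ^ 2 := by rw [hl]; positivity
      have c1 : (p' / r) * (1 + l * θ ^ 2 / r ^ 2) ≤ 12 * b / θ := by
        have : p' / r ≤ 4 * b / θ := by
          rw [div_le_div_iff₀ hr0 hθ]
          have := mul_le_mul hpd.2 hrθ hθ.le (by positivity)
          linarith
        calc (p' / r) * (1 + l * θ ^ 2 / r ^ 2) ≤ 4 * b / θ * (1 + l * θ ^ 2 / r ^ 2) := by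
              gcongr
          _ ≤ 4 * b / θ * (1 + 2) := by gcongr
          _ = 12 * b / θ := by ring
      have c2 : ν * (1 - y ^ 2) * ((p' / r) * (1 + l * θ ^ 2 / r ^ 2)) ≤ 12 * b * θ ^ 2 := by
        calc ν * (1 - y ^ 2) * ((p' / r) * (1 + l * θ ^ 2 / r ^ 2))
            ≤ ν * (1 - y ^ 2) * (12 * b / θ) := by gcongr
          _ ≤ θ ^ 3 * 1 * (12 * b / θ) := by
              gcongr
              linarith [sq_nonneg y]
          _ = 12 * b * θ ^ 2 := by field_simp
      have c3 : (1 / 2 * k ^ 2 - 2) * θ ^ 2 ≤ p - 1 / 2 * u ^ 2 := by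
        rcases le_or_gt 0 u with hu0 | hu0
        · have : u ^ 2 * r ^ 2 ≤ (r ^ 2 - l * θ ^ 2) * r ^ 2 := by
            have e1 : 0 ≤ u * r := by positivity
            have e2 : u ^ 2 * r ^ 2 = (r ^ 2 - l * θ ^ 2) ^ 2 := by rw [← hur]; ring
            rw [e2, sq]
            rw [hur] at e1
            have : 0 ≤ l * θ ^ 2 := by rw [hl]; positivity
            gcongr
            linarith
          have := le_of_mul_le_mul_right this (by positivity)
          rw [hl] at this
          have hkθ := mul_nonneg (sq_nonneg k) hθp.le
          linarith
        · have : u ^ 2 ≤ θ ^ 2 := sq_le_sq' hu (by linarith)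
          linarith
      have c4 : ν * y * u ≤ (10 * b + 4) * θ ^ 2 := by
        have d1 : r ≤ 10 * b + 4 := by linarith [sq_nonneg (r - 1)]
        have d2 : |u| ≤ 10 * b + 4 := by
          have : 0 ≤ l * θ ^ 2 := by rw [hl]; positivity
          rw [abs_le]
          exact ⟨by linarith, le_of_mul_le_mul_right (b := u) (c := 10 * b + 4)
            (by linarith [mul_le_mul_of_nonneg_right d1 hr0.le]) hr0⟩
        calc ν * y * u ≤ |ν * y * u| := le_abs_self _
          _ = ν * |y| * |u| := by rw [abs_mul, abs_mul, abs_of_pos hν]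
          _ ≤ θ ^ 2 * 1 * (10 * b + 4) := by
            gcongr
            exact abs_le.2 ⟨hy1.le, hy2.le⟩
          _ = _ := by ring
      have hpos : 0 < ν * (1 - y ^ 2) * (d - p' / r * (1 + l * θ ^ 2 / r ^ 2)) := by
        have e : ν * (1 - y ^ 2) * d = p - 1 / 2 * u ^ 2 - 2 * (ν * y * u) := by
          linear_combination he
        have : 0 < (1 / 2 * k ^ 2 - 2 - 2 * (10 * b + 4) - 12 * b) * θ ^ 2 := by
          have : 0 < 1 / 2 * k ^ 2 - 2 - 2 * (10 * b + 4) - 12 * b := by linarith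
          positivity
        rw [mul_sub, e]
        linarith
      exact pos_of_mul_pos_right hpos (by positivity)
  have hk' := key x ⟨hx.1, le_rfl⟩
  have hxI := Ico_subset_Icc_self hx
  have hr2 := hRsq x hxI
  have hr0 : 0 < R x := hθ.trans_le (hRθ x hxI)
  generalize R x = r at *
  have hl0 : 0 ≤ l * θ ^ 2 := by rw [hl]; positivity
  rcases le_or_gt 0 (r - l * θ ^ 2 / r) with hz | hz
  · have z1 : (r - l * θ ^ 2 / r) ^ 2 ≤ maxSol ν c x ^ 2 := by gcongr; linarith
    have z2 : (r - l * θ ^ 2 / r) ^ 2 = r ^ 2 - 2 * (l * θ ^ 2) + (l * θ ^ 2 / r) ^ 2 := by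
      field_simp
      ring
    nlinarith [sq_nonneg (l * θ ^ 2 / r)]
  · have : r * r < l * θ ^ 2 := by
      rw [sub_neg, lt_div_iff₀ hr0] at hz; exact hz
    nlinarith [sq_nonneg (maxSol ν c x)]

end

section
variable {ν : ℝ} {c : ℝ × ℝ × ℝ} {x b : ℝ}

lemma abs_maxSol_sq_sub_P_le {θ η : ℝ} (hν : 0 < ν) (hc : c ∈ J ν)
    (hc1 : 0 ≤ c.1) (h1 : |c.1| ≤ b) (h2 : |c.2.1| ≤ b) (h3 : |c.2.2| ≤ b) (hθ : 0 < θ)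
    (hθ1 : θ ≤ 1) (hνθ : ν ≤ θ ^ 3) (hη : 0 ≤ η) (hηθ : η ≤ θ ^ 2)
    (hP : ∀ x ∈ Icc (-1 : ℝ) 1, -η ≤ P c x) (hU : ∀ x ∈ Ico (-1 : ℝ) 1, -θ ≤ maxSol ν c x)
    (hx : x ∈ Ico (-1 : ℝ) 1) :
    |1 / 2 * maxSol ν c x ^ 2 - P c x| ≤
      (1 + (16 + 48 * b) ^ 2 + 2 * (8 + 64 * b) ^ 2) * θ ^ 2 := by
  have hu := maxSol_upper_bound hν hc hc1 h1 h2 h3 hθ hθ1 hνθ hη hηθ hP hU hx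
  have hl := maxSol_lower_bound hν hc hc1 h1 h2 h3 hθ hθ1 hνθ hη hηθ hP hU hx
  have e1 : 0 ≤ ((16 + 48 * b) * θ) ^ 2 := by positivity
  have e2 : 0 ≤ 2 * (8 + 64 * b) ^ 2 * θ ^ 2 := by positivity
  have e3 : 0 ≤ θ ^ 2 := by positivity
  rw [mul_pow] at hu e1
  rw [abs_le]
  constructor <;> linarith

/-- Comparison with $-\nu(1+x)$: at contact the viscous terms combine so that
$\nu(1-x^2)(U'+\nu)=P+\tfrac12\nu^2(1+x)^2>0$. -/
lemma neg_two_mul_le_maxSol (hν : 0 < ν) (hc : c ∈ J ν) (hP : ∀ x ∈ Icc (-1 : ℝ) 1, 0 ≤ P c x)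
    (hx : x ∈ Ico (-1 : ℝ) 1) : -(2 * ν) ≤ maxSol ν c x := by
  have key : ∀ y ∈ Icc (-1) x, 0 < maxSol ν c y + ν * (1 + y) := by
    have hd : ∀ y ∈ Icc (-1) x, ∃ d,
        ν * (1 - y ^ 2) * d + 2 * ν * y * maxSol ν c y + 1 / 2 * maxSol ν c y ^ 2 = P c y ∧
        HasDerivAt (fun y => maxSol ν c y + ν * (1 + y)) (d + ν) y := by
      intro y hy
      obtain ⟨d, hd, he⟩ := maxSol_hasDerivAt' hν hc ⟨hy.1, hy.2.trans_lt hx.2⟩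
      refine ⟨d, he, ?_⟩
      refine HasDerivAt.congr_deriv
        (hd.add (((hasDerivAt_id y).const_add 1).const_mul ν)) ?_
      ring
    refine pos_of_crossing (fun y hy => ?_) ?_ fun y hy h0 => ?_
    · obtain ⟨d, -, h⟩ := hd y hy
      exact h.continuousAt.continuousWithinAt
    · rw [maxSol_neg_one]
      have := Real.sqrt_nonneg (ν ^ 2 + c.1)
      linarith
    · obtain ⟨d, he, h⟩ := hd y (Ioc_subset_Icc_self hy)
      refine ⟨_, ?_, h⟩
      have hy1 : 0 < 1 + y := by linarith [hy.1]
      have hy2 : 0 < 1 - y := by linarith [hy.2, hx.2]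
      have hp := hP y ⟨hy.1.le, by linarith⟩
      have q0 : 0 < 1 - y ^ 2 := by nlinarith
      have hu : maxSol ν c y = -(ν * (1 + y)) := by linarith
      rw [hu] at he
      have : 0 < ν * (1 - y ^ 2) * (d + ν) := by
        have e : ν * (1 - y ^ 2) * (d + ν) = P c y + 1 / 2 * (ν * (1 + y)) ^ 2 := by
          linear_combination he
        rw [e]; positivity
      exact pos_of_mul_pos_right this (by positivity)
  have := key x ⟨hx.1, le_rfl⟩
  nlinarith [hx.2]

/-- Lowering $c_3$ to $c_3^*$ only decreases $P$, and there $P$ is half the square of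
$\sqrt{c_1}(1-x)-\sqrt{c_2}(1+x)$. -/
lemma P_nonneg_of_mem_J_zero (hc : c ∈ J 0) (hx : x ∈ Icc (-1 : ℝ) 1) : 0 ≤ P c x := by
  obtain ⟨h1, h2, h3⟩ := hc
  simp only [c3bar, ne_eq, OfNat.ofNat_ne_zero, not_false_eq_true, zero_pow, neg_zero, zero_add,
    mul_zero, add_zero] at h1 h2 h3
  have e1 := Real.sq_sqrt h1
  have e2 := Real.sq_sqrt h2
  have e3 : 0 ≤ 1 - x ^ 2 := by nlinarith [hx.1, hx.2]
  have e4 := mul_le_mul_of_nonneg_right h3 e3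
  have e5 := sq_nonneg (√c.1 * (1 - x) - √c.2.1 * (1 + x))
  rw [P]
  linear_combination e4 + 1 / 2 * e5 + (1 - x) * e1 + (1 + x) * e2

/-- The bound on $u^2/2-p$ controls only $|u|$; the one-sided bound $u\ge-s$ fixes the sign at the
cost of $2s$. -/
lemma abs_sub_sqrt_le {u p e s : ℝ} (hp : 0 ≤ p) (h : |1 / 2 * u ^ 2 - p| ≤ e) (hs : 0 ≤ s)
    (hu : -s ≤ u) : |u - √(2 * p)| ≤ 2 * s + √(2 * e) := by
  have hy := Real.sq_sqrt (show 0 ≤ 2 * p by linarith)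
  have hy0 := Real.sqrt_nonneg (2 * p)
  have he0 : 0 ≤ e := (abs_nonneg _).trans h
  have he := Real.sq_sqrt (show 0 ≤ 2 * e by linarith)
  have hse0 := Real.sqrt_nonneg (2 * e)
  set y := √(2 * p)
  set t := √(2 * e)
  rw [abs_le] at h
  have h1 : y ≤ |u| + t := by
    refine abs_le_of_sq_le_sq' (a := y) (b := |u| + t) ?_ (by positivity) |>.2
    nlinarith [sq_abs u, mul_nonneg (abs_nonneg u) hse0]
  have h2 : |u| ≤ y + t := by
    refine abs_le_of_sq_le_sq' (a := |u|) (b := y + t) ?_ (by positivity) |>.2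
    nlinarith [sq_abs u, mul_nonneg hy0 hse0]
  rw [abs_le]
  rcases le_or_gt 0 u with h0 | h0
  · rw [abs_of_nonneg h0] at h1 h2
    constructor <;> linarith
  · rw [abs_of_neg h0] at h1 h2
    constructor <;> linarith

end

/-! ### Uniformity over vanishing sequences -/

/-- The filter of pairs `(ν, c')` with `ν → 0⁺`, `c' → c`, `c' ∈ J ν` and `c' ∈ A`. -/
def vanFilter (c : ℝ × ℝ × ℝ) (A : Set (ℝ × ℝ × ℝ)) : Filter (ℝ × (ℝ × ℝ × ℝ)) :=
  (𝓝[>] 0 ×ˢ 𝓝 c) ⊓ 𝓟 {z | z.2 ∈ J z.1 ∧ z.2 ∈ A}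

section
variable {c : ℝ × ℝ × ℝ} {A : Set (ℝ × ℝ × ℝ)}

/-- Transfers an estimate valid eventually along the filter to every sequence, with a constant that
does not depend on the sequence. -/
lemma IsVanishing.tendsto_vanFilter {ν : ℕ → ℝ} {ck : ℕ → ℝ × ℝ × ℝ} (h : IsVanishing c ν ck)
    (hA : ∀ k, ck k ∈ A) : Tendsto (fun k => (ν k, ck k)) atTop (vanFilter c A) := by
  refine tendsto_inf.2 ⟨Tendsto.prodMk ?_ h.tendsto, tendsto_principal.2 ?_⟩
  · exact tendsto_nhdsWithin_iff.2 ⟨h.tendsto_zero, Eventually.of_forall h.pos⟩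
  · exact Eventually.of_forall fun k => ⟨h.mem k, hA k⟩

lemma tendsto_fst_vanFilter : Tendsto Prod.fst (vanFilter c A) (𝓝[>] 0) :=
  tendsto_fst.mono_left inf_le_left

lemma tendsto_fst_vanFilter' : Tendsto Prod.fst (vanFilter c A) (𝓝 0) :=
  tendsto_fst_vanFilter.mono_right nhdsWithin_le_nhds

lemma tendsto_snd_vanFilter : Tendsto Prod.snd (vanFilter c A) (𝓝 c) :=
  tendsto_snd.mono_left inf_le_left

lemma eventually_vanFilter_mem : ∀ᶠ z in vanFilter c A, z.2 ∈ J z.1 ∧ z.2 ∈ A :=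
  mem_inf_of_right (mem_principal_self _)

lemma eventually_vanFilter_pos : ∀ᶠ z in vanFilter c A, 0 < z.1 :=
  tendsto_fst_vanFilter.eventually self_mem_nhdsWithin

lemma eventually_vanFilter_le {δ : ℝ} (hδ : 0 < δ) : ∀ᶠ z in vanFilter c A, z.1 ≤ δ :=
  tendsto_fst_vanFilter'.eventually (Iic_mem_nhds hδ)

lemma eventually_vanFilter_bdd : ∀ᶠ z in vanFilter c A,
    |z.2.1| ≤ ‖c‖ + 1 ∧ |z.2.2.1| ≤ ‖c‖ + 1 ∧ |z.2.2.2| ≤ ‖c‖ + 1 := by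
  have h : Tendsto (fun z : ℝ × ℝ × ℝ × ℝ => ‖z.2‖) (vanFilter c A) (𝓝 ‖c‖) :=
    (continuous_norm.tendsto c).comp tendsto_snd_vanFilter
  filter_upwards [h.eventually (Iic_mem_nhds (lt_add_one ‖c‖))] with z hz
  have h1 := norm_fst_le z.2
  have h2 := norm_snd_le z.2
  have h3 := norm_fst_le z.2.2
  have h4 := norm_snd_le z.2.2
  simp only [Real.norm_eq_abs] at h1 h3 h4
  exact ⟨by linarith, by linarith, by linarith⟩

/-- Sup bounds for `U² / 2 - P` give convergence to `√(2 P)`. -/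
lemma eventually_abs_maxSol_sub_sqrt_le {e s : ℝ × ℝ × ℝ × ℝ → ℝ}
    (he : Tendsto e (vanFilter c A) (𝓝 0)) (hs : Tendsto s (vanFilter c A) (𝓝 0))
    (hs0 : ∀ᶠ z in vanFilter c A, 0 ≤ s z)
    (h : ∀ᶠ z in vanFilter c A, ∀ x ∈ Ico (-1 : ℝ) 1,
      |1 / 2 * maxSol z.1 z.2 x ^ 2 - P z.2 x| ≤ e z ∧ -s z ≤ maxSol z.1 z.2 x)
    (hP : ∀ x ∈ Icc (-1 : ℝ) 1, 0 ≤ P c x) {δ : ℝ} (hδ : 0 < δ) :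
    ∀ᶠ z in vanFilter c A, ∀ x ∈ Ico (-1 : ℝ) 1,
      |maxSol z.1 z.2 x - √(2 * P c x)| ≤ δ := by
  have hc := tendsto_snd_vanFilter (c := c) (A := A)
  have hd : Tendsto (fun z : ℝ × ℝ × ℝ × ℝ => ‖z.2 - c‖) (vanFilter c A) (𝓝 0) := by
    simpa using (hc.sub_const c).norm
  have ht : Tendsto (fun z => 2 * s z + √(2 * (e z + 5 * ‖z.2 - c‖))) (vanFilter c A) (𝓝 0) := by
    have := (hs.const_mul 2).add (((he.add (hd.const_mul 5)).const_mul 2).sqrt)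
    simpa using this
  filter_upwards [ht.eventually (Iic_mem_nhds hδ), hs0, h] with z hz hs0 hz' x hx
  obtain ⟨h1, h2⟩ := hz' x hx
  refine (abs_sub_sqrt_le (hP x (Ico_subset_Icc_self hx)) ?_ hs0 h2).trans hz
  have e1 : P z.2 x - P c x = P (z.2 - c) x := by
    simp only [P, Prod.fst_sub, Prod.snd_sub]; ring
  have e2 : |P (z.2 - c) x| ≤ 5 * ‖z.2 - c‖ :=
    abs_P_le (norm_fst_le (z.2 - c)) ((norm_fst_le _).trans (norm_snd_le (z.2 - c)))
      ((norm_snd_le _).trans (norm_snd_le (z.2 - c))) (Ico_subset_Icc_self hx)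
  calc |1 / 2 * maxSol z.1 z.2 x ^ 2 - P c x|
      = |(1 / 2 * maxSol z.1 z.2 x ^ 2 - P z.2 x) + (P z.2 x - P c x)| := by ring_nf
    _ ≤ _ := (abs_add_le _ _).trans (by rw [e1]; gcongr)

/-- The sup bound for parameters in `J 0`. -/
lemma exists_maxSol_bound_of_mem_J_zero (c : ℝ × ℝ × ℝ) : ∃ L : ℝ, 0 < L ∧
    ∀ᶠ z in vanFilter c (J 0), ∀ x ∈ Ico (-1 : ℝ) 1,
      |1 / 2 * maxSol z.1 z.2 x ^ 2 - P z.2 x| ≤ L * z.1 ^ (2 / 3 : ℝ) ∧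
        -(2 * z.1) ≤ maxSol z.1 z.2 x := by
  refine ⟨1 + (16 + 48 * (‖c‖ + 1)) ^ 2 + 2 * (8 + 64 * (‖c‖ + 1)) ^ 2, by positivity, ?_⟩
  · filter_upwards [eventually_vanFilter_mem, eventually_vanFilter_pos,
      eventually_vanFilter_le (show (0 : ℝ) < 1 / 8 by norm_num), eventually_vanFilter_bdd]
      with z hz hν hν1 hb x hx
    have hP : ∀ x ∈ Icc (-1 : ℝ) 1, 0 ≤ P z.2 x := fun x hx => P_nonneg_of_mem_J_zero hz.2 hx
    have hU : ∀ x ∈ Ico (-1 : ℝ) 1, -(2 * z.1) ≤ maxSol z.1 z.2 x :=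
      fun x hx => neg_two_mul_le_maxSol hν hz.1 hP hx
    refine ⟨?_, hU x hx⟩
    -- The choice is $\theta=\nu^{1/3}$ and $\eta=0$. Smallness of $\nu$ makes $2\nu\le\theta$, as
    -- $\nu=\theta^2\theta$ with $\theta\le1/2$.
    have t3 : (z.1 ^ (1 / 3 : ℝ)) ^ 3 = z.1 := by
      rw [← Real.rpow_natCast, ← Real.rpow_mul hν.le]; norm_num
    have t2 : (z.1 ^ (1 / 3 : ℝ)) ^ 2 = z.1 ^ (2 / 3 : ℝ) := by
      rw [← Real.rpow_natCast, ← Real.rpow_mul hν.le]; norm_num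
    have t0 : 0 < z.1 ^ (1 / 3 : ℝ) := by positivity
    rw [← t2]
    have hc1 : 0 ≤ z.2.1 := by simpa using hz.2.1
    have t1 : z.1 ^ (1 / 3 : ℝ) ≤ 1 / 2 := by
      by_contra! hlt
      have : (1 / 2 : ℝ) ^ 3 < (z.1 ^ (1 / 3 : ℝ)) ^ 3 := by gcongr
      rw [t3] at this
      norm_num at this
      linarith
    refine abs_maxSol_sq_sub_P_le (b := ‖c‖ + 1) (η := 0) hν hz.1 hc1 hb.1 hb.2.1 hb.2.2 t0
      (by linarith) t3.ge le_rfl (by positivity) (by simpa using hP) (fun y hy => ?_) hx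
    refine le_trans ?_ (hU y hy)
    have t4 : (z.1 ^ (1 / 3 : ℝ)) ^ 2 ≤ (1 / 2) ^ 2 := by gcongr
    have t5 : z.1 = (z.1 ^ (1 / 3 : ℝ)) ^ 2 * z.1 ^ (1 / 3 : ℝ) := by
      rw [← pow_succ]; exact t3.symm
    have t6 := mul_le_mul_of_nonneg_right t4 t0.le
    linarith

lemma tendsto_error (h2 : c.2.1 = 0) (hc3 : c.2.2 = -c.1 / 2) :
    Tendsto (fun z : ℝ × ℝ × ℝ × ℝ => |z.2.2.1| + |2 * z.2.2.2 + z.2.1| ^ 2 + z.1 ^ (2 / 3 : ℝ))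
      (vanFilter c A) (𝓝 0) := by
  have hc := tendsto_snd_vanFilter (c := c) (A := A)
  have t1 : Tendsto (fun z : ℝ × ℝ × ℝ × ℝ => |z.2.2.1| + |2 * z.2.2.2 + z.2.1| ^ 2)
      (vanFilter c A) (𝓝 (|c.2.1| + |2 * c.2.2 + c.1| ^ 2)) := by
    have : Continuous fun c : ℝ × ℝ × ℝ => |c.2.1| + |2 * c.2.2 + c.1| ^ 2 := by fun_prop
    exact (this.tendsto c).comp hc
  have t2 : Tendsto (fun z : ℝ × ℝ × ℝ × ℝ => z.1 ^ (2 / 3 : ℝ)) (vanFilter c A) (𝓝 0) := by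
    have := (Real.continuousAt_rpow_const 0 (2 / 3) (Or.inr (by norm_num))).tendsto.comp
      (tendsto_fst_vanFilter' (c := c) (A := A))
    simpa [Function.comp_def] using this
  have := t1.add t2
  rw [h2, hc3] at this
  convert this using 2
  rw [show 2 * (-c.1 / 2) + c.1 = 0 by ring]
  simp

set_option maxHeartbeats 800000 in
/-- The sup bound for `c₂ = 0`. -/
lemma exists_maxSol_bound_of_snd_eq_zero (hc1 : 0 < c.1) (hc2 : c.2.1 = 0)
    (hc3 : c.2.2 = -c.1 / 2) : ∃ L : ℝ, 0 < L ∧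
    ∀ᶠ z in vanFilter c univ, ∀ x ∈ Ico (-1 : ℝ) 1,
      |1 / 2 * maxSol z.1 z.2 x ^ 2 - P z.2 x| ≤
        L * (|z.2.2.1| + |2 * z.2.2.2 + z.2.1| ^ 2 + z.1 ^ (2 / 3 : ℝ)) ∧
        -√(L * (|z.2.2.1| + |2 * z.2.2.2 + z.2.1| ^ 2 + z.1 ^ (2 / 3 : ℝ))) ≤ maxSol z.1 z.2 x := by
  obtain ⟨L₀, hL₀⟩ : ∃ L₀, L₀ = 1 + (16 + 48 * (‖c‖ + 1)) ^ 2 + 2 * (8 + 64 * (‖c‖ + 1)) ^ 2 :=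
    ⟨_, rfl⟩
  have hL1 : 1 ≤ L₀ := by rw [hL₀, add_assoc]; exact le_add_of_nonneg_right (by positivity)
  -- With $\theta^2=K\tau$, the summand $24=16+8$ absorbs $16\nu^2+8|c_2|$ from the affine lower
  -- bound, and $1/c_1$ absorbs the negative part of $P$.
  obtain ⟨K, hK⟩ : ∃ K, K = 24 + 1 / c.1 := ⟨_, rfl⟩
  have hKc : 1 / c.1 ≤ K := by rw [hK]; linarith
  have hK24 : 24 ≤ K := by rw [hK]; have : 0 < 1 / c.1 := by positivity
                           linarith
  have ht := (tendsto_error (A := univ) hc2 hc3).const_mul K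
  rw [mul_zero] at ht
  have hcc := tendsto_snd_vanFilter (c := c) (A := univ)
  have e1 : ∀ᶠ z in vanFilter c univ, 0 < z.2.1 :=
    ((continuous_fst.tendsto c).comp hcc).eventually (lt_mem_nhds hc1)
  have e3 : ∀ᶠ z in vanFilter c univ, z.2.2.2 ≤ -c.1 / 4 :=
    (((continuous_snd.comp continuous_snd).tendsto c).comp hcc).eventually
      (Iic_mem_nhds (show c.2.2 < _ by linarith))
  refine ⟨L₀ * K, by positivity, ?_⟩
  filter_upwards [eventually_vanFilter_mem, eventually_vanFilter_pos,
    eventually_vanFilter_le one_pos, eventually_vanFilter_bdd, e1, e3,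
    ht.eventually (Iic_mem_nhds one_pos)] with z hz hν hν1 hb hz1 hz3 hτ1 x hx
  obtain ⟨τ, hτ⟩ : ∃ τ, τ = |z.2.2.1| + |2 * z.2.2.2 + z.2.1| ^ 2 + z.1 ^ (2 / 3 : ℝ) := ⟨_, rfl⟩
  rw [← hτ] at hτ1 ⊢
  have hp : 0 < z.1 ^ (2 / 3 : ℝ) := by positivity
  have hn1 := abs_nonneg z.2.2.1
  have hn2 := sq_nonneg (|2 * z.2.2.2 + z.2.1|)
  have hτ0 : 0 < τ := by rw [hτ]; positivity
  have hKτ : 0 < K * τ := by positivity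
  have hθ2 : √(K * τ) ^ 2 = K * τ := Real.sq_sqrt hKτ.le
  have hθ0 : 0 < √(K * τ) := Real.sqrt_pos.2 hKτ
  have hντ : z.1 ^ (2 / 3 : ℝ) ≤ K * τ := by nlinarith
  have hη : (2 * z.2.2.2 + z.2.1) ^ 2 / c.1 + 2 * |z.2.2.1| ≤ K * τ := by
    have : (2 * z.2.2.2 + z.2.1) ^ 2 / c.1 ≤ K * |2 * z.2.2.2 + z.2.1| ^ 2 := by
      rw [sq_abs, div_eq_mul_one_div, mul_comm]
      gcongr
    rw [hτ]
    nlinarith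
  have hP : ∀ x ∈ Icc (-1 : ℝ) 1,
      -((2 * z.2.2.2 + z.2.1) ^ 2 / c.1 + 2 * |z.2.2.1|) ≤ P z.2 x := by
    intro x hx
    have y1 : 0 ≤ 1 - x := by linarith [hx.2]
    have y2 : 0 ≤ 1 + x := by linarith [hx.1]
    have p1 : -(2 * |z.2.2.1|) ≤ z.2.2.1 * (1 + x) := by
      have := neg_abs_le z.2.2.1
      nlinarith [hx.2]
    -- Since $-c_3\ge c_1/4$ with the limiting $c_1$, this factor of $P$ dominates
    -- $s(1-x)+\tfrac{c_1}4(1-x)^2$, where $s=2c_3+c_1$ at the perturbed parameters. Completing the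
    -- square bounds it below by $-s^2/c_1$, whence the quadratic error term.
    have p2 : -((2 * z.2.2.2 + z.2.1) ^ 2 / c.1) ≤
        (1 - x) * ((2 * z.2.2.2 + z.2.1) - z.2.2.2 * (1 - x)) := by
      have q1 : (2 * z.2.2.2 + z.2.1) ^ 2 / c.1 + (2 * z.2.2.2 + z.2.1) * (1 - x) +
          c.1 / 4 * (1 - x) ^ 2 = ((2 * z.2.2.2 + z.2.1) + c.1 / 2 * (1 - x)) ^ 2 / c.1 := by
        field_simp
        ring
      have q2 : 0 ≤ ((2 * z.2.2.2 + z.2.1) + c.1 / 2 * (1 - x)) ^ 2 / c.1 := by positivity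
      nlinarith [sq_nonneg (1 - x)]
    rw [P]
    linarith
  have hUθ : ∀ x ∈ Ico (-1 : ℝ) 1, -√(K * τ) ≤ maxSol z.1 z.2 x := by
    intro x hx
    refine le_trans ?_ (affSol_le_maxSol hν hz.1 hx)
    have hs : √(z.1 ^ 2 + z.2.2.1) ^ 2 = z.1 ^ 2 + z.2.2.1 :=
      Real.sq_sqrt (by linarith [hz.1.2.1])
    have hs0 := Real.sqrt_nonneg (z.1 ^ 2 + z.2.2.1)
    have hs1 := Real.sqrt_nonneg (z.1 ^ 2 + z.2.1)
    have hν2 : z.1 ^ 2 ≤ z.1 ^ (2 / 3 : ℝ) := by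
      rw [← Real.rpow_natCast]
      exact Real.rpow_le_rpow_of_exponent_ge hν hν1 (by norm_num)
    have hle : 2 * (z.1 + √(z.1 ^ 2 + z.2.2.1)) ≤ √(K * τ) := by
      refine Real.le_sqrt_of_sq_le ?_
      have := le_abs_self z.2.2.1
      have : (2 * (z.1 + √(z.1 ^ 2 + z.2.2.1))) ^ 2 ≤ 16 * z.1 ^ 2 + 8 * |z.2.2.1| := by
        nlinarith [sq_nonneg (z.1 - √(z.1 ^ 2 + z.2.2.1))]
      refine this.trans ?_
      have : 24 * τ ≤ K * τ := by gcongr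
      linarith
    rw [affSol]
    have : 0 ≤ (z.1 + √(z.1 ^ 2 + z.2.1)) * (1 - x) :=
      mul_nonneg (by positivity) (by linarith [hx.2])
    nlinarith [hx.2]
  refine ⟨?_, ?_⟩
  · have hθ1 : √(K * τ) ≤ 1 := Real.sqrt_le_one.2 hτ1
    have hνθ : z.1 ≤ √(K * τ) ^ 3 := by
      have t3 : (z.1 ^ (1 / 3 : ℝ)) ^ 3 = z.1 := by
        rw [← Real.rpow_natCast, ← Real.rpow_mul hν.le]; norm_num
      have t2 : (z.1 ^ (1 / 3 : ℝ)) ^ 2 = z.1 ^ (2 / 3 : ℝ) := by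
        rw [← Real.rpow_natCast, ← Real.rpow_mul hν.le]; norm_num
      have : z.1 ^ (1 / 3 : ℝ) ≤ √(K * τ) := Real.le_sqrt_of_sq_le (by rw [t2]; exact hντ)
      calc z.1 = (z.1 ^ (1 / 3 : ℝ)) ^ 3 := t3.symm
        _ ≤ _ := by gcongr
    have := abs_maxSol_sq_sub_P_le hν hz.1 hz1.le hb.1 hb.2.1 hb.2.2 hθ0 hθ1 hνθ
      (by positivity) (hη.trans_eq hθ2.symm) hP hUθ hx
    rwa [hθ2, ← hL₀, ← mul_assoc] at this
  · refine le_trans (neg_le_neg ?_) (hUθ x hx)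
    refine Real.sqrt_le_sqrt ?_
    rw [mul_assoc]
    exact le_mul_of_one_le_left hKτ.le hL1

end

/-! ### Norms -/

lemma linfNorm_le {f : ℝ → ℝ} {a : ℝ} (h : ∀ x ∈ Ioo (-1 : ℝ) 1, |f x| ≤ a) :
    linfNorm f ≤ ENNReal.ofReal a := by
  rw [linfNorm, eLpNorm_exponent_top]
  exact eLpNormEssSup_le_of_ae_bound (ae_restrict_of_forall_mem measurableSet_Ioo h)

lemma eHolderNorm_domRestrict_le {f : ℝ → ℝ} {S : Set ℝ} {β : ℝ≥0} {h : ℝ} (hh : 0 ≤ h)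
    (hf : ∀ x ∈ S, ∀ y ∈ S, |f x - f y| ≤ h * |x - y| ^ (β : ℝ)) :
    eHolderNorm β (S.domRestrict f) ≤ ENNReal.ofReal h := by
  have : HolderWith (Real.toNNReal h) β (S.domRestrict f) := by
    rintro ⟨x, hx⟩ ⟨y, hy⟩
    have := hf x hx y hy
    rw [Subtype.edist_eq, edist_dist, edist_dist,
      ENNReal.ofReal_rpow_of_nonneg dist_nonneg β.coe_nonneg, ← ENNReal.ofReal.eq_1,
      ← ENNReal.ofReal_mul hh]
    exact ENNReal.ofReal_le_ofReal this
  exact this.eHolderNorm_le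

lemma linfNorm_add_holderNorm_le {f : ℝ → ℝ} {S : Set ℝ} {β : ℝ≥0} {a h ν : ℝ} (hν : 0 < ν)
    (hν1 : ν ≤ 1) (ha : 0 ≤ a) (hh : 0 ≤ h) (hS : S ⊆ Ioo (-1) 1)
    (hf : ∀ x ∈ Ioo (-1 : ℝ) 1, |f x| ≤ a * ν ^ (2 / 3 : ℝ))
    (hf' : ∀ x ∈ S, ∀ y ∈ S, |f x - f y| ≤ h * ν ^ (2 / 3 - (β : ℝ)) * |x - y| ^ (β : ℝ)) :
    linfNorm f + ENNReal.ofReal (ν ^ (β : ℝ)) * holderNorm β f S ≤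
      ENNReal.ofReal ((2 * a + h) * ν ^ (2 / 3 : ℝ)) := by
  have e1 := linfNorm_le hf
  have e2 : (⨆ x ∈ S, ‖f x‖ₑ) ≤ ENNReal.ofReal (a * ν ^ (2 / 3 : ℝ)) := by
    refine iSup₂_le fun x hx => ?_
    rw [← ofReal_norm]
    exact ENNReal.ofReal_le_ofReal (hf x (hS hx))
  have e3 := eHolderNorm_domRestrict_le (by positivity) hf'
  have e4 : ν ^ (β : ℝ) ≤ 1 := Real.rpow_le_one hν.le hν1 β.coe_nonneg
  calc linfNorm f + ENNReal.ofReal (ν ^ (β : ℝ)) * holderNorm β f S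
      ≤ ENNReal.ofReal (a * ν ^ (2 / 3 : ℝ)) + ENNReal.ofReal (ν ^ (β : ℝ)) *
        (ENNReal.ofReal (a * ν ^ (2 / 3 : ℝ)) + ENNReal.ofReal (h * ν ^ (2 / 3 - (β : ℝ)))) := by
        rw [holderNorm]; gcongr
    _ = ENNReal.ofReal (a * ν ^ (2 / 3 : ℝ) + ν ^ (β : ℝ) *
        (a * ν ^ (2 / 3 : ℝ) + h * ν ^ (2 / 3 - (β : ℝ)))) := by
        rw [← ENNReal.ofReal_add (by positivity) (by positivity),
          ← ENNReal.ofReal_mul (by positivity), ← ENNReal.ofReal_add (by positivity) (by positivity)]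
    _ ≤ _ := by
        refine ENNReal.ofReal_le_ofReal ?_
        have e5 : ν ^ (β : ℝ) * ν ^ (2 / 3 - (β : ℝ)) = ν ^ (2 / 3 : ℝ) := by
          rw [← Real.rpow_add hν]; congr 1; ring
        have e6 : ν ^ (β : ℝ) * (a * ν ^ (2 / 3 : ℝ)) ≤ a * ν ^ (2 / 3 : ℝ) :=
          mul_le_of_le_one_left (by positivity) e4
        linear_combination e6 + h * e5

/-- Interpolation split at distance $\nu$: the Lipschitz bound is used for $|x-y|\le\nu$, the sup
bound for $|x-y|\ge\nu$. Both yield $\nu^{2/3-\beta}$. -/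
lemma holder_of_lipschitz {f : ℝ → ℝ} {S : Set ℝ} {β a d ν : ℝ} (hν : 0 < ν) (hβ : 0 < β)
    (hβ1 : β < 1) (ha : 0 ≤ a) (hd : 0 ≤ d) (hf : ∀ x ∈ S, |f x| ≤ a * ν ^ (2 / 3 : ℝ))
    (hf' : ∀ x ∈ S, ∀ y ∈ S, |f x - f y| ≤ d * ν ^ (-1 / 3 : ℝ) * |x - y|) :
    ∀ x ∈ S, ∀ y ∈ S, |f x - f y| ≤ (2 * a + d) * ν ^ (2 / 3 - β) * |x - y| ^ β := by
  intro x hx y hy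
  rcases eq_or_ne x y with rfl | hxy
  · simp [Real.zero_rpow hβ.ne']
  have hr : 0 < |x - y| := abs_pos.2 (sub_ne_zero.2 hxy)
  have hfin := hf' x hx y hy
  have hx' := hf x hx
  have hy' := hf y hy
  generalize |x - y| = r at *
  have hq : 0 < ν ^ (2 / 3 - β) * r ^ β := by positivity
  rcases le_total r ν with h | h
  · have e1 : r ≤ r ^ β * ν ^ (1 - β) := by
      calc r = r ^ β * r ^ (1 - β) := by rw [← Real.rpow_add hr]; simp
        _ ≤ _ := by gcongr
    have e2 : ν ^ (-1 / 3 : ℝ) * ν ^ (1 - β) = ν ^ (2 / 3 - β) := by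
      rw [← Real.rpow_add hν]; congr 1; ring
    calc |f x - f y| ≤ d * ν ^ (-1 / 3 : ℝ) * r := hfin
      _ ≤ d * ν ^ (-1 / 3 : ℝ) * (r ^ β * ν ^ (1 - β)) := by gcongr
      _ = d * (ν ^ (2 / 3 - β) * r ^ β) := by rw [← e2]; ring
      _ ≤ (2 * a + d) * (ν ^ (2 / 3 - β) * r ^ β) := by gcongr; linarith
      _ = _ := by ring
  · have e1 : ν ^ (2 / 3 : ℝ) ≤ ν ^ (2 / 3 - β) * r ^ β := by
      calc ν ^ (2 / 3 : ℝ) = ν ^ (2 / 3 - β) * ν ^ β := by rw [← Real.rpow_add hν]; simp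
        _ ≤ _ := by gcongr
    calc |f x - f y| ≤ |f x| + |f y| := abs_sub _ _
      _ ≤ 2 * a * ν ^ (2 / 3 : ℝ) := by linarith
      _ ≤ 2 * a * (ν ^ (2 / 3 - β) * r ^ β) := by gcongr
      _ ≤ (2 * a + d) * (ν ^ (2 / 3 - β) * r ^ β) := by gcongr; linarith
      _ = _ := by ring

/-- The Hölder bound for the error in the equation, in the interior. -/
lemma exists_holder_bound (c : ℝ × ℝ × ℝ) {ε β : ℝ} (hε : 0 < ε) (hβ : 0 < β) (hβ1 : β < 1) :
    ∃ a h : ℝ, 0 ≤ a ∧ 0 ≤ h ∧ ∀ᶠ z in vanFilter c (J 0),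
      (∀ x ∈ Ioo (-1 : ℝ) 1, |1 / 2 * maxSol z.1 z.2 x ^ 2 - P z.2 x| ≤ a * z.1 ^ (2 / 3 : ℝ)) ∧
      ∀ x ∈ Ioo (-1 + ε) (1 - ε), ∀ y ∈ Ioo (-1 + ε) (1 - ε),
        |(1 / 2 * maxSol z.1 z.2 x ^ 2 - P z.2 x) - (1 / 2 * maxSol z.1 z.2 y ^ 2 - P z.2 y)| ≤
          h * z.1 ^ (2 / 3 - β) * |x - y| ^ β := by
  obtain ⟨L, hL, hbd⟩ := exists_maxSol_bound_of_mem_J_zero c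
  obtain ⟨b, hb⟩ : ∃ b, b = ‖c‖ + 1 := ⟨_, rfl⟩
  have hb0 : 0 ≤ b := by rw [hb]; positivity
  -- A bound for $|U|$: $U^2\le2(5b+L)$ and $|U|\le U^2+1$.
  obtain ⟨W, hW⟩ : ∃ W, W = 10 * b + 2 * L + 1 := ⟨_, rfl⟩
  have hW0 : 0 ≤ W := by rw [hW]; positivity
  refine ⟨L, 2 * L + (W * ((L + 2 * W) / ε) + 4 * b), hL.le, by positivity, ?_⟩
  filter_upwards [hbd, eventually_vanFilter_mem, eventually_vanFilter_pos,
    eventually_vanFilter_le one_pos, eventually_vanFilter_bdd] with z hz hmem hν hν1 hbz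
  rw [← hb] at hbz
  refine ⟨fun x hx => (hz x (Ioo_subset_Ico_self hx)).1, ?_⟩
  have hsub : Ioo (-1 + ε) (1 - ε) ⊆ Ioo (-1) 1 := Ioo_subset_Ioo (by linarith) (by linarith)
  refine holder_of_lipschitz hν hβ hβ1 hL.le (by positivity)
    (f := fun x => 1 / 2 * maxSol z.1 z.2 x ^ 2 - P z.2 x)
    (fun x hx => (hz x (Ioo_subset_Ico_self (hsub hx))).1) ?_
  have p3 : 1 ≤ z.1 ^ (-1 / 3 : ℝ) := Real.one_le_rpow_of_pos_of_le_one_of_nonpos hν hν1 (by norm_num)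
  have p2 : z.1 ^ (2 / 3 : ℝ) = z.1 * z.1 ^ (-1 / 3 : ℝ) := by
    rw [mul_comm, ← Real.rpow_add_one hν.ne']; norm_num
  have p1 : z.1 ^ (2 / 3 : ℝ) ≤ 1 := Real.rpow_le_one hν.le hν1 (by norm_num)
  have hderiv : ∀ x ∈ Ioo (-1 + ε) (1 - ε), ∃ d,
      HasDerivAt (fun x => 1 / 2 * maxSol z.1 z.2 x ^ 2 - P z.2 x) d x ∧
      |d| ≤ (W * ((L + 2 * W) / ε) + 4 * b) * z.1 ^ (-1 / 3 : ℝ) := by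
    intro x hx
    have hxI := Ioo_subset_Ico_self (hsub hx)
    have hxI' := Ico_subset_Icc_self hxI
    obtain ⟨d, hd, he⟩ := maxSol_hasDerivAt' hν hmem.1 hxI
    refine ⟨_, ((hd.pow 2).const_mul (1 / 2)).sub (hasDerivAt_P z.2 x), ?_⟩
    have hh := (hz x hxI).1
    have hPb := abs_P_le hbz.1 hbz.2.1 hbz.2.2 hxI'
    have hPd := abs_deriv_P_le hbz.1 hbz.2.1 hbz.2.2 hxI'
    have hq : ε ≤ 1 - x ^ 2 := by
      rcases le_total 0 x with h0 | h0 <;> nlinarith [hx.1, hx.2]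
    have hx1 : |x| ≤ 1 := abs_le.2 hxI'
    generalize maxSol z.1 z.2 x = u at *
    generalize -z.2.1 + z.2.2.1 - 2 * z.2.2.2 * x = p' at *
    generalize P z.2 x = p at *
    have hu2 : u ^ 2 ≤ 10 * b + 2 * L := by
      have := (abs_le.1 hh).2
      have := (abs_le.1 hPb).2
      have : L * z.1 ^ (2 / 3 : ℝ) ≤ L := mul_le_of_le_one_right hL.le p1
      linarith
    have hu : |u| ≤ W := by
      rw [← sq_abs] at hu2
      rw [hW]
      nlinarith [sq_nonneg (|u| - 1)]
    -- The equation reads $\nu(1-x^2)U'=-(U^2/2-P)-2\nu xU=O(\nu^{2/3})$, and $1-x^2\ge\varepsilon$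
    -- in the interior.
    have hd' : |d| ≤ (L + 2 * W) / ε * z.1 ^ (-1 / 3 : ℝ) := by
      have k1 : z.1 * (1 - x ^ 2) * d = -(1 / 2 * u ^ 2 - p) - 2 * z.1 * (x * u) := by
        linear_combination he
      have k2 : z.1 * ε * |d| ≤ L * z.1 ^ (2 / 3 : ℝ) + 2 * z.1 * W := by
        calc z.1 * ε * |d| ≤ z.1 * (1 - x ^ 2) * |d| := by gcongr
          _ = |z.1 * (1 - x ^ 2) * d| := by
            rw [abs_mul, abs_of_nonneg (mul_nonneg hν.le (hε.le.trans hq))]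
          _ ≤ |1 / 2 * u ^ 2 - p| + 2 * z.1 * (|x| * |u|) := by
            rw [k1]
            refine (abs_sub _ _).trans ?_
            rw [abs_neg, abs_mul, abs_mul, abs_mul, abs_two, abs_of_pos hν]
          _ ≤ L * z.1 ^ (2 / 3 : ℝ) + 2 * z.1 * (1 * W) := by gcongr
          _ = _ := by ring
      have k3 : z.1 * ε * |d| ≤ z.1 * ((L + 2 * W) * z.1 ^ (-1 / 3 : ℝ)) := by
        refine k2.trans ?_
        rw [p2]
        have : 2 * z.1 * W * 1 ≤ 2 * z.1 * W * z.1 ^ (-1 / 3 : ℝ) := by gcongr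
        linarith
      rw [mul_assoc] at k3
      have k4 := le_of_mul_le_mul_left k3 hν
      rw [div_mul_eq_mul_div, le_div_iff₀ hε]
      linarith
    have e : 1 / 2 * (((2 : ℕ) : ℝ) * u ^ (2 - 1) * d) - p' = u * d - p' := by
      push_cast; ring
    rw [e]
    calc |u * d - p'| ≤ |u| * |d| + |p'| := by rw [← abs_mul]; exact abs_sub _ _
      _ ≤ W * ((L + 2 * W) / ε * z.1 ^ (-1 / 3 : ℝ)) + 4 * b * z.1 ^ (-1 / 3 : ℝ) := by
        gcongr
        exact hPd.trans (le_mul_of_one_le_right (by positivity) p3)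
      _ = _ := by ring
  choose! d hd hd' using hderiv
  intro x hx y hy
  have := (convex_Ioo (-1 + ε) (1 - ε)).norm_image_sub_le_of_norm_hasDerivWithin_le
    (fun x hx => (hd x hx).hasDerivWithinAt) (fun x hx => hd' x hx) hy hx
  simpa using this

/-! ### Families of analytic functions with uniformly bounded derivatives -/

section
variable {ι : Type*} {l : Filter ι} {K K' : Set ℝ} {f g : ι → ℝ → ℝ} {ρ σ : ι → ℝ} {n m : ℕ}

/-- `f z = O(ρ z)` uniformly on `K`, along `l`. -/
def SupO (l : Filter ι) (K : Set ℝ) (f : ι → ℝ → ℝ) (ρ : ι → ℝ) : Prop :=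
  ∃ C : ℝ, ∀ᶠ z in l, ∀ x ∈ K, |f z x| ≤ C * ρ z

/-- The functions `f z` are eventually analytic at the points of `K`. -/
def AnalO (l : Filter ι) (K : Set ℝ) (f : ι → ℝ → ℝ) : Prop :=
  ∀ᶠ z in l, ∀ x ∈ K, AnalyticAt ℝ (f z) x

/-- The derivatives of order at most `n` are `O(ρ)` uniformly on `K`. -/
def CmO (l : Filter ι) (K : Set ℝ) (n : ℕ) (f : ι → ℝ → ℝ) (ρ : ι → ℝ) : Prop :=
  AnalO l K f ∧ ∀ j ≤ n, SupO l K (fun z => iteratedDeriv j (f z)) ρ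

protected lemma SupO.congr (h : SupO l K f ρ) (hfg : ∀ᶠ z in l, ∀ x ∈ K, f z x = g z x) :
    SupO l K g ρ := by
  obtain ⟨C, hC⟩ := h
  refine ⟨C, ?_⟩
  filter_upwards [hC, hfg] with z hz hz' x hx
  rw [← hz' x hx]; exact hz x hx

protected lemma SupO.add (hf : SupO l K f ρ) (hg : SupO l K g ρ) :
    SupO l K (fun z x => f z x + g z x) ρ := by
  obtain ⟨C, hC⟩ := hf
  obtain ⟨D, hD⟩ := hg
  refine ⟨C + D, ?_⟩
  filter_upwards [hC, hD] with z h1 h2 x hx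
  rw [add_mul]
  exact (abs_add_le _ _).trans (add_le_add (h1 x hx) (h2 x hx))

protected lemma SupO.mul (hf : SupO l K f ρ) (hg : SupO l K g σ) :
    SupO l K (fun z x => f z x * g z x) (ρ * σ) := by
  obtain ⟨C, hC⟩ := hf
  obtain ⟨D, hD⟩ := hg
  refine ⟨C * D, ?_⟩
  filter_upwards [hC, hD] with z h1 h2 x hx
  rw [abs_mul, Pi.mul_apply, mul_mul_mul_comm]
  exact mul_le_mul (h1 x hx) (h2 x hx) (abs_nonneg _) ((abs_nonneg _).trans (h1 x hx))

lemma SupO.rate_mono (hf : SupO l K f ρ) (h : ∀ᶠ z in l, 0 ≤ ρ z ∧ ρ z ≤ σ z) :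
    SupO l K f σ := by
  obtain ⟨C, hC⟩ := hf
  refine ⟨|C|, ?_⟩
  filter_upwards [hC, h] with z h1 h2 x hx
  calc |f z x| ≤ C * ρ z := h1 x hx
    _ ≤ |C| * ρ z := by gcongr; exacts [h2.1, le_abs_self C]
    _ ≤ |C| * σ z := by gcongr; exact h2.2

lemma SupO.exists_pos (hf : SupO l K f ρ) (hρ : ∀ᶠ z in l, 0 < ρ z) :
    ∃ C, 0 < C ∧ ∀ᶠ z in l, ∀ x ∈ K, |f z x| < C * ρ z := by
  obtain ⟨C, hC⟩ := hf
  refine ⟨|C| + 1, by positivity, ?_⟩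
  filter_upwards [hC, hρ] with z h1 h2 x hx
  calc |f z x| ≤ C * ρ z := h1 x hx
    _ < (|C| + 1) * ρ z := by gcongr; linarith [le_abs_self C]

protected lemma AnalO.mono (h : AnalO l K f) (hK : K' ⊆ K) : AnalO l K' f :=
  Eventually.mono h fun _ hz x hx => hz x (hK hx)

protected lemma AnalO.deriv (h : AnalO l K f) : AnalO l K fun z => deriv (f z) :=
  Eventually.mono h fun _ hz x hx => (hz x hx).deriv

protected lemma AnalO.iteratedDeriv (h : AnalO l K f) (n : ℕ) :
    AnalO l K fun z => iteratedDeriv n (f z) := by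
  refine Eventually.mono h fun z hz x hx => ?_
  simp only [iteratedDeriv_eq_iterate]
  exact (hz x hx).iterated_deriv n

protected lemma AnalO.add (hf : AnalO l K f) (hg : AnalO l K g) : AnalO l K fun z x => f z x + g z x := by
  filter_upwards [hf, hg] with z h1 h2 x hx using (h1 x hx).fun_add (h2 x hx)

protected lemma AnalO.mul (hf : AnalO l K f) (hg : AnalO l K g) : AnalO l K fun z x => f z x * g z x := by
  filter_upwards [hf, hg] with z h1 h2 x hx using (h1 x hx).fun_mul (h2 x hx)

/-- Equality near the points of `K`. -/
def EqNear (l : Filter ι) (K : Set ℝ) (f g : ι → ℝ → ℝ) : Prop :=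
  ∀ᶠ z in l, ∀ x ∈ K, f z =ᶠ[𝓝 x] g z

protected lemma EqNear.deriv (h : EqNear l K f g) :
    EqNear l K (fun z => deriv (f z)) (fun z => deriv (g z)) :=
  Eventually.mono h fun _ hz x hx => (hz x hx).deriv

protected lemma EqNear.eq (h : EqNear l K f g) : ∀ᶠ z in l, ∀ x ∈ K, f z x = g z x :=
  Eventually.mono h fun _ hz x hx => (hz x hx).self_of_nhds

protected lemma EqNear.iteratedDeriv (h : EqNear l K f g) (n : ℕ) :
    EqNear l K (fun z => iteratedDeriv n (f z)) (fun z => iteratedDeriv n (g z)) := by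
  induction n with
  | zero => simpa using h
  | succ n ih => simpa only [iteratedDeriv_succ] using ih.deriv

/-- Equality on neighbourhoods is required because equality on `K` alone does not pass to
derivatives. -/
protected lemma CmO.congr (hf : CmO l K n f ρ) (h : EqNear l K f g) : CmO l K n g ρ := by
  refine ⟨?_, fun j hj => (hf.2 j hj).congr (h.iteratedDeriv j).eq⟩
  filter_upwards [hf.1, h] with z h1 h2 x hx using (h1 x hx).congr (h2 x hx)

lemma CmO.of_le (hf : CmO l K n f ρ) (h : m ≤ n) : CmO l K m f ρ :=
  ⟨hf.1, fun j hj => hf.2 j (hj.trans h)⟩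

lemma CmO.supO (hf : CmO l K n f ρ) : SupO l K f ρ := by simpa using hf.2 0 (Nat.zero_le n)

protected lemma CmO.deriv (hf : CmO l K (n + 1) f ρ) : CmO l K n (fun z => deriv (f z)) ρ :=
  ⟨hf.1.deriv, fun j hj => by simpa only [iteratedDeriv_succ'] using hf.2 (j + 1) (by omega)⟩

protected lemma CmO.iteratedDeriv (k : ℕ) (hf : CmO l K (n + k) f ρ) :
    CmO l K n (fun z => iteratedDeriv k (f z)) ρ := by
  induction k generalizing n with
  | zero => simpa using hf
  | succ k ih =>
    simp only [iteratedDeriv_succ]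
    exact (ih (n := n + 1) (by rwa [show n + 1 + k = n + (k + 1) by ring])).deriv

lemma CmO.of_supO (hf : AnalO l K f) (h : SupO l K f ρ) : CmO l K 0 f ρ :=
  ⟨hf, fun j hj => by simpa [Nat.le_zero.1 hj] using h⟩

lemma CmO.of_deriv (hf : AnalO l K f) (h : SupO l K f ρ) (h' : CmO l K n (fun z => deriv (f z)) ρ) :
    CmO l K (n + 1) f ρ := by
  refine ⟨hf, fun j hj => ?_⟩
  cases j with
  | zero => simpa using h
  | succ j => simpa only [iteratedDeriv_succ'] using h'.2 j (by omega)

lemma CmO.succ (hf : CmO l K n f ρ) (h : SupO l K (fun z => iteratedDeriv (n + 1) (f z)) ρ) :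
    CmO l K (n + 1) f ρ := by
  refine ⟨hf.1, fun j hj => ?_⟩
  rcases Nat.lt_or_ge n j with h1 | h1
  · rwa [show j = n + 1 by omega]
  · exact hf.2 j h1

lemma AnalO.deriv_add (hf : AnalO l K f) (hg : AnalO l K g) :
    EqNear l K (fun z x => deriv (f z) x + deriv (g z) x)
      (fun z => deriv fun x => f z x + g z x) := by
  filter_upwards [hf, hg] with z h1 h2 x hx
  filter_upwards [(h1 x hx).eventually_analyticAt, (h2 x hx).eventually_analyticAt] with y e1 e2
  exact (e1.differentiableAt.hasDerivAt.add e2.differentiableAt.hasDerivAt).deriv.symm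

lemma AnalO.deriv_mul (hf : AnalO l K f) (hg : AnalO l K g) :
    EqNear l K (fun z x => deriv (f z) x * g z x + f z x * deriv (g z) x)
      (fun z => deriv fun x => f z x * g z x) := by
  filter_upwards [hf, hg] with z h1 h2 x hx
  filter_upwards [(h1 x hx).eventually_analyticAt, (h2 x hx).eventually_analyticAt] with y e1 e2
  exact (e1.differentiableAt.hasDerivAt.mul e2.differentiableAt.hasDerivAt).deriv.symm

protected lemma CmO.add (hf : CmO l K n f ρ) (hg : CmO l K n g ρ) :
    CmO l K n (fun z x => f z x + g z x) ρ := by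
  induction n generalizing f g with
  | zero => exact .of_supO (hf.1.add hg.1) (hf.supO.add hg.supO)
  | succ n ih =>
    exact .of_deriv (hf.1.add hg.1) (hf.supO.add hg.supO)
      ((ih hf.deriv hg.deriv).congr (hf.1.deriv_add hg.1))

protected lemma CmO.mul (hf : CmO l K n f ρ) (hg : CmO l K n g σ) :
    CmO l K n (fun z x => f z x * g z x) (ρ * σ) := by
  induction n generalizing f g with
  | zero => exact .of_supO (hf.1.mul hg.1) (hf.supO.mul hg.supO)
  | succ n ih =>
    refine .of_deriv (hf.1.mul hg.1) (hf.supO.mul hg.supO) ?_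
    refine CmO.congr (CmO.add (ih hf.deriv (hg.of_le n.le_succ)) ?_) (hf.1.deriv_mul hg.1)
    exact ih (hf.of_le n.le_succ) hg.deriv

lemma CmO.const {a : ι → ℝ} (h : ∃ C, ∀ᶠ z in l, |a z| ≤ C * ρ z)
    (hρ : ∀ᶠ z in l, 0 ≤ ρ z) : CmO l K n (fun z _ => a z) ρ := by
  obtain ⟨C, hC⟩ := h
  refine ⟨Eventually.of_forall fun z x _ => analyticAt_const, fun j _ => ?_⟩
  cases j with
  | zero => exact ⟨C, hC.mono fun z hz x _ => by simpa using hz⟩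
  | succ j =>
    refine ⟨0, hρ.mono fun z hz x _ => ?_⟩
    simp [iteratedDeriv_const]

lemma CmO.const_one (a : ℝ) : CmO l K n (fun _ _ => a) 1 :=
  CmO.const ⟨|a|, by simp⟩ (by simp)

protected lemma CmO.id (hK : K ⊆ Icc (-1) 1) : CmO l K n (fun _ x => x) 1 := by
  have ha : AnalO l K fun _ x => x := Eventually.of_forall fun _ x _ => analyticAt_id
  have hs : SupO l K (fun _ x => x) 1 :=
    ⟨1, Eventually.of_forall fun _ x hx => by simpa using abs_le.2 (hK hx)⟩
  cases n with
  | zero => exact .of_supO ha hs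
  | succ n => exact .of_deriv ha hs (by simpa using CmO.const_one 1)

lemma CmO.mul_one (hf : CmO l K n f ρ) (hg : CmO l K n g 1) :
    CmO l K n (fun z x => f z x * g z x) ρ := by
  simpa using hf.mul hg

lemma CmO.one_mul (hf : CmO l K n f 1) (hg : CmO l K n g ρ) :
    CmO l K n (fun z x => f z x * g z x) ρ := by
  simpa using hf.mul hg

lemma CmO.const_mul (a : ℝ) (hg : CmO l K n g ρ) : CmO l K n (fun z x => a * g z x) ρ :=
  (CmO.const_one a).one_mul hg

protected lemma CmO.neg (hg : CmO l K n g ρ) : CmO l K n (fun z x => -g z x) ρ := by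
  simpa using hg.const_mul (-1)

protected lemma CmO.sub (hf : CmO l K n f ρ) (hg : CmO l K n g ρ) :
    CmO l K n (fun z x => f z x - g z x) ρ := by
  simpa [sub_eq_add_neg] using hf.add hg.neg

lemma CmO.rate_mono (hf : CmO l K n f ρ) (h : ∀ᶠ z in l, 0 ≤ ρ z ∧ ρ z ≤ σ z) :
    CmO l K n f σ :=
  ⟨hf.1, fun j hj => (hf.2 j hj).rate_mono h⟩

end

/-! ### Linear first-order equations with a small parameter -/

/-- The right-hand side is a strict supersolution: $\kappa\ge\delta$ makes $\kappa\cdot k\nu/\delta$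
exceed $g$, and since $1-x^2\le1$ the exponential decays no faster than damping at rate $\delta$
allows. -/
lemma linear_ode_upper {E κ g : ℝ → ℝ} {p q ν δ k B : ℝ} (hν : 0 < ν) (hδ : 0 < δ) (hk : 0 < k)
    (hB : 0 ≤ B) (hp : -1 ≤ p) (hq : q < 1) (hE : ∀ x ∈ Icc p q, DifferentiableAt ℝ E x)
    (he : ∀ x ∈ Icc p q, ν * (1 - x ^ 2) * deriv E x + κ x * E x = g x)
    (hκ : ∀ x ∈ Icc p q, δ ≤ κ x) (hg : ∀ x ∈ Icc p q, |g x| < k * ν) (hEp : E p ≤ B) :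
    ∀ x ∈ Icc p q, E x ≤ k * ν / δ + B * Real.exp (-(δ / ν * (x - p))) := by
  have hd : ∀ x ∈ Icc p q, HasDerivAt
      (fun x => k * ν / δ + B * Real.exp (-(δ / ν * (x - p))) - E x)
      (-(B * Real.exp (-(δ / ν * (x - p))) * (δ / ν)) - deriv E x) x := by
    intro x hx
    have h1 := ((((hasDerivAt_id x).sub_const p).const_mul (δ / ν)).neg.exp.const_mul B).const_add
      (k * ν / δ)
    refine (h1.sub (hE x hx).hasDerivAt).congr_deriv ?_
    simp only [Pi.neg_apply, _root_.id]
    ring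
  intro x hx
  have key := pos_of_crossing (fun x hx => (hd x hx).continuousAt.continuousWithinAt) ?_
    (fun y hy h0 => ⟨_, ?_, hd y (Ioc_subset_Icc_self hy)⟩) x hx
  · linarith
  · have : 0 < k * ν / δ := by positivity
    simp only [sub_self, mul_zero, neg_zero, Real.exp_zero]
    linarith
  · have hyI := Ioc_subset_Icc_self hy
    have hy1 : -1 < y := hp.trans_lt hy.1
    have hy2 : y < 1 := hy.2.trans_lt hq
    have q0 : 0 < 1 - y ^ 2 := by nlinarith
    have e1 := he y hyI
    have e2 := hκ y hyI
    have e3 := (abs_lt.1 (hg y hyI)).2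
    have hb : 0 ≤ B * Real.exp (-(δ / ν * (y - p))) := by positivity
    generalize B * Real.exp (-(δ / ν * (y - p))) = b at *
    have e4 : E y = k * ν / δ + b := by linarith
    have e5 : δ * (k * ν / δ + b) ≤ κ y * E y := by
      rw [e4]; gcongr
    have e6 : δ * (k * ν / δ + b) = k * ν + δ * b := by field_simp
    have e7 : ν * (1 - y ^ 2) * (-(b * (δ / ν)) - deriv E y) =
        κ y * E y - g y - δ * b * (1 - y ^ 2) := by
      have : ν * (b * (δ / ν)) = δ * b := by field_simp
      linear_combination (-(1 - y ^ 2)) * this - e1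
    have e8 : δ * b * (1 - y ^ 2) ≤ δ * b :=
      mul_le_of_le_one_right (by positivity) (by nlinarith [sq_nonneg y])
    have : 0 < ν * (1 - y ^ 2) * (-(b * (δ / ν)) - deriv E y) := by
      rw [e7]; linarith
    exact pos_of_mul_pos_right this (by positivity)

lemma linear_ode_bound {E κ g : ℝ → ℝ} {p q ν δ k B : ℝ} (hν : 0 < ν) (hδ : 0 < δ) (hk : 0 < k)
    (hB : 0 ≤ B) (hp : -1 ≤ p) (hq : q < 1) (hE : ∀ x ∈ Icc p q, DifferentiableAt ℝ E x)
    (he : ∀ x ∈ Icc p q, ν * (1 - x ^ 2) * deriv E x + κ x * E x = g x)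
    (hκ : ∀ x ∈ Icc p q, δ ≤ κ x) (hg : ∀ x ∈ Icc p q, |g x| < k * ν) (hEp : |E p| ≤ B) :
    ∀ x ∈ Icc p q, |E x| ≤ k * ν / δ + B * Real.exp (-(δ / ν * (x - p))) := by
  intro x hx
  have h1 := linear_ode_upper hν hδ hk hB hp hq hE he hκ hg (le_of_abs_le hEp) x hx
  have h2 := linear_ode_upper (E := fun x => -E x) (g := fun x => -g x) hν hδ hk hB hp hq
    (fun x hx => (hE x hx).neg)
    (fun x hx => by rw [deriv.fun_neg]; linear_combination -(he x hx)) hκ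
    (fun x hx => by rw [abs_neg]; exact hg x hx) (neg_le_of_abs_le hEp |> fun h => by linarith) x hx
  rw [abs_le]
  constructor <;> linarith

/-! ### Derivative estimates for the upper solution -/

/-- The inviscid profile `√(2 P)`. -/
def outerSol (z : ℝ × ℝ × ℝ × ℝ) (x : ℝ) : ℝ := √(2 * P z.2 x)

/-- The difference between the upper solution and the inviscid profile. -/
def remainder (z : ℝ × ℝ × ℝ × ℝ) (x : ℝ) : ℝ := maxSol z.1 z.2 x - outerSol z x

/-- The viscous terms of the equation, evaluated at the inviscid profile and divided by `ν`. -/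
def outerForcing (z : ℝ × ℝ × ℝ × ℝ) (x : ℝ) : ℝ :=
  (1 - x ^ 2) * deriv (outerSol z) x + 2 * x * outerSol z x

/-- The right-hand sides of the linear equations satisfied by the derivatives of the remainder. -/
def derivForcing : ℕ → ℝ × ℝ × ℝ × ℝ → ℝ → ℝ
  | 0, z, x => -(z.1 * deriv (outerForcing z) x) -
      (deriv (outerSol z) x + 2 * z.1) * remainder z x
  | n + 1, z, x => deriv (derivForcing n z) x -
      (deriv (outerSol z) x + deriv (remainder z) x - 2 * n * z.1) *
        iteratedDeriv (n + 1) (remainder z) x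

/-- Along the vanishing viscosity limit, `P` and the upper solution are bounded below on `K`. -/
def Nondegenerate (c : ℝ × ℝ × ℝ) (K : Set ℝ) : Prop :=
  K ⊆ Ico (-1) 1 ∧ ∃ δ : ℝ, 0 < δ ∧ ∀ᶠ z in vanFilter c (J 0), ∀ x ∈ K,
    δ ≤ P z.2 x ∧ δ ≤ maxSol z.1 z.2 x

section
variable {c : ℝ × ℝ × ℝ} {K K' : Set ℝ} {n m : ℕ}

lemma Nondegenerate.mono (h : Nondegenerate c K) (hK : K' ⊆ K) : Nondegenerate c K' := by
  obtain ⟨h1, δ, hδ, h2⟩ := h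
  exact ⟨hK.trans h1, δ, hδ, h2.mono fun z hz x hx => hz x (hK hx)⟩

lemma Nondegenerate.subset_Icc (h : Nondegenerate c K) : K ⊆ Icc (-1) 1 :=
  h.1.trans Ico_subset_Icc_self

lemma analyticAt_P (c : ℝ × ℝ × ℝ) (x : ℝ) : AnalyticAt ℝ (P c) x := by
  unfold P; fun_prop

lemma Nondegenerate.eventually_pos (h : Nondegenerate c K) :
    ∀ᶠ z in vanFilter c (J 0), ∀ x ∈ K, ∀ᶠ y in 𝓝 x, 0 < P z.2 y := by
  obtain ⟨-, δ, hδ, h2⟩ := h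
  filter_upwards [h2] with z hz x hx
  exact (analyticAt_P z.2 x).continuousAt.eventually (lt_mem_nhds (hδ.trans_le (hz x hx).1))

lemma hasDerivAt_outerSol {z : ℝ × ℝ × ℝ × ℝ} {x : ℝ} (h : 0 < P z.2 x) :
    HasDerivAt (outerSol z) ((-z.2.1 + z.2.2.1 - 2 * z.2.2.2 * x) * (outerSol z x)⁻¹) x := by
  have h1 := ((hasDerivAt_P z.2 x).const_mul 2).sqrt (by positivity)
  refine h1.congr_deriv ?_
  rw [outerSol, mul_div_mul_left _ _ (by norm_num), div_eq_mul_inv]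

lemma analyticAt_outerSol {z : ℝ × ℝ × ℝ × ℝ} {x : ℝ} (h : 0 < P z.2 x) :
    AnalyticAt ℝ (outerSol z) x := by
  have h1 : AnalyticAt ℝ (fun x => 2 * P z.2 x) x := analyticAt_const.mul (analyticAt_P z.2 x)
  have h2 : ContDiffAt ℝ ⊤ (fun x => √(2 * P z.2 x)) x :=
    h1.contDiffAt.sqrt (by positivity)
  exact h2.analyticAt

lemma Nondegenerate.analO_outerSol (h : Nondegenerate c K) :
    AnalO (vanFilter c (J 0)) K outerSol := by
  filter_upwards [h.eventually_pos] with z hz x hx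
  exact analyticAt_outerSol (hz x hx).self_of_nhds

lemma cmO_deriv_P (hK : K ⊆ Icc (-1) 1) : CmO (vanFilter c (J 0)) K n
    (fun z x => -z.2.1 + z.2.2.1 - 2 * z.2.2.2 * x) 1 := by
  have h : ∀ᶠ z in vanFilter c (J 0), (0 : ℝ) ≤ (1 : ℝ × ℝ × ℝ × ℝ → ℝ) z := by simp
  refine CmO.sub (.add (.neg (.const ⟨‖c‖ + 1, ?_⟩ h)) (.const ⟨‖c‖ + 1, ?_⟩ h))
    (.one_mul (.const_mul 2 (.const ⟨‖c‖ + 1, ?_⟩ h)) (.id hK))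
  all_goals
    filter_upwards [eventually_vanFilter_bdd] with z hz
    simp only [Pi.one_apply, mul_one]
  exacts [hz.1, hz.2.1, hz.2.2]

lemma cmO_P (hK : K ⊆ Icc (-1) 1) :
    CmO (vanFilter c (J 0)) K n (fun z x => P z.2 x) 1 := by
  have h : ∀ᶠ z in vanFilter c (J 0), (0 : ℝ) ≤ (1 : ℝ × ℝ × ℝ × ℝ → ℝ) z := by simp
  have h1 : CmO (vanFilter c (J 0)) K n (fun z x => P z.2 x)  1 := by
    simp only [P, sq]
    refine .add (.add (.one_mul (.const ⟨‖c‖ + 1, ?_⟩ h) (.sub (.const_one 1) (.id hK)))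
      (.one_mul (.const ⟨‖c‖ + 1, ?_⟩ h) (.add (.const_one 1) (.id hK))))
      (.one_mul (.const ⟨‖c‖ + 1, ?_⟩ h) (.sub (.const_one 1) (.one_mul (.id hK) (.id hK))))
    all_goals
      filter_upwards [eventually_vanFilter_bdd] with z hz
      simp only [Pi.one_apply, mul_one]
    exacts [hz.1, hz.2.1, hz.2.2]
  exact h1

/-- Induction closes on $1/Y$, where $Y=\sqrt{2P}$: its derivative is $-P'(1/Y)^3$. Then
$Y=2P\cdot(1/Y)$ inherits the bounds. -/
lemma Nondegenerate.cmO_outerSol_inv (h : Nondegenerate c K) :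
    CmO (vanFilter c (J 0)) K n (fun z x => (outerSol z x)⁻¹) 1 := by
  have ha : AnalO (vanFilter c (J 0)) K (fun z x => (outerSol z x)⁻¹) := by
    filter_upwards [h.analO_outerSol, h.eventually_pos] with z h1 h2 x hx
    refine (h1 x hx).fun_inv ?_
    have := (h2 x hx).self_of_nhds
    exact (Real.sqrt_pos.2 (by positivity)).ne'
  have hs : SupO (vanFilter c (J 0)) K (fun z x => (outerSol z x)⁻¹) 1 := by
    obtain ⟨-, δ, hδ, h2⟩ := h
    refine ⟨(√(2 * δ))⁻¹, ?_⟩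
    filter_upwards [h2] with z hz x hx
    rw [outerSol, abs_of_nonneg (inv_nonneg.2 (Real.sqrt_nonneg _)), Pi.one_apply, mul_one]
    have := (hz x hx).1
    gcongr
  induction n with
  | zero => exact .of_supO ha hs
  | succ n ih =>
    refine .of_deriv ha hs ?_
    have h3 := (cmO_deriv_P (c := c) (n := n) h.subset_Icc).one_mul (ih.one_mul (ih.one_mul ih))
    refine h3.neg.congr ?_
    filter_upwards [h.eventually_pos] with z hz x hx
    filter_upwards [hz x hx] with y hy
    have hy0 : outerSol z y ≠ 0 := (Real.sqrt_pos.2 (by positivity)).ne'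
    have := ((hasDerivAt_outerSol hy).inv hy0).deriv
    change _ = deriv (outerSol z)⁻¹ y
    rw [this]
    field_simp

lemma Nondegenerate.cmO_outerSol (h : Nondegenerate c K) :
    CmO (vanFilter c (J 0)) K n outerSol 1 := by
  have h1 := ((cmO_P (c := c) (n := n) h.subset_Icc).const_mul 2).one_mul h.cmO_outerSol_inv
  refine h1.congr ?_
  filter_upwards [h.eventually_pos] with z hz x hx
  filter_upwards [hz x hx] with y hy
  have hy0 : 0 < outerSol z y := Real.sqrt_pos.2 (by positivity)
  have hsq : outerSol z y ^ 2 = 2 * P z.2 y := Real.sq_sqrt (by positivity)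
  rw [← hsq]
  field_simp

lemma Nondegenerate.cmO_outerForcing (h : Nondegenerate c K) :
    CmO (vanFilter c (J 0)) K n outerForcing 1 := by
  have hid := CmO.id (l := vanFilter c (J 0)) (n := n) h.subset_Icc
  have h1 : CmO (vanFilter c (J 0)) K n (fun z => deriv (outerSol z)) 1 := h.cmO_outerSol.deriv
  have h2 := (((CmO.const_one 1).sub (hid.one_mul hid)).one_mul h1).add
    ((hid.const_mul 2).one_mul h.cmO_outerSol)
  have e : outerForcing = fun z x => (1 - x * x) * deriv (outerSol z) x + 2 * x * outerSol z x := by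
    funext z x
    rw [outerForcing, sq]
  rw [e]
  exact h2

lemma eventually_fst_nonneg : ∀ᶠ z in vanFilter c (J 0), 0 ≤ z.1 :=
  eventually_vanFilter_pos.mono fun _ h => h.le

lemma cmO_fst : CmO (vanFilter c (J 0)) K n (fun z _ => z.1) Prod.fst :=
  .const ⟨1, eventually_fst_nonneg.mono fun z hz => by rw [abs_of_nonneg hz, one_mul]⟩
    eventually_fst_nonneg

lemma CmO.to_one {f : ℝ × ℝ × ℝ × ℝ → ℝ → ℝ} (h : CmO (vanFilter c (J 0)) K n f Prod.fst) :
    CmO (vanFilter c (J 0)) K n f 1 := by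
  refine h.rate_mono ?_
  filter_upwards [eventually_fst_nonneg, eventually_vanFilter_le one_pos] with z h1 h2
  exact ⟨h1, h2⟩

lemma Nondegenerate.analO_remainder (h : Nondegenerate c K) :
    AnalO (vanFilter c (J 0)) K remainder := by
  filter_upwards [h.analO_outerSol, eventually_vanFilter_mem, eventually_vanFilter_pos]
    with z h1 h2 h3 x hx
  exact (analyticAt_maxSol h3 h2.1 (h.1 hx)).fun_sub (h1 x hx)

/-- The equation for the remainder. -/
lemma Nondegenerate.remainder_ode (h : Nondegenerate c K) :
    EqNear (vanFilter c (J 0)) K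
      (fun z x => z.1 * (1 - x ^ 2) * deriv (remainder z) x +
        (outerSol z x + 1 / 2 * remainder z x + 2 * z.1 * x) * remainder z x)
      (fun z x => -(z.1 * outerForcing z x)) := by
  filter_upwards [h.eventually_pos, eventually_vanFilter_mem, eventually_vanFilter_pos]
    with z h1 h2 h3 x hx
  filter_upwards [h1 x hx, maxSol_ode h3 h2.1 (h.1 hx),
    (analyticAt_maxSol h3 h2.1 (h.1 hx)).eventually_analyticAt] with y e1 e2 e3
  have hsq : outerSol z y ^ 2 = 2 * P z.2 y := Real.sq_sqrt (by positivity)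
  have hd : deriv (remainder z) y = deriv (maxSol z.1 z.2) y - deriv (outerSol z) y :=
    (e3.differentiableAt.hasDerivAt.sub (analyticAt_outerSol e1).differentiableAt.hasDerivAt).deriv
  rw [hd, outerForcing, remainder]
  linear_combination e2 - 1 / 2 * hsq

/-- The equations for the derivatives of the remainder. -/
lemma Nondegenerate.derivForcing_eq (h : Nondegenerate c K) (n : ℕ) :
    AnalO (vanFilter c (J 0)) K (derivForcing n) ∧
    EqNear (vanFilter c (J 0)) K
      (fun z x => z.1 * (1 - x ^ 2) * iteratedDeriv (n + 2) (remainder z) x +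
        (outerSol z x + remainder z x - 2 * n * z.1 * x) * iteratedDeriv (n + 1) (remainder z) x)
      (derivForcing n) := by
  have hY := h.analO_outerSol
  have hV := h.analO_remainder
  have hH : AnalO (vanFilter c (J 0)) K outerForcing := (h.cmO_outerForcing (n := 0)).1
  induction n with
  | zero =>
    refine ⟨?_, ?_⟩
    · filter_upwards [hY.deriv, hV, hH.deriv] with z h1 h2 h3 x hx
      exact (analyticAt_const.fun_mul (h3 x hx)).fun_neg.fun_sub
        (((h1 x hx).fun_add analyticAt_const).fun_mul (h2 x hx))
    · filter_upwards [hY, hV, hH, h.remainder_ode.deriv] with z h1 h2 h3 h4 x hx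
      filter_upwards [(h1 x hx).eventually_analyticAt, (h2 x hx).eventually_analyticAt,
        (h3 x hx).eventually_analyticAt, h4 x hx] with y e1 e2 e3 e4
      have d0 : HasDerivAt (fun x : ℝ => z.1 * (1 - x ^ 2)) (z.1 * (-(2 * y))) y := by
        simpa using (((hasDerivAt_id y).pow 2).const_sub 1).const_mul z.1
      have d1 := e1.differentiableAt.hasDerivAt
      have d2 := e2.differentiableAt.hasDerivAt
      have d2' := e2.deriv.differentiableAt.hasDerivAt
      have d5 : HasDerivAt (fun x : ℝ => 2 * z.1 * x) (2 * z.1) y := by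
        simpa using (hasDerivAt_id y).const_mul (2 * z.1)
      -- On differentiation the half of the quadratic term becomes a full $VV'$ and the two terms
      -- $\pm2\nu xV'$ cancel, so the damping coefficient is $Y+V$. Each further derivative
      -- subtracts $2\nu x$ from it.
      have l1 := ((d0.fun_mul d2').fun_add
        (((d1.fun_add (d2.const_mul (1 / 2))).fun_add d5).fun_mul d2)).deriv
      have l2 := ((e3.differentiableAt.hasDerivAt.const_mul z.1).fun_neg).deriv
      rw [l1, l2] at e4
      simp only [derivForcing, iteratedDeriv_succ, iteratedDeriv_zero, Nat.cast_zero]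
      linear_combination e4
  | succ n ih =>
    obtain ⟨ih1, ih2⟩ := ih
    refine ⟨?_, ?_⟩
    · filter_upwards [hY.deriv, hV.deriv, hV.iteratedDeriv (n + 1), ih1.deriv]
        with z h1 h2 h3 h4 x hx
      exact (h4 x hx).fun_sub ((((h1 x hx).fun_add (h2 x hx)).fun_sub analyticAt_const).fun_mul
        (h3 x hx))
    · filter_upwards [hY, hV, hV.iteratedDeriv (n + 1), hV.iteratedDeriv (n + 2), ih2.deriv]
        with z h1 h2 h3 h4 h5 x hx
      filter_upwards [(h1 x hx).eventually_analyticAt, (h2 x hx).eventually_analyticAt,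
        (h3 x hx).eventually_analyticAt, (h4 x hx).eventually_analyticAt, h5 x hx]
        with y e1 e2 e3 e4 e5
      have d0 : HasDerivAt (fun x : ℝ => z.1 * (1 - x ^ 2)) (z.1 * (-(2 * y))) y := by
        simpa using (((hasDerivAt_id y).pow 2).const_sub 1).const_mul z.1
      have d1 := e1.differentiableAt.hasDerivAt
      have d2 := e2.differentiableAt.hasDerivAt
      have d3 := e3.differentiableAt.hasDerivAt
      have d4 := e4.differentiableAt.hasDerivAt
      have d5 : HasDerivAt (fun x : ℝ => 2 * n * z.1 * x) (2 * n * z.1) y := by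
        simpa using (hasDerivAt_id y).const_mul (2 * n * z.1)
      have l1 := ((d0.fun_mul d4).fun_add
        (((d1.fun_add d2).fun_sub d5).fun_mul d3)).deriv
      rw [l1, ← iteratedDeriv_succ, ← iteratedDeriv_succ] at e5
      simp only [derivForcing]
      push_cast
      rw [← e5]
      ring

/-- The `n`-th forcing involves derivatives of the remainder only up to order `n`. Every term has
one factor $O(\nu)$, the others being bounded, so bounds of order `m` control $m-n$ of its
derivatives. -/
lemma Nondegenerate.cmO_derivForcing (h : Nondegenerate c K)
    (hV : CmO (vanFilter c (J 0)) K m remainder Prod.fst) (k : ℕ) (hk : n + k ≤ m) :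
    CmO (vanFilter c (J 0)) K k (derivForcing n) Prod.fst := by
  have hY : ∀ k, CmO (vanFilter c (J 0)) K k (fun z => deriv (outerSol z)) 1 :=
    fun k => h.cmO_outerSol.deriv
  induction n generalizing k with
  | zero =>
    exact (cmO_fst.mul_one h.cmO_outerForcing.deriv).neg.sub
      (((hY k).add (cmO_fst.to_one.const_mul 2)).one_mul (hV.of_le (by omega)))
  | succ n ih =>
    have h1 := (ih (k + 1) (by omega)).deriv
    have h2 : CmO (vanFilter c (J 0)) K k (fun z => deriv (remainder z)) 1 :=
      (hV.of_le (by omega : k + 1 ≤ m)).deriv.to_one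
    have h3 : CmO (vanFilter c (J 0)) K k (fun z => iteratedDeriv (n + 1) (remainder z))
      Prod.fst := (hV.of_le (by omega : k + (n + 1) ≤ m)).iteratedDeriv (n + 1)
    exact h1.sub ((((hY k).add h2).sub (cmO_fst.to_one.const_mul (2 * n))).one_mul h3)

end

/-! ### Propagation of $O(\nu)$ bounds along the linear equations. -/

section
variable {c : ℝ × ℝ × ℝ} {K : Set ℝ} {p p' q δ : ℝ} {n m : ℕ}
  {E κ g : ℝ × ℝ × ℝ × ℝ → ℝ → ℝ}

/-- At $-1$ the factor $1-x^2$ vanishes and the equation becomes $\kappa E=g$, so the initial value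
is already $O(\nu)$. -/
lemma supO_of_linear_left (hδ : 0 < δ) (hq : q < 1)
    (hE : AnalO (vanFilter c (J 0)) (Icc (-1) q) E)
    (he : ∀ᶠ z in vanFilter c (J 0), ∀ x ∈ Icc (-1) q,
      z.1 * (1 - x ^ 2) * deriv (E z) x + κ z x * E z x = g z x)
    (hκ : ∀ᶠ z in vanFilter c (J 0), ∀ x ∈ Icc (-1) q, δ ≤ κ z x)
    (hg : SupO (vanFilter c (J 0)) (Icc (-1) q) g Prod.fst) :
    SupO (vanFilter c (J 0)) (Icc (-1) q) E Prod.fst := by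
  obtain ⟨k, hk, hgk⟩ := hg.exists_pos eventually_vanFilter_pos
  refine ⟨2 * k / δ, ?_⟩
  filter_upwards [hE, he, hκ, hgk, eventually_vanFilter_pos] with z h1 h2 h3 h4 hν x hx
  have hI : (-1 : ℝ) ∈ Icc (-1) q := ⟨le_rfl, hx.1.trans hx.2⟩
  have hB : |E z (-1)| ≤ k * z.1 / δ := by
    have e1 := h2 _ hI
    have e2 := h4 _ hI
    have e3 := h3 _ hI
    have e4 : κ z (-1) * E z (-1) = g z (-1) := by linear_combination e1
    rw [← e4, abs_mul, abs_of_pos (hδ.trans_le e3)] at e2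
    rw [le_div_iff₀ hδ]
    have := mul_le_mul_of_nonneg_right e3 (abs_nonneg (E z (-1)))
    linarith
  have := linear_ode_bound hν hδ hk (by positivity) le_rfl hq
    (fun x hx => (h1 x hx).differentiableAt) h2 h3 h4 hB x hx
  refine this.trans ?_
  have hexp : Real.exp (-(δ / z.1 * (x - -1))) ≤ 1 := by
    rw [Real.exp_le_one_iff, neg_nonpos]
    exact mul_nonneg (by positivity) (by linarith [hx.1])
  have : k * z.1 / δ * Real.exp (-(δ / z.1 * (x - -1))) ≤ k * z.1 / δ :=
    mul_le_of_le_one_right (by positivity) hexp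
  calc _ ≤ k * z.1 / δ + k * z.1 / δ := by linarith
    _ = _ := by ring

/-- Data at `p` are only bounded, but after the fixed distance $p'-p$ the exponential is at most
$\nu/(\delta(p'-p))$, by $e^{-y}\le1/y$. -/
lemma supO_of_linear_right (hδ : 0 < δ) (hp : -1 ≤ p) (hpp : p < p') (hq : q < 1)
    (hE : AnalO (vanFilter c (J 0)) (Icc p q) E)
    (he : ∀ᶠ z in vanFilter c (J 0), ∀ x ∈ Icc p q,
      z.1 * (1 - x ^ 2) * deriv (E z) x + κ z x * E z x = g z x)
    (hκ : ∀ᶠ z in vanFilter c (J 0), ∀ x ∈ Icc p q, δ ≤ κ z x)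
    (hg : SupO (vanFilter c (J 0)) (Icc p q) g Prod.fst)
    (hE1 : SupO (vanFilter c (J 0)) (Icc p q) E 1) :
    SupO (vanFilter c (J 0)) (Icc p' q) E Prod.fst := by
  obtain ⟨k, hk, hgk⟩ := hg.exists_pos eventually_vanFilter_pos
  obtain ⟨B, hB, hEB⟩ := hE1.exists_pos (by simp)
  have hpp' : 0 < p' - p := sub_pos.2 hpp
  refine ⟨k / δ + B / (δ * (p' - p)), ?_⟩
  filter_upwards [hE, he, hκ, hgk, hEB, eventually_vanFilter_pos] with z h1 h2 h3 h4 h5 hν x hx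
  have hpx : p < x := hpp.trans_le hx.1
  have hI : p ∈ Icc p q := ⟨le_rfl, hpx.le.trans hx.2⟩
  have := linear_ode_bound hν hδ hk hB.le hp hq
    (fun x hx => (h1 x hx).differentiableAt) h2 h3 h4 (by simpa using (h5 p hI).le) x
    ⟨hpx.le, hx.2⟩
  refine this.trans ?_
  have hy : 0 < δ / z.1 * (p' - p) := by positivity
  have hexp : Real.exp (-(δ / z.1 * (x - p))) ≤ z.1 / (δ * (p' - p)) := by
    calc Real.exp (-(δ / z.1 * (x - p))) ≤ Real.exp (-(δ / z.1 * (p' - p))) := by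
          gcongr; exact hx.1
      _ ≤ (δ / z.1 * (p' - p))⁻¹ := by
          rw [Real.exp_neg]
          gcongr
          linarith [Real.add_one_le_exp (δ / z.1 * (p' - p))]
      _ = z.1 / (δ * (p' - p)) := by field_simp
  calc _ ≤ k * z.1 / δ + B * (z.1 / (δ * (p' - p))) := by gcongr
    _ = _ := by ring

/-- Once $E=O(\nu)$, every other term of the equation is $O(\nu)$. Dividing by $\nu(1-x^2)$ bounds
$E'$, which supplies the initial data for the next order. -/
lemma supO_deriv_of_linear (hp : -1 < p) (hq : q < 1)
    (he : ∀ᶠ z in vanFilter c (J 0), ∀ x ∈ Icc p q,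
      z.1 * (1 - x ^ 2) * deriv (E z) x + κ z x * E z x = g z x)
    (hκ : SupO (vanFilter c (J 0)) (Icc p q) κ 1)
    (hg : SupO (vanFilter c (J 0)) (Icc p q) g Prod.fst)
    (hE : SupO (vanFilter c (J 0)) (Icc p q) E Prod.fst) :
    SupO (vanFilter c (J 0)) (Icc p q) (fun z => deriv (E z)) 1 := by
  obtain ⟨a, ha, hga⟩ := hg.exists_pos eventually_vanFilter_pos
  obtain ⟨b, hb, hκb⟩ := hκ.exists_pos (by simp)
  obtain ⟨d, hd, hEd⟩ := hE.exists_pos eventually_vanFilter_pos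
  have hp1 : 0 < 1 + p := by linarith
  have hq1 : 0 < 1 - q := by linarith
  refine ⟨(a + b * d) / ((1 - q) * (1 + p)), ?_⟩
  filter_upwards [he, hga, hκb, hEd, eventually_vanFilter_pos] with z h1 h2 h3 h4 hν x hx
  have e1 : (1 - q) * (1 + p) ≤ 1 - x ^ 2 := by
    rw [show 1 - x ^ 2 = (1 - x) * (1 + x) by ring]
    exact mul_le_mul (by linarith [hx.2]) (by linarith [hx.1]) hp1.le (by linarith [hx.2])
  have e0 : 0 < 1 - x ^ 2 := lt_of_lt_of_le (by positivity) e1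
  have h3' : |κ z x| ≤ b := by simpa using (h3 x hx).le
  rw [Pi.one_apply, mul_one, le_div_iff₀ (by positivity)]
  have e2 : z.1 * (1 - x ^ 2) * |deriv (E z) x| ≤ z.1 * (a + b * d) := by
    have : z.1 * (1 - x ^ 2) * deriv (E z) x = g z x - κ z x * E z x := by
      linear_combination h1 x hx
    calc z.1 * (1 - x ^ 2) * |deriv (E z) x| = |z.1 * (1 - x ^ 2) * deriv (E z) x| := by
          rw [abs_mul, abs_of_pos (mul_pos hν e0)]
      _ ≤ |g z x| + |κ z x| * |E z x| := by rw [this, ← abs_mul]; exact abs_sub _ _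
      _ ≤ a * z.1 + b * (d * z.1) := by
          gcongr
          · exact (h2 x hx).le
          · exact (h4 x hx).le
      _ = _ := by ring
  rw [mul_assoc] at e2
  have e3 := le_of_mul_le_mul_left e2 hν
  have e4 := mul_le_mul_of_nonneg_right e1 (abs_nonneg (deriv (E z) x))
  linarith

lemma Nondegenerate.supO_remainder (h : Nondegenerate c K) :
    SupO (vanFilter c (J 0)) K remainder 1 := by
  obtain ⟨L, hL, hbd⟩ := exists_maxSol_bound_of_mem_J_zero c
  refine ⟨4 + √(2 * L), ?_⟩
  filter_upwards [hbd, eventually_vanFilter_pos, eventually_vanFilter_le one_pos,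
    h.eventually_pos] with z h1 hν hν1 hP x hx
  obtain ⟨e1, e2⟩ := h1 x (h.1 hx)
  have p1 : z.1 ^ (2 / 3 : ℝ) ≤ 1 := Real.rpow_le_one hν.le hν1 (by norm_num)
  have := abs_sub_sqrt_le (hP x hx).self_of_nhds.le
    (e1.trans (mul_le_of_le_one_right hL.le p1)) (by positivity) e2
  rw [Pi.one_apply, mul_one, remainder, outerSol]
  linarith

/-- Up to $O(\nu)$ the coefficient is the mean of $\sqrt{2P}\ge0$ and $U\ge\delta$; in the
differentiated equations it is $U$ itself. -/
lemma Nondegenerate.coeff_zero_ge (h : Nondegenerate c K) : ∃ δ : ℝ, 0 < δ ∧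
    ∀ᶠ z in vanFilter c (J 0), ∀ x ∈ K,
      δ ≤ outerSol z x + 1 / 2 * remainder z x + 2 * z.1 * x := by
  obtain ⟨hK, δ, hδ, h2⟩ := h
  refine ⟨δ / 4, by positivity, ?_⟩
  filter_upwards [h2, eventually_vanFilter_pos,
    eventually_vanFilter_le (show 0 < δ / 8 by positivity)] with z h3 hν hν1 x hx
  have e1 := (h3 x hx).2
  have e2 : 0 ≤ outerSol z x := Real.sqrt_nonneg _
  rw [remainder]
  nlinarith [(hK hx).1]

lemma Nondegenerate.coeff_ge (h : Nondegenerate c K) (n : ℕ) : ∃ δ : ℝ, 0 < δ ∧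
    ∀ᶠ z in vanFilter c (J 0), ∀ x ∈ K,
      δ ≤ outerSol z x + remainder z x - 2 * n * z.1 * x := by
  obtain ⟨hK, δ, hδ, h2⟩ := h
  refine ⟨δ / 2, by positivity, ?_⟩
  filter_upwards [h2, eventually_vanFilter_pos,
    eventually_vanFilter_le (show 0 < δ / (4 * (n + 1)) by positivity)] with z h3 hν hν1 x hx
  have e1 := (h3 x hx).2
  rw [le_div_iff₀ (by positivity)] at hν1
  have e3 : (n : ℝ) * z.1 * x ≤ n * z.1 := mul_le_of_le_one_right (by positivity) (hK hx).2.le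
  rw [remainder]
  linarith

lemma Nondegenerate.supO_forcing (h : Nondegenerate c K) :
    SupO (vanFilter c (J 0)) K (fun z x => -(z.1 * outerForcing z x)) Prod.fst :=
  ((cmO_fst (n := 0)).mul_one h.cmO_outerForcing).neg.supO

/-- Derivative bounds up to the left end point. -/
lemma Nondegenerate.cmO_remainder_left (h : Nondegenerate c (Icc (-1) q)) (hq : q < 1) (m : ℕ) :
    CmO (vanFilter c (J 0)) (Icc (-1) q) m remainder Prod.fst := by
  induction m with
  | zero =>
    obtain ⟨δ, hδ, hκ⟩ := h.coeff_zero_ge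
    exact .of_supO h.analO_remainder
      (supO_of_linear_left hδ hq h.analO_remainder h.remainder_ode.eq hκ h.supO_forcing)
  | succ m ih =>
    obtain ⟨δ, hδ, hκ⟩ := h.coeff_ge m
    refine ih.succ (supO_of_linear_left hδ hq (h.analO_remainder.iteratedDeriv (m + 1)) ?_ hκ
      (h.cmO_derivForcing ih (n := m) 0 (by omega)).supO)
    simpa only [← iteratedDeriv_succ] using (h.derivForcing_eq m).2.eq

/-- Derivative bounds to the right of a point of the interval. -/
lemma Nondegenerate.cmO_remainder_right (h : Nondegenerate c (Icc p q)) (hp : -1 < p)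
    (hq : q < 1) (m : ℕ) (hpp : p < p') :
    CmO (vanFilter c (J 0)) (Icc p' q) m remainder Prod.fst := by
  induction m generalizing p' with
  | zero =>
    obtain ⟨δ, hδ, hκ⟩ := h.coeff_zero_ge
    exact .of_supO (h.analO_remainder.mono (Icc_subset_Icc_left hpp.le))
      (supO_of_linear_right hδ hp.le hpp hq h.analO_remainder h.remainder_ode.eq hκ
        h.supO_forcing h.supO_remainder)
  | succ m ih =>
    refine (ih hpp).succ ?_
    -- The interval shrinks at each order: bounds of order `m` on $[r,q]$ give a bounded derivative
    -- of order $m+1$ at `r`, and its decay over $[r,p']$ makes it $O(\nu)$.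
    obtain ⟨r, hr, hr'⟩ := exists_between hpp
    have hN := h.mono (Icc_subset_Icc_left (b := q) hr.le)
    have ih' := ih hr
    obtain ⟨δ, hδ, hκ⟩ := hN.coeff_ge m
    refine supO_of_linear_right hδ (hp.trans hr).le hr' hq
      (hN.analO_remainder.iteratedDeriv (m + 1)) ?_ hκ
      (hN.cmO_derivForcing ih' (n := m) 0 (by omega)).supO ?_
    · simpa only [← iteratedDeriv_succ] using (hN.derivForcing_eq m).2.eq
    · have hY := hN.cmO_outerSol (n := 0)
      have hV := (ih'.of_le (Nat.zero_le m)).to_one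
      have hν : CmO (vanFilter c (J 0)) (Icc r q) 0 (fun z x => z.1 * x) 1 :=
        cmO_fst.to_one.one_mul (.id hN.subset_Icc)
      -- The derivative of order one is bounded through the nonlinear equation of the remainder,
      -- those of higher order through the equation of the preceding derivative.
      cases m with
      | zero =>
        have := supO_deriv_of_linear (hp.trans hr) hq hN.remainder_ode.eq
          (SupO.congr ((hY.add (hV.const_mul (1 / 2))).add (hν.const_mul 2)).supO
            (Eventually.of_forall fun z x _ => by ring)) hN.supO_forcing ih'.supO
        simpa [iteratedDeriv_succ] using this
      | succ n =>
        have := supO_deriv_of_linear (E := fun z => iteratedDeriv (n + 1) (remainder z))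
          (κ := fun z x => outerSol z x + remainder z x - 2 * n * z.1 * x) (g := derivForcing n)
          (hp.trans hr) hq (by simpa only [← iteratedDeriv_succ] using (hN.derivForcing_eq n).2.eq)
          (SupO.congr ((hY.add hV).sub (hν.const_mul (2 * n))).supO
            (Eventually.of_forall fun z x _ => by ring))
          (hN.cmO_derivForcing ih' (n := n) 0 (by omega)).supO (ih'.2 (n + 1) le_rfl)
        simpa only [← iteratedDeriv_succ] using this

end

/-! ### The double zero, the $C^m$ norms, and transfer to sequences. -/

section
variable {c : ℝ × ℝ × ℝ} {p q : ℝ} {x : ℝ}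

lemma abs_P_sub_P_le (c c' : ℝ × ℝ × ℝ) (hx : x ∈ Icc (-1 : ℝ) 1) :
    |P c' x - P c x| ≤ 5 * ‖c' - c‖ := by
  have e1 : P c' x - P c x = P (c' - c) x := by
    simp only [P, Prod.fst_sub, Prod.snd_sub]; ring
  rw [e1]
  exact abs_P_le (norm_fst_le (c' - c)) ((norm_fst_le _).trans (norm_snd_le (c' - c)))
    ((norm_snd_le _).trans (norm_snd_le (c' - c))) hx

/-- Compactness gives $P_c\ge d$, hence $P\ge d/2$ nearby. The sup estimate keeps $U^2$ away from
$0$, and $U\ge-2\nu$ excludes the negative root. -/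
lemma nondegenerate_of_pos (hp : -1 ≤ p) (hq : q < 1) (h : ∀ x ∈ Icc p q, 0 < P c x) :
    Nondegenerate c (Icc p q) := by
  have hsub : Icc p q ⊆ Ico (-1) 1 := fun x hx => ⟨hp.trans hx.1, hx.2.trans_lt hq⟩
  refine ⟨hsub, ?_⟩
  obtain ⟨d, hd, hdP⟩ : ∃ d, 0 < d ∧ ∀ x ∈ Icc p q, d ≤ P c x := by
    rcases (Icc p q).eq_empty_or_nonempty with he | hne
    · exact ⟨1, one_pos, by simp [he]⟩
    · obtain ⟨x₀, hx₀, hmin⟩ := isCompact_Icc.exists_isMinOn hne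
        (fun x _ => (analyticAt_P c x).continuousAt.continuousWithinAt)
      exact ⟨_, h x₀ hx₀, fun x hx => hmin hx⟩
  obtain ⟨L, hL, hbd⟩ := exists_maxSol_bound_of_mem_J_zero c
  have t1 : Tendsto (fun z : ℝ × ℝ × ℝ × ℝ => 5 * ‖z.2 - c‖) (vanFilter c (J 0)) (𝓝 0) := by
    simpa using ((tendsto_snd_vanFilter (c := c) (A := J 0)).sub_const c).norm.const_mul 5
  have t2 : Tendsto (fun z : ℝ × ℝ × ℝ × ℝ => L * z.1 ^ (2 / 3 : ℝ)) (vanFilter c (J 0))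
      (𝓝 0) := by
    have := ((Real.continuousAt_rpow_const 0 (2 / 3) (Or.inr (by norm_num))).tendsto.comp
      (tendsto_fst_vanFilter' (c := c) (A := J 0))).const_mul L
    simpa [Function.comp_def] using this
  have hs : 0 < √(d / 2) := Real.sqrt_pos.2 (by positivity)
  refine ⟨min (d / 2) (√(d / 2)), lt_min (by positivity) hs, ?_⟩
  filter_upwards [hbd, t1.eventually (Iic_mem_nhds (half_pos hd)),
    t2.eventually (Iic_mem_nhds (show 0 < d / 4 by positivity)), eventually_vanFilter_pos,
    eventually_vanFilter_le (show 0 < √(d / 2) / 4 by positivity)] with z h1 h2 h3 hν hν1 x hx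
  have e1 := (abs_le.1 (abs_P_sub_P_le c z.2 (Ico_subset_Icc_self (hsub hx)))).1
  have e2 := hdP x hx
  obtain ⟨e3, e4⟩ := h1 x (hsub hx)
  have e5 := (abs_le.1 e3).1
  have h2' : 5 * ‖z.2 - c‖ ≤ d / 2 := h2
  have h3' : L * z.1 ^ (2 / 3 : ℝ) ≤ d / 4 := h3
  have hP : d / 2 ≤ P z.2 x := by linarith
  refine ⟨(min_le_left _ _).trans hP, (min_le_right _ _).trans ?_⟩
  have hsq : √(d / 2) ^ 2 = d / 2 := Real.sq_sqrt (by positivity)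
  by_contra! hlt
  have : maxSol z.1 z.2 x ^ 2 < √(d / 2) ^ 2 := sq_lt_sq' (by linarith) hlt
  linarith

lemma P_eq_of_eq_c3star (h1 : 0 ≤ c.1) (h2 : 0 ≤ c.2.1) (h3 : c.2.2 = c3star c.1 c.2.1) (x : ℝ) :
    P c x = 1 / 2 * (√c.1 * (1 - x) - √c.2.1 * (1 + x)) ^ 2 := by
  have e1 := Real.sq_sqrt h1
  have e2 := Real.sq_sqrt h2
  rw [P, h3, c3star, c3bar]
  simp only [ne_eq, OfNat.ofNat_ne_zero, not_false_eq_true, zero_pow, zero_add, mul_zero, add_zero]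
  linear_combination -(1 - x) * e1 - (1 + x) * e2

lemma sqrt_add_sqrt_pos (hc : c ≠ 0) (h1 : 0 ≤ c.1) (h2 : 0 ≤ c.2.1)
    (h3 : c.2.2 = c3star c.1 c.2.1) : 0 < √c.1 + √c.2.1 := by
  refine lt_of_le_of_ne (by positivity) fun h => hc ?_
  have e1 : c.1 = 0 := (Real.sqrt_eq_zero h1).1
    (by linarith [Real.sqrt_nonneg c.1, Real.sqrt_nonneg c.2.1])
  have e2 : c.2.1 = 0 := (Real.sqrt_eq_zero h2).1
    (by linarith [Real.sqrt_nonneg c.1, Real.sqrt_nonneg c.2.1])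
  have e3 : c.2.2 = 0 := by rw [h3, e1, e2, c3star, c3bar]; simp
  exact Prod.ext e1 (Prod.ext e2 e3)

lemma P_pos_of_ne_xbar (hc : c ≠ 0) (h1 : 0 ≤ c.1) (h2 : 0 ≤ c.2.1)
    (h3 : c.2.2 = c3star c.1 c.2.1) (hx : x ≠ xbar c) : 0 < P c x := by
  have hs := sqrt_add_sqrt_pos hc h1 h2 h3
  have : √c.1 * (1 - x) - √c.2.1 * (1 + x) = (√c.1 + √c.2.1) * (xbar c - x) := by
    rw [xbar]; field_simp; ring
  rw [P_eq_of_eq_c3star h1 h2 h3, this]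
  have := sub_ne_zero.2 hx.symm
  positivity

lemma xbar_mem (c : ℝ × ℝ × ℝ) : xbar c ∈ Icc (-1 : ℝ) 1 := by
  have h1 := Real.sqrt_nonneg c.1
  have h2 := Real.sqrt_nonneg c.2.1
  have h3 : |xbar c| ≤ 1 := by
    rw [xbar, abs_div, abs_of_nonneg (add_nonneg h1 h2)]
    refine div_le_one_of_le₀ ?_ (by positivity)
    rw [abs_le]
    constructor <;> linarith
  exact abs_le.1 h3

lemma xbar_reflect (c : ℝ × ℝ × ℝ) : xbar (reflect c) = -xbar c := by
  simp only [xbar, reflect]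
  rw [← neg_div, neg_sub, add_comm]

/-- The set is relatively open in a nondegenerate interval, or empty when $\varepsilon\ge2$.
Derivatives within it then agree with ordinary ones. -/
lemma uniqueDiffOn_outerSet (c : ℝ × ℝ × ℝ) (ε : ℝ) :
    UniqueDiffOn ℝ (Icc (-1) (1 - ε) \ Icc (xbar c - ε) (xbar c + ε)) := by
  rcases lt_or_ge (-1) (1 - ε) with h | h
  · exact (uniqueDiffOn_Icc h).inter isClosed_Icc.isOpen_compl
  · have := xbar_mem c
    convert uniqueDiffOn_empty
    refine sdiff_eq_empty.2 fun x hx => ⟨?_, ?_⟩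
    · linarith [hx.1, this.2]
    · linarith [hx.2, this.1]

/-- Bounds for the derivatives of the remainder away from the double zero and from `1`. -/
lemma exists_remainder_bound (hc : c ≠ 0) (h1 : 0 ≤ c.1) (h2 : 0 ≤ c.2.1)
    (h3 : c.2.2 = c3star c.1 c.2.1) {ε : ℝ} (hε : 0 < ε) (m : ℕ) :
    ∃ C : ℝ, 0 ≤ C ∧ ∀ᶠ z in vanFilter c (J 0),
      ∀ x ∈ Icc (-1) (1 - ε) \ Icc (xbar c - ε) (xbar c + ε),
        AnalyticAt ℝ (remainder z) x ∧
          ∀ j ≤ m, |iteratedDeriv j (remainder z) x| ≤ C * z.1 := by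
  have hx := xbar_mem c
  have hl : CmO (vanFilter c (J 0)) (Icc (-1) (xbar c - ε)) m remainder Prod.fst :=
    (nondegenerate_of_pos le_rfl (by linarith [hx.2]) fun y hy =>
      P_pos_of_ne_xbar hc h1 h2 h3 (by linarith [hy.2] : y < xbar c).ne).cmO_remainder_left
        (by linarith [hx.2]) m
  -- Nondegeneracy is taken from $\bar x+\varepsilon/2$ on, leaving a layer of width $\varepsilon/2$
  -- for the exponential decay. Either interval may be empty when $\bar x$ is near an endpoint.
  have hr : CmO (vanFilter c (J 0)) (Icc (xbar c + ε) (1 - ε)) m remainder Prod.fst :=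
    (nondegenerate_of_pos (p := xbar c + ε / 2) (by linarith [hx.1]) (by linarith) fun y hy =>
      P_pos_of_ne_xbar hc h1 h2 h3 (by linarith [hy.1] : xbar c < y).ne').cmO_remainder_right
        (by linarith [hx.1]) (by linarith) m (by linarith)
  have key : ∀ K, CmO (vanFilter c (J 0)) K m remainder Prod.fst → ∃ C : ℝ, 0 ≤ C ∧
      ∀ᶠ z in vanFilter c (J 0), ∀ x ∈ K, AnalyticAt ℝ (remainder z) x ∧
        ∀ j ≤ m, |iteratedDeriv j (remainder z) x| ≤ C * z.1 := by
    intro K hK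
    choose! C hC using hK.2
    refine ⟨∑ j ∈ Finset.range (m + 1), |C j|, Finset.sum_nonneg fun _ _ => abs_nonneg _, ?_⟩
    have hall : ∀ᶠ z in vanFilter c (J 0), ∀ j ∈ Finset.range (m + 1), ∀ x ∈ K,
        |iteratedDeriv j (remainder z) x| ≤ C j * z.1 :=
      (Finset.range (m + 1)).eventually_all.2 fun j hj =>
        hC j (Nat.lt_succ_iff.1 (Finset.mem_range.1 hj))
    filter_upwards [hall, hK.1, eventually_fst_nonneg] with z hz1 hz2 hν x hx
    refine ⟨hz2 x hx, fun j hj => ?_⟩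
    have hj' : j ∈ Finset.range (m + 1) := Finset.mem_range.2 (Nat.lt_succ_iff.2 hj)
    refine (hz1 j hj' x hx).trans (mul_le_mul_of_nonneg_right ?_ hν)
    exact (le_abs_self _).trans
      (Finset.single_le_sum (f := fun j => |C j|) (fun _ _ => abs_nonneg _) hj')
  obtain ⟨C₁, hC₁, hb₁⟩ := key _ hl
  obtain ⟨C₂, hC₂, hb₂⟩ := key _ hr
  refine ⟨C₁ + C₂, by positivity, ?_⟩
  filter_upwards [hb₁, hb₂, eventually_fst_nonneg] with z hz1 hz2 hν x hx
  have i1 : C₁ * z.1 ≤ (C₁ + C₂) * z.1 := by gcongr; linarith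
  have i2 : C₂ * z.1 ≤ (C₁ + C₂) * z.1 := by gcongr; linarith
  by_cases hlt : x < xbar c - ε
  · obtain ⟨a, b⟩ := hz1 x ⟨hx.1.1, hlt.le⟩
    exact ⟨a, fun j hj => (b j hj).trans i1⟩
  · have : xbar c + ε < x := by
      by_contra! hle
      exact hx.2 ⟨not_lt.1 hlt, hle⟩
    obtain ⟨a, b⟩ := hz2 x ⟨this.le, hx.1.2⟩
    exact ⟨a, fun j hj => (b j hj).trans i2⟩

lemma cmNorm_le {f F : ℝ → ℝ} {S : Set ℝ} {m : ℕ} {B : ℝ} (hS : UniqueDiffOn ℝ S)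
    (hf : EqOn f F S) (hF : ∀ x ∈ S, AnalyticAt ℝ F x ∧ ∀ j ≤ m, |iteratedDeriv j F x| ≤ B) :
    cmNorm m f S ≤ ENNReal.ofReal ((m + 1) * B) := by
  have hcd : ContDiffOn ℝ m f S :=
    ContDiffOn.congr (fun x hx => (hF x hx).1.contDiffAt.contDiffWithinAt) hf
  rw [cmNorm, if_pos hcd]
  calc ∑ j ∈ Finset.range (m + 1), ⨆ x ∈ S, ‖iteratedDerivWithin j f S x‖ₑ
      ≤ ∑ j ∈ Finset.range (m + 1), ENNReal.ofReal B := by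
        refine Finset.sum_le_sum fun j hj => iSup₂_le fun x hx => ?_
        rw [iteratedDerivWithin_congr hf hx,
          iteratedDerivWithin_eq_iteratedDeriv hS (hF x hx).1.contDiffAt hx, ← ofReal_norm]
        exact ENNReal.ofReal_le_ofReal
          ((hF x hx).2 j (Nat.lt_succ_iff.1 (Finset.mem_range.1 hj)))
    _ = _ := by
        rw [Finset.sum_const, Finset.card_range, nsmul_eq_mul, ENNReal.ofReal_mul (by positivity),
          ENNReal.ofReal_add (by positivity) one_pos.le]
        simp

lemma cmNorm_upperSol_le {z : ℝ × ℝ × ℝ × ℝ} (hν : 0 < z.1) (hz : z.2 ∈ J z.1) {ε B : ℝ}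
    (hε : 0 < ε) {m : ℕ}
    (h : ∀ x ∈ Icc (-1) (1 - ε) \ Icc (xbar c - ε) (xbar c + ε), AnalyticAt ℝ (remainder z) x ∧
      ∀ j ≤ m, |iteratedDeriv j (remainder z) x| ≤ B) :
    cmNorm m (fun x => upperSol z.1 z.2 x - √(2 * P z.2 x))
      (Icc (-1) (1 - ε) \ Icc (xbar c - ε) (xbar c + ε)) ≤ ENNReal.ofReal ((m + 1) * B) := by
  refine cmNorm_le (uniqueDiffOn_outerSet c ε) (fun x hx => ?_) h
  simp only [remainder, outerSol]
  rw [upperSol_eq hν hz ⟨hx.1.1, by linarith [hx.1.2]⟩]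

lemma cmNorm_lowerSol_le {z : ℝ × ℝ × ℝ × ℝ} (hν : 0 < z.1) (hz : z.2 ∈ J z.1) {ε B : ℝ}
    (hε : 0 < ε) {m : ℕ}
    (h : ∀ x ∈ Icc (-1) (1 - ε) \ Icc (xbar (reflect c) - ε) (xbar (reflect c) + ε),
      AnalyticAt ℝ (remainder (z.1, reflect z.2)) x ∧
      ∀ j ≤ m, |iteratedDeriv j (remainder (z.1, reflect z.2)) x| ≤ B) :
    cmNorm m (fun x => lowerSol z.1 z.2 x + √(2 * P z.2 x))
      (Icc (-1 + ε) 1 \ Icc (xbar c - ε) (xbar c + ε)) ≤ ENNReal.ofReal ((m + 1) * B) := by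
  have hset : Icc (-1 + ε) 1 \ Icc (xbar c - ε) (xbar c + ε) =
      -(Icc (-1) (1 - ε) \ Icc (xbar (reflect c) - ε) (xbar (reflect c) + ε)) := by
    ext x
    rw [xbar_reflect]
    simp only [Set.mem_sdiff, mem_Icc, Set.mem_neg]
    constructor
    · rintro ⟨⟨a, b⟩, h⟩
      exact ⟨⟨by linarith, by linarith⟩, fun ⟨a, b⟩ => h ⟨by linarith, by linarith⟩⟩
    · rintro ⟨⟨a, b⟩, h⟩
      exact ⟨⟨by linarith, by linarith⟩, fun ⟨a, b⟩ => h ⟨by linarith, by linarith⟩⟩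
  rw [hset]
  refine cmNorm_le (F := fun x => -remainder (z.1, reflect z.2) (-x)) ?_ (fun x hx => ?_)
    fun x hx => ?_
  · rw [← hset]
    rcases lt_or_ge (-1 + ε) 1 with h | h
    · exact (uniqueDiffOn_Icc h).inter isClosed_Icc.isOpen_compl
    · have := xbar_mem c
      convert uniqueDiffOn_empty
      refine sdiff_eq_empty.2 fun x hx => ⟨?_, ?_⟩
      · linarith [hx.1, this.2]
      · linarith [hx.2, this.1]
  · rw [← hset] at hx
    simp only [remainder, outerSol, P_reflect, neg_neg]
    rw [lowerSol_eq hν hz ⟨by linarith [hx.1.1], hx.1.2⟩]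
    ring
  · obtain ⟨a, b⟩ := h (-x) hx
    refine ⟨(a.fun_comp analyticAt_id.neg).neg, fun j hj => ?_⟩
    rw [iteratedDeriv_fun_neg, iteratedDeriv_comp_neg j (remainder (z.1, reflect z.2)) x, abs_neg,
      smul_eq_mul, abs_mul, abs_pow, abs_neg, abs_one, one_pow, one_mul]
    exact b j hj

lemma tendsto_linfNorm_zero {f : ℕ → ℝ → ℝ}
    (h : ∀ δ : ℝ, 0 < δ → ∀ᶠ k in atTop, ∀ x ∈ Ioo (-1 : ℝ) 1, |f k x| ≤ δ) :
    Tendsto (fun k => linfNorm (f k)) atTop (𝓝 0) := by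
  rw [ENNReal.tendsto_nhds_zero]
  intro e he
  obtain ⟨r, hr0, hr⟩ := ENNReal.lt_iff_exists_nnreal_btwn.1 he
  filter_upwards [h r (by exact_mod_cast hr0)] with k hk
  refine (linfNorm_le hk).trans ?_
  rw [ENNReal.ofReal_coe_nnreal]
  exact hr.le

lemma IsVanishing.reflect {ν : ℕ → ℝ} {ck : ℕ → ℝ × ℝ × ℝ} (h : IsVanishing c ν ck) :
    IsVanishing (reflect c) ν fun k => AxisymNS.reflect (ck k) :=
  ⟨h.pos, h.tendsto_zero, fun k => reflect_mem_J (h.mem k),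
    (continuous_reflect.tendsto c).comp h.tendsto⟩

/-- Passage to the limit in $c_{k1},c_{k2}\ge-\nu_k^2$. -/
lemma IsVanishing.nonneg {ν : ℕ → ℝ} {ck : ℕ → ℝ × ℝ × ℝ} (h : IsVanishing c ν ck) :
    0 ≤ c.1 ∧ 0 ≤ c.2.1 := by
  have hν : Tendsto (fun k => -(ν k) ^ 2) atTop (𝓝 0) := by
    simpa using (h.tendsto_zero.pow 2).neg
  exact ⟨le_of_tendsto_of_tendsto' hν ((continuous_fst.tendsto c).comp h.tendsto)
      fun k => (h.mem k).1,
    le_of_tendsto_of_tendsto' hν (((continuous_fst.comp continuous_snd).tendsto c).comp h.tendsto)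
      fun k => (h.mem k).2.1⟩

lemma c3star_reflect (h : c.2.2 = c3star c.1 c.2.1) :
    (reflect c).2.2 = c3star (reflect c).1 (reflect c).2.1 := by
  simp only [reflect, h, c3star, c3bar]; ring

end

/-! ### Uniform convergence to the inviscid profile. -/

section
variable {c : ℝ × ℝ × ℝ} {ν : ℝ} {x : ℝ}

lemma upperSol_eq_of_mem_Ioo (hν : 0 < ν) (hc : c ∈ J ν) (hx : x ∈ Ioo (-1 : ℝ) 1) :
    upperSol ν c x = maxSol ν c x := upperSol_eq hν hc (Ioo_subset_Ico_self hx)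

lemma lowerSol_eq_of_mem_Ioo (hν : 0 < ν) (hc : c ∈ J ν) (hx : x ∈ Ioo (-1 : ℝ) 1) :
    lowerSol ν c x = -maxSol ν (reflect c) (-x) := lowerSol_eq hν hc (Ioo_subset_Ioc_self hx)

lemma neg_mem_Ioo {a b : ℝ} (h : x ∈ Ioo (-a) b) : -x ∈ Ioo (-b) a :=
  ⟨by linarith [h.2], by linarith [h.1]⟩

lemma neg_mem_Ioo_one (h : x ∈ Ioo (-1 : ℝ) 1) : -x ∈ Ioo (-1 : ℝ) 1 := neg_mem_Ioo h

lemma P_nonneg_of_eq_c3star (h1 : 0 ≤ c.1) (h2 : 0 ≤ c.2.1) (h3 : c.2.2 = c3star c.1 c.2.1) :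
    0 ≤ P c x := by
  rw [P_eq_of_eq_c3star h1 h2 h3]; positivity

/-- Uniform convergence of the upper solutions for parameters in `J 0`. -/
lemma eventually_maxSol_close (h1 : 0 ≤ c.1) (h2 : 0 ≤ c.2.1) (h3 : c.2.2 = c3star c.1 c.2.1)
    {δ : ℝ} (hδ : 0 < δ) : ∀ᶠ z in vanFilter c (J 0), ∀ x ∈ Ico (-1 : ℝ) 1,
      |maxSol z.1 z.2 x - √(2 * P c x)| ≤ δ := by
  obtain ⟨L, hL, hbd⟩ := exists_maxSol_bound_of_mem_J_zero c
  have hν := tendsto_fst_vanFilter' (c := c) (A := J 0)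
  have t2 : Tendsto (fun z : ℝ × ℝ × ℝ × ℝ => L * z.1 ^ (2 / 3 : ℝ)) (vanFilter c (J 0))
      (𝓝 0) := by
    have := ((Real.continuousAt_rpow_const 0 (2 / 3) (Or.inr (by norm_num))).tendsto.comp
      hν).const_mul L
    simpa [Function.comp_def] using this
  exact eventually_abs_maxSol_sub_sqrt_le t2 (by simpa using hν.const_mul 2)
    (eventually_fst_nonneg.mono fun z hz => by positivity) hbd
    (fun x _ => P_nonneg_of_eq_c3star h1 h2 h3) hδ

/-- Uniform convergence of the upper solutions when `c₂ = 0`. -/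
lemma eventually_maxSol_close' (h1 : 0 < c.1) (h2 : c.2.1 = 0) (h3 : c.2.2 = c3star c.1 c.2.1)
    (h3' : c.2.2 = -c.1 / 2) {δ : ℝ} (hδ : 0 < δ) :
    ∀ᶠ z in vanFilter c univ, ∀ x ∈ Ico (-1 : ℝ) 1,
      |maxSol z.1 z.2 x - √(2 * P c x)| ≤ δ := by
  obtain ⟨L, hL, hbd⟩ := exists_maxSol_bound_of_snd_eq_zero h1 h2 h3'
  have ht := (tendsto_error (A := univ) h2 h3').const_mul L
  rw [mul_zero] at ht
  exact eventually_abs_maxSol_sub_sqrt_le ht (by simpa using ht.sqrt)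
    (Eventually.of_forall fun z => Real.sqrt_nonneg _) hbd
    (fun x _ => P_nonneg_of_eq_c3star h1.le h2.ge h3) hδ

lemma eq_neg_half_of_snd_eq_zero (hc : c ≠ 0) (h1 : 0 ≤ c.1) (h2 : c.2.1 = 0)
    (h3 : c.2.2 = c3star c.1 c.2.1) : 0 < c.1 ∧ c.2.2 = -c.1 / 2 := by
  have e1 := Real.sq_sqrt h1
  have e3 : c.2.2 = -c.1 / 2 := by
    rw [h3, h2, c3star, c3bar]
    simp only [ne_eq, OfNat.ofNat_ne_zero, not_false_eq_true, zero_pow, zero_add, mul_zero,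
      add_zero, Real.sqrt_zero]
    linear_combination (-1 / 2) * e1
  refine ⟨lt_of_le_of_ne h1 fun h => hc ?_, e3⟩
  exact Prod.ext h.symm (Prod.ext h2 (by rw [e3, ← h]; simp))

lemma reflect_ne_zero (hc : c ≠ 0) : reflect c ≠ 0 := fun h => hc <| by
  rw [← reflect_reflect c, h]; rfl

end

end AxisymNS

end

theorem theorem1p6 (c : ℝ × ℝ × ℝ) (hc : c ≠ 0) (hc3 : c.2.2 = c3star c.1 c.2.1) :
    -- (i)
    ((∀ (ν : ℕ → ℝ) (ck : ℕ → ℝ × ℝ × ℝ), IsVanishing c ν ck → (∀ k, ck k ∈ J 0) →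
        Tendsto (fun k => linfNorm fun x => upperSol (ν k) (ck k) x - √(2 * P c x))
          atTop (𝓝 0) ∧
        Tendsto (fun k => linfNorm fun x => lowerSol (ν k) (ck k) x + √(2 * P c x))
          atTop (𝓝 0)) ∧
      (∀ ε : ℝ, 0 < ε → ∀ β : ℝ≥0, 0 < β → (β : ℝ) < 2 / 3 → ∃ C : ℝ,
        ∀ (ν : ℕ → ℝ) (ck : ℕ → ℝ × ℝ × ℝ), IsVanishing c ν ck → (∀ k, ck k ∈ J 0) →
          ∀ᶠ k in atTop,
            linfNorm (fun x => 1 / 2 * upperSol (ν k) (ck k) x ^ 2 - P (ck k) x) +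
                ENNReal.ofReal (ν k ^ (β : ℝ)) *
                  holderNorm β (fun x => 1 / 2 * upperSol (ν k) (ck k) x ^ 2 - P (ck k) x)
                    (Ioo (-1 + ε) (1 - ε))
              ≤ ENNReal.ofReal (C * ν k ^ (2 / 3 : ℝ)) ∧
            linfNorm (fun x => 1 / 2 * lowerSol (ν k) (ck k) x ^ 2 - P (ck k) x) +
                ENNReal.ofReal (ν k ^ (β : ℝ)) *
                  holderNorm β (fun x => 1 / 2 * lowerSol (ν k) (ck k) x ^ 2 - P (ck k) x)
                    (Ioo (-1 + ε) (1 - ε))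
              ≤ ENNReal.ofReal (C * ν k ^ (2 / 3 : ℝ))) ∧
      xbar c ∈ Icc (-1 : ℝ) 1 ∧
      (∀ ε : ℝ, 0 < ε → ∀ m : ℕ, ∃ C : ℝ,
        ∀ (ν : ℕ → ℝ) (ck : ℕ → ℝ × ℝ × ℝ), IsVanishing c ν ck → (∀ k, ck k ∈ J 0) →
          ∀ᶠ k in atTop,
            cmNorm m (fun x => upperSol (ν k) (ck k) x - √(2 * P (ck k) x))
                (Icc (-1) (1 - ε) \ Icc (xbar c - ε) (xbar c + ε)) +
              cmNorm m (fun x => lowerSol (ν k) (ck k) x + √(2 * P (ck k) x))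
                (Icc (-1 + ε) 1 \ Icc (xbar c - ε) (xbar c + ε))
              ≤ ENNReal.ofReal (C * ν k))) ∧
    -- (ii)
    (c.2.1 = 0 →
      (∀ (ν : ℕ → ℝ) (ck : ℕ → ℝ × ℝ × ℝ), IsVanishing c ν ck →
        Tendsto (fun k => linfNorm fun x => upperSol (ν k) (ck k) x - √(2 * P c x))
          atTop (𝓝 0) ∧
        Tendsto (fun k => |(ck k).2.1| + |2 * (ck k).2.2 + (ck k).1| ^ 2 + ν k ^ (2 / 3 : ℝ))
          atTop (𝓝 0)) ∧
      ∃ C : ℝ, ∀ (ν : ℕ → ℝ) (ck : ℕ → ℝ × ℝ × ℝ), IsVanishing c ν ck →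
        ∀ᶠ k in atTop,
          linfNorm (fun x => 1 / 2 * upperSol (ν k) (ck k) x ^ 2 - P (ck k) x) ≤
            ENNReal.ofReal (C * (|(ck k).2.1| + |2 * (ck k).2.2 + (ck k).1| ^ 2 +
              ν k ^ (2 / 3 : ℝ)))) ∧
    -- (iii)
    (c.1 = 0 →
      (∀ (ν : ℕ → ℝ) (ck : ℕ → ℝ × ℝ × ℝ), IsVanishing c ν ck →
        Tendsto (fun k => linfNorm fun x => lowerSol (ν k) (ck k) x + √(2 * P c x))
          atTop (𝓝 0) ∧
        Tendsto (fun k => |(ck k).1| + |2 * (ck k).2.2 + (ck k).2.1| ^ 2 + ν k ^ (2 / 3 : ℝ))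
          atTop (𝓝 0)) ∧
      ∃ C : ℝ, ∀ (ν : ℕ → ℝ) (ck : ℕ → ℝ × ℝ × ℝ), IsVanishing c ν ck →
        ∀ᶠ k in atTop,
          linfNorm (fun x => 1 / 2 * lowerSol (ν k) (ck k) x ^ 2 - P (ck k) x) ≤
            ENNReal.ofReal (C * (|(ck k).1| + |2 * (ck k).2.2 + (ck k).2.1| ^ 2 +
              ν k ^ (2 / 3 : ℝ)))) := by
  have hr := reflect_ne_zero hc
  have hr3 := c3star_reflect hc3
  have hPr : ∀ z : ℝ × ℝ × ℝ, ∀ x, P (reflect z) (-x) = P z x := fun z x => by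
    rw [P_reflect, neg_neg]
  -- the lower solution reduces to the upper one by reflection
  have hlow : ∀ (ν : ℕ → ℝ) (ck : ℕ → ℝ × ℝ × ℝ), IsVanishing c ν ck → ∀ k,
      ∀ x ∈ Ioo (-1 : ℝ) 1, -x ∈ Ioo (-1 : ℝ) 1 ∧
        lowerSol (ν k) (ck k) x = -maxSol (ν k) (reflect (ck k)) (-x) := fun ν ck h k x hx =>
    ⟨neg_mem_Ioo_one hx, lowerSol_eq_of_mem_Ioo (h.pos k) (h.mem k) hx⟩
  refine ⟨⟨?_, ?_, xbar_mem c, ?_⟩, ?_, ?_⟩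
  · intro ν ck h hJ
    have hn := h.nonneg
    have hJ' : ∀ k, reflect (ck k) ∈ J 0 := fun k => reflect_mem_J (hJ k)
    constructor
    · refine tendsto_linfNorm_zero fun δ hδ => ?_
      filter_upwards [(h.tendsto_vanFilter hJ).eventually
        (eventually_maxSol_close hn.1 hn.2 hc3 hδ)] with k hk x hx
      rw [upperSol_eq_of_mem_Ioo (h.pos k) (h.mem k) hx]
      exact hk x (Ioo_subset_Ico_self hx)
    · refine tendsto_linfNorm_zero fun δ hδ => ?_
      filter_upwards [(h.reflect.tendsto_vanFilter hJ').eventually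
        (eventually_maxSol_close (c := reflect c) hn.2 hn.1 hr3 hδ)] with k hk x hx
      obtain ⟨hx', hl⟩ := hlow ν ck h k x hx
      have := hk (-x) (Ioo_subset_Ico_self hx')
      rw [hPr] at this
      rwa [hl, neg_add_eq_sub, abs_sub_comm]
  · intro ε hε β hβ hβ1
    have hβ1' : (β : ℝ) < 1 := by linarith
    obtain ⟨a, d, ha, hd, hb⟩ := exists_holder_bound c hε (NNReal.coe_pos.2 hβ) hβ1'
    obtain ⟨a', d', ha', hd', hb'⟩ := exists_holder_bound (reflect c) hε (NNReal.coe_pos.2 hβ) hβ1'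
    have hS : Ioo (-1 + ε) (1 - ε) ⊆ Ioo (-1) 1 := Ioo_subset_Ioo (by linarith) (by linarith)
    refine ⟨(2 * a + d) + (2 * a' + d'), fun ν ck h hJ => ?_⟩
    have hJ' : ∀ k, reflect (ck k) ∈ J 0 := fun k => reflect_mem_J (hJ k)
    filter_upwards [(h.tendsto_vanFilter hJ).eventually hb,
      (h.reflect.tendsto_vanFilter hJ').eventually hb',
      h.tendsto_zero.eventually (Iic_mem_nhds one_pos)] with k hk hk' hν1
    have hν := h.pos k
    constructor
    · refine (linfNorm_add_holderNorm_le hν hν1 ha hd hS (fun x hx => ?_)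
        fun x hx y hy => ?_).trans (ENNReal.ofReal_le_ofReal ?_)
      · rw [upperSol_eq_of_mem_Ioo hν (h.mem k) hx]
        exact hk.1 x hx
      · rw [upperSol_eq_of_mem_Ioo hν (h.mem k) (hS hx),
          upperSol_eq_of_mem_Ioo hν (h.mem k) (hS hy)]
        exact hk.2 x hx y hy
      · exact mul_le_mul_of_nonneg_right (by linarith) (by positivity)
    · refine (linfNorm_add_holderNorm_le hν hν1 ha' hd' hS (fun x hx => ?_)
        fun x hx y hy => ?_).trans (ENNReal.ofReal_le_ofReal ?_)
      · obtain ⟨hx', hl⟩ := hlow ν ck h k x hx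
        have := hk'.1 (-x) hx'
        rwa [hPr, ← neg_sq, ← hl] at this
      · obtain ⟨hx', hl⟩ := hlow ν ck h k x (hS hx)
        obtain ⟨hy', hl'⟩ := hlow ν ck h k y (hS hy)
        have := hk'.2 (-x) ⟨by linarith [hx.2], by linarith [hx.1]⟩ (-y)
          ⟨by linarith [hy.2], by linarith [hy.1]⟩
        rwa [hPr, hPr, ← neg_sq (maxSol _ _ (-x)), ← neg_sq (maxSol _ _ (-y)), ← hl, ← hl',
          neg_sub_neg, abs_sub_comm y x] at this
      · exact mul_le_mul_of_nonneg_right (by linarith) (by positivity)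
  · intro ε hε m
    -- Nonnegativity of $c_1,c_2$ follows only from the existence of a vanishing sequence. If it
    -- fails there is none, and any constant will do.
    by_cases hn : 0 ≤ c.1 ∧ 0 ≤ c.2.1
    · obtain ⟨C, hC, hb⟩ := exists_remainder_bound hc hn.1 hn.2 hc3 hε m
      obtain ⟨C', hC', hb'⟩ := exists_remainder_bound (c := reflect c) hr hn.2 hn.1 hr3 hε m
      refine ⟨(m + 1) * C + (m + 1) * C', fun ν ck h hJ => ?_⟩
      have hJ' : ∀ k, reflect (ck k) ∈ J 0 := fun k => reflect_mem_J (hJ k)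
      filter_upwards [(h.tendsto_vanFilter hJ).eventually hb,
        (h.reflect.tendsto_vanFilter hJ').eventually hb'] with k hk hk'
      have hν := h.pos k
      have e1 := cmNorm_upperSol_le (z := (ν k, ck k)) hν (h.mem k) hε hk
      have e2 := cmNorm_lowerSol_le (z := (ν k, ck k)) hν (h.mem k) hε hk'
      refine (add_le_add e1 e2).trans ?_
      rw [← ENNReal.ofReal_add (by positivity) (by positivity)]
      exact ENNReal.ofReal_le_ofReal (by linarith)
    · exact ⟨0, fun ν ck h _ => absurd h.nonneg hn⟩
  · intro h2
    constructor
    · intro ν ck h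
      obtain ⟨p1, p3⟩ := eq_neg_half_of_snd_eq_zero hc h.nonneg.1 h2 hc3
      have hl := h.tendsto_vanFilter (A := univ) fun _ => mem_univ _
      refine ⟨tendsto_linfNorm_zero fun δ hδ => ?_, (tendsto_error h2 p3).comp hl⟩
      filter_upwards [hl.eventually (eventually_maxSol_close' p1 h2 hc3 p3 hδ)] with k hk x hx
      rw [upperSol_eq_of_mem_Ioo (h.pos k) (h.mem k) hx]
      exact hk x (Ioo_subset_Ico_self hx)
    · by_cases h1 : 0 ≤ c.1
      · obtain ⟨p1, p3⟩ := eq_neg_half_of_snd_eq_zero hc h1 h2 hc3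
        obtain ⟨L, -, hb⟩ := exists_maxSol_bound_of_snd_eq_zero p1 h2 p3
        refine ⟨L, fun ν ck h => ?_⟩
        filter_upwards [(h.tendsto_vanFilter (A := univ) fun _ => mem_univ _).eventually hb]
          with k hk
        refine linfNorm_le fun x hx => ?_
        rw [upperSol_eq_of_mem_Ioo (h.pos k) (h.mem k) hx]
        exact (hk x (Ioo_subset_Ico_self hx)).1
      · exact ⟨0, fun ν ck h => absurd h.nonneg.1 h1⟩
  · intro h2
    constructor
    · intro ν ck h
      obtain ⟨p1, p3⟩ := eq_neg_half_of_snd_eq_zero hr h.nonneg.2 h2 hr3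
      have hl := h.reflect.tendsto_vanFilter (A := univ) fun _ => mem_univ _
      refine ⟨tendsto_linfNorm_zero fun δ hδ => ?_, (tendsto_error (c := reflect c) h2 p3).comp hl⟩
      filter_upwards [hl.eventually (eventually_maxSol_close' p1 h2 hr3 p3 hδ)] with k hk x hx
      obtain ⟨hx', hl⟩ := hlow ν ck h k x hx
      have := hk (-x) (Ioo_subset_Ico_self hx')
      rw [hPr] at this
      rwa [hl, neg_add_eq_sub, abs_sub_comm]
    · by_cases h1 : 0 ≤ c.2.1
      · obtain ⟨p1, p3⟩ := eq_neg_half_of_snd_eq_zero (c := reflect c) hr h1 h2 hr3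
        obtain ⟨L, -, hb⟩ := exists_maxSol_bound_of_snd_eq_zero p1 h2 p3
        refine ⟨L, fun ν ck h => ?_⟩
        filter_upwards [(h.reflect.tendsto_vanFilter (A := univ) fun _ => mem_univ _).eventually hb]
          with k hk
        refine linfNorm_le fun x hx => ?_
        obtain ⟨hx', hl⟩ := hlow ν ck h k x hx
        have := (hk (-x) (Ioo_subset_Ico_self hx')).1
        rwa [hPr, ← neg_sq, ← hl] at this
      · exact ⟨0, fun ν ck h => absurd h.nonneg.2 h1⟩
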